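/- **Setting.** Let $F=G/H=\sum_{r,s\ge 0}a_{r,s}z^rw^s$ near the origin of $\mathbb C^2$, and let $\mathcal V=\{H=0\}$. For $(z,w)\in\mathbb C^2$ put $D(z,w)=\{|z'|\le|z|,\ |w'|\le|w|\}$ and $T(z,w)=\{|z'|=|z|,\ |w'|=|w|\}$. A point $(z,w)\in\mathcal V$ is *minimal* if $\mathcal V\cap D(z,w)\subseteq T(z,w)$, and *strictly minimal* if moreover $\mathcal V\cap D(z,w)$ has exactly one element. It is a *simple pole* if $\nabla H(z,w)\ne 0$. We write $(r,s)\in\mathbf{dir}(z,w)$ if $(r,s)\in\mathbb N^2$ is a nonzero complex multiple of $(zH_z,wH_w)$, evaluated at $(z,w)$. Let $(z,w)$ be a simple pole with $wH_w(z,w)\neq 0$, with $G,H$ analytic in a neighborhood of $D(z,w)$. Let $w'=g(z')$ be the analytic parametrization of $\mathcal V$ near $(z,w)$, and put $$\psi(\zeta)=-\lim_{u\to g(\zeta)}(u-g(\zeta))\frac{F(\zeta,u)}{u},\qquad \tilde\psi(\theta)=\psi(ze^{i\theta}),\qquad \tilde f(\theta)=\log\frac{g(ze^{i\theta})}{g(z)}+i\rho\,\theta,$$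 where $\rho=zH_z/(wH_w)$ is the common value of $r/s$ for $(r,s)\in\mathbf{dir}(z,w)$. Let $k$ be the order of vanishing of $\tilde f$ at $0$, and let $c_k$ be its first nonzero Taylor coefficient, so $\tilde f(x)=c_kx^k+\cdots$. Let $$y(x)=\tilde f(x)^{1/k}=c_k^{1/k}x\Bigl(1+\tfrac{\tilde f(x)-c_kx^k}{c_kx^k}\Bigr)^{1/k}$$ with the argument of $c_k^{1/k}$ in $[-\tfrac{\pi}{2k},\tfrac{\pi}{2k}]$. Let $\eta$ be the inverse function of $y$ near $0$, and let $b_l$ be the Taylor coefficients at $0$ of $(\tilde\psi\circ\eta)\cdot\eta'$. Let $l_0$ be the order to which $G$ vanishes on $\mathcal V$ near $(z,w)$, that is, the largest $l$ with $G(z',w')=O(|z'-z|^l+|w'-w|^l)$ as $(z',w')\to(z,w)$ in $\mathcal V$; it is assumed that such a largest $l$ exists. Put $$A(k,l)=\begin{cases}\frac2k\Gamma\!\left(\frac{l+1}k\right)& k,l\text{ even},\\[2pt] 0& k\text{ even},\ l\text{ odd},\\[2pt] \frac1k\Gamma\!\left(\frac{l+1}k\right)\Bigl(1+(-1)^l e^{i\pi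 (l+1)/k}\Bigr)& k\text{ odd},\end{cases}$$ and let $\mathcal A(k,l)=A(k,l)$ if $\operatorname{Im}c_k\ge0$ and $\mathcal A(k,l)=\overline{A(k,l)}$ otherwise. **Theorem.** Let $K$ be a compact set of strictly minimal simple poles of $F$ such that, at every point $(z,w)$ of $K$, $G$ and $H$ are analytic in a neighborhood of $D(z,w)$ and $wH_w\ne0$, and such that the orders $k$ and $l_0$ are finite and the same at all points of $K$. Then there is a full asymptotic expansion $$a_{r,s}\sim\frac1{2\pi}z^{-r}w^{-s}\sum_{l\ge l_0}\mathcal A(k,l)\,b_l\,s^{-(l+1)/k},$$ uniformly over $(z,w)\in K$ and $(r,s)\in\mathbf{dir}(z,w)$. That is, for every $N\ge 0$ and every $\varepsilon>0$ there is an $S$ such that, for all $(z,w)\in K$ and all $(r,s)\in\mathbf{dir}(z,w)$ with $s\ge S$, $$\Bigl|a_{r,s}-\frac1{2\pi}z^{-r}w^{-s}\sum_{l=l_0}^{N}\mathcal A(k,l)\,b_l\,s^{-(l+1)/k}\Bigr|\le\varepsilon\,|z^{-r}w^{-s}|\,s^{-(N+1)/k}.$$ The case $K=\{(z,w)\}$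 is the expansion at a single strictly minimal simple pole. -/

import Mathlib

open Filter Topology

noncomputable section

namespace SmoothPole

/-! ### Geometry of the zero set of `H` -/

/-- The set `𝒱` where `H` vanishes. -/
def zeroSet (H : ℂ × ℂ → ℂ) : Set (ℂ × ℂ) := {q | H q = 0}

/-- The torus `T(p)` of points with the same coordinatewise moduli as `p`. -/
def torus (p : ℂ × ℂ) : Set (ℂ × ℂ) := {q | ‖q.1‖ = ‖p.1‖ ∧ ‖q.2‖ = ‖p.2‖}

/-- The closed polydisk `D(p)`. -/
def polydisk (p : ℂ × ℂ) : Set (ℂ × ℂ) := {q | ‖q.1‖ ≤ ‖p.1‖ ∧ ‖q.2‖ ≤ ‖p.2‖}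

/-- `p ∈ 𝒱` is minimal if `𝒱 ∩ D(p) ⊆ T(p)`. -/
def IsMinimal (H : ℂ × ℂ → ℂ) (p : ℂ × ℂ) : Prop :=
  p ∈ zeroSet H ∧ zeroSet H ∩ polydisk p ⊆ torus p

/-- A minimal point is strictly minimal if `𝒱 ∩ D(p)` has cardinality one. -/
def IsStrictlyMinimal (H : ℂ × ℂ → ℂ) (p : ℂ × ℂ) : Prop :=
  IsMinimal H p ∧ (zeroSet H ∩ polydisk p).encard = 1

/-- The partial derivative `H_z` at `p`. -/
def partialZ (H : ℂ × ℂ → ℂ) (p : ℂ × ℂ) : ℂ := deriv (fun ζ => H (ζ, p.2)) p.1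

/-- The partial derivative `H_w` at `p`. -/
def partialW (H : ℂ × ℂ → ℂ) (p : ℂ × ℂ) : ℂ := deriv (fun u => H (p.1, u)) p.2

/-- A simple pole of `G / H`: `H` vanishes at `p` but its gradient does not. -/
def IsSimplePole (H : ℂ × ℂ → ℂ) (p : ℂ × ℂ) : Prop :=
  p ∈ zeroSet H ∧ (partialZ H p ≠ 0 ∨ partialW H p ≠ 0)

/-- `(r, s) ∈ dir(p)`: the vector `(r, s)` is a nonzero complex multiple of `(z H_z, w H_w)`. -/
def InDir (H : ℂ × ℂ → ℂ) (p : ℂ × ℂ) (r s : ℕ) : Prop :=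
  ∃ c : ℂ, c ≠ 0 ∧ (r : ℂ) = c * (p.1 * partialZ H p) ∧ (s : ℂ) = c * (p.2 * partialW H p)

/-- The slope `z H_z / (w H_w)` of `dir(p)`, i.e. the common value of `r / s` for
`(r, s) ∈ dir(p)`. -/
def dirSlope (H : ℂ × ℂ → ℂ) (p : ℂ × ℂ) : ℂ :=
  (p.1 * partialZ H p) / (p.2 * partialW H p)

/-- `l` is the order to which `G` vanishes on `𝒱` near `p`: the largest `l` with
`G(z', w') = O(|z' - z| ^ l + |w' - w| ^ l)` as `(z', w') → p` in `𝒱`. -/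
def IsVanishingOrderOn (G H : ℂ × ℂ → ℂ) (p : ℂ × ℂ) (l : ℕ) : Prop :=
  IsGreatest {j : ℕ | G =O[𝓝[zeroSet H] p]
    fun q => ‖q.1 - p.1‖ ^ j + ‖q.2 - p.2‖ ^ j} l

/-! ### The functions `g`, `ψ`, `f` and their versions in the angle `θ`

The angle is allowed to be a complex number near `0`; this is the analytic continuation of the
corresponding function of a real angle, and has the same Taylor coefficients at `0`. -/

/-- `g` is an analytic function whose graph `w' = g(z')` is `𝒱` near `p`. -/
def IsZeroParam (H : ℂ × ℂ → ℂ) (p : ℂ × ℂ) (g : ℂ → ℂ) : Prop :=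
  AnalyticAt ℂ g p.1 ∧ g p.1 = p.2 ∧ ∀ᶠ q in 𝓝 p, (H q = 0 ↔ q.2 = g q.1)

/-- The parametrization `g` of `𝒱` near `p`.  It exists when `H` is analytic at `p`, `H p = 0`
and `H_w ≠ 0` there, and its germ at `p.1` is unique. -/
def zeroParam (H : ℂ × ℂ → ℂ) (p : ℂ × ℂ) : ℂ → ℂ := Classical.epsilon (IsZeroParam H p)

theorem zeroParam_spec {H : ℂ × ℂ → ℂ} {p : ℂ × ℂ} (hH : AnalyticAt ℂ H p) (h0 : H p = 0)
    (hw : partialW H p ≠ 0) : IsZeroParam H p (zeroParam H p) := by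
  refine Classical.epsilon_spec (p := IsZeroParam H p) ?_
  have hd : HasDerivAt (fun u => H (p.1, u)) (fderiv ℂ H p (0, 1)) p.2 := by
    have h1 : HasFDerivAt H (fderiv ℂ H p) (p.1, p.2) := hH.differentiableAt.hasFDerivAt
    have h2 : HasDerivAt (fun u : ℂ => (p.1, u)) ((0 : ℂ), (1 : ℂ)) p.2 :=
      (hasDerivAt_const _ _).prodMk (hasDerivAt_id _)
    exact h1.comp_hasDerivAt p.2 h2
  have hne : fderiv ℂ H p (0, 1) ≠ 0 := by
    rw [← hd.deriv]; exact hw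
  have hinv : (fderiv ℂ H p ∘L .inr ℂ ℂ ℂ).IsInvertible := by
    refine ⟨ContinuousLinearEquiv.unitsEquivAut ℂ (Units.mk0 _ hne), ?_⟩
    ext
    simp
  have hc : ContDiffAt ℂ ⊤ H p := hH.contDiffAt
  refine ⟨hc.implicitFunction (by simp) hinv,
    (hc.contDiffAt_implicitFunction (by simp) hinv).analyticAt,
    hc.implicitFunction_apply_self _ hinv, ?_⟩
  filter_upwards [hc.eventually_apply_eq_iff_implicitFunction (by simp) hinv] with v hv
  rw [← h0, hv, eq_comm]

/-- `ψ(ζ) = - lim_{u → g(ζ)} (u - g(ζ)) F(ζ, u) / u` with `F = G / H`. -/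
def psi (G H : ℂ × ℂ → ℂ) (p : ℂ × ℂ) (ζ : ℂ) : ℂ :=
  - limUnder (𝓝[≠] (zeroParam H p ζ))
      (fun u => (u - zeroParam H p ζ) * ((G (ζ, u) / H (ζ, u)) / u))

/-- The map `M(θ) = z e^{iθ}`. -/
def angleMap (p : ℂ × ℂ) (θ : ℂ) : ℂ := p.1 * Complex.exp (Complex.I * θ)

/-- `ψ̃ = ψ ∘ M`. -/
def psiTilde (G H : ℂ × ℂ → ℂ) (p : ℂ × ℂ) (θ : ℂ) : ℂ := psi G H p (angleMap p θ)

/-- `f̃(θ) = log (g(z e^{iθ}) / g(z)) + i (r / s) θ`, where `r / s` is the slope of `dir(p)`. -/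
def fTilde (H : ℂ × ℂ → ℂ) (p : ℂ × ℂ) (θ : ℂ) : ℂ :=
  Complex.log (zeroParam H p (angleMap p θ) / zeroParam H p p.1)
    + Complex.I * dirSlope H p * θ

/-! ### The expansion coefficients -/

/-- The `j`-th Taylor coefficient of `f` at `0`. -/
def taylorCoeff (f : ℂ → ℂ) (j : ℕ) : ℂ := iteratedDeriv j f 0 / (j.factorial : ℂ)

/-- `y(x) = f(x)^{1/k} = c_k^{1/k} x (1 + (f(x) - c_k x^k) / (c_k x^k))^{1/k}`, with principal
powers.  When `Re c_k ≥ 0` the argument of `c_k^{1/k}` is in `[-π/(2k), π/(2k)]`. -/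
def rootPhase (f : ℂ → ℂ) (k : ℕ) (x : ℂ) : ℂ :=
  taylorCoeff f k ^ (1 / (k : ℂ)) * x *
    (1 + (f x - taylorCoeff f k * x ^ k) / (taylorCoeff f k * x ^ k)) ^ (1 / (k : ℂ))

/-- `η` is an analytic inverse of `y` near `0`. -/
def IsInverseAtZero (y η : ℂ → ℂ) : Prop :=
  AnalyticAt ℂ η 0 ∧ η 0 = 0 ∧ (∀ᶠ x in 𝓝 0, η (y x) = x) ∧ ∀ᶠ t in 𝓝 0, y (η t) = t

/-- The inverse function `η` of `y` near `0`.  It exists when `y` is analytic at `0` with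
`y 0 = 0` and `y' 0 ≠ 0`, and its germ at `0` is unique. -/
def inverseAtZero (y : ℂ → ℂ) : ℂ → ℂ := Classical.epsilon (IsInverseAtZero y)

theorem inverseAtZero_spec {y : ℂ → ℂ} (hy : AnalyticAt ℂ y 0) (h0 : y 0 = 0)
    (h1 : deriv y 0 ≠ 0) : IsInverseAtZero y (inverseAtZero y) := by
  refine Classical.epsilon_spec (p := IsInverseAtZero y) ?_
  have hs : HasStrictDerivAt y (deriv y 0) 0 := hy.hasStrictDerivAt
  refine ⟨hs.localInverse y _ 0 h1, ?_, ?_, ?_, ?_⟩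
  · have := hy.analyticAt_localInverse h1
    rwa [h0] at this
  · have := (hs.hasStrictFDerivAt_equiv h1).localInverse_apply_image
    rwa [h0] at this
  · exact (hs.hasStrictFDerivAt_equiv h1).eventually_left_inverse
  · have := (hs.hasStrictFDerivAt_equiv h1).eventually_right_inverse
    rwa [h0] at this

/-- The Taylor coefficients `b_l` of `(ψ̃ ∘ η) · η'`, where `η` inverts `y = f̃^{1/k}`. -/
def bCoeff (G H : ℂ × ℂ → ℂ) (p : ℂ × ℂ) (k l : ℕ) : ℂ :=
  taylorCoeff (fun t =>
    psiTilde G H p (inverseAtZero (rootPhase (fTilde H p) k) t)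
      * deriv (inverseAtZero (rootPhase (fTilde H p) k)) t) l

/-- The constants `A(k, l)`, with the convention `Im c_k ≥ 0`. -/
def constA (k l : ℕ) : ℂ :=
  if Even k then
    if Even l then ((2 / (k : ℝ) * Real.Gamma (((l : ℝ) + 1) / k) : ℝ) : ℂ) else 0
  else
    ((1 / (k : ℝ) * Real.Gamma (((l : ℝ) + 1) / k) : ℝ) : ℂ) *
      (1 + (-1) ^ l * Complex.exp (Complex.I * Real.pi * (((l : ℂ) + 1) / k)))

/-- The constants `𝒜(k, l)`: equal to `A(k, l)` if `Im c ≥ 0` and to its complex conjugate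
otherwise, where `c` is the leading Taylor coefficient `c_k` of `f̃`. -/
def constScriptA (c : ℂ) (k l : ℕ) : ℂ :=
  if 0 ≤ c.im then constA k l else (starRingEnd ℂ) (constA k l)

/-- The terms of index `l₀ ≤ l ≤ N` of `∑ 𝒜(k, l) b_l s^{-(l+1)/k}`. -/
def expansionSum (G H : ℂ × ℂ → ℂ) (p : ℂ × ℂ) (k l₀ N s : ℕ) : ℂ :=
  ∑ l ∈ Finset.Icc l₀ N,
    constScriptA (taylorCoeff (fTilde H p) k) k l * bCoeff G H p k l *
      (((s : ℝ) ^ (-(((l : ℝ) + 1) / (k : ℝ))) : ℝ) : ℂ)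

end SmoothPole

end

open Filter Topology

noncomputable section

namespace SmoothPole

open Metric Set MeasureTheory

/-! ### Taylor coefficients -/

/-! The coefficient is an iterated Cauchy integral over a small torus. Minimality of `(z, w)` allows
the outer circle to be moved to `|ζ| = |z|` while the inner circle stays at a small radius `ρ`. On
each fibre `ζ = z e^{iθ}` the inner circle is then enlarged to some `R > |w|`, where its integral is
`O(R^{-s})`, exponentially smaller than `|w|^{-s}`. By strict minimality no pole is crossed when `θ`
is away from `0`; when `θ` is near `0` exactly one is crossed, the simple pole at `g(ζ)`, and its
residue contributes `ψ(ζ) g(ζ)^{-s}`. Since `r = ρ s` with `ρ` now the slope, multiplying by `z^r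
w^s` leaves `(1/2π) ∫_{-δ}^{δ} ψ̃ e^{-s f̃} dθ` up to an exponentially small error
(`exists_near_bound`, `exists_far_bound`, `exists_coeff_sub_integral_le`).

Minimality also gives `Re f̃(θ) = log |g(z e^{iθ})/w| ≥ 0` for real `θ` near `0`, with strict
inequality for small `θ ≠ 0`. In the coordinate `y = f̃^{1/k}` the integrand becomes `B(y) e^{-s
y^k} dy` with `B = (ψ̃ ∘ η) η'`. This has a primitive `Q` on a disk, so the integral is `Q(y(δ)) -
Q(y(-δ))` and the path between the endpoints no longer matters. Each endpoint is reached from `0`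
along a ray `t ω` with `ω^k = 1`, on which `y^k = t^k` and Taylor expansion of `B` produces Gamma
values, followed by an arc on which `Re y^k` stays bounded below, so that it is negligible
(`exists_endpoint_bound`). The ray is `ω = 1` for `y(δ)` and `ω = negRay` for `y(-δ)`; the
difference `1 - ω^{l+1}` of the two contributions is what the constants `𝒜(k, l)` record
(`constScriptA_mul`).

Uniformity comes from making every estimate depend only on a radius of analyticity, sup bounds, a
lower bound for `|c_k|` and a lower bound for `Re f̃(±δ)`. Since `g`, `f̃` and `ψ̃` are jointly
analytic in the point and the angle, these data can be fixed on a neighbourhood of each `p₀ ∈ K`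
(`exists_local_expansion`), and compactness finishes. The order `l₀` enters only through `b_l = 0`
for `l < l₀`. -/

theorem taylorCoeff_congr {f g : ℂ → ℂ} (h : f =ᶠ[𝓝 0] g) (j : ℕ) :
    taylorCoeff f j = taylorCoeff g j := by
  rw [taylorCoeff, taylorCoeff, h.iteratedDeriv_eq]

theorem taylorCoeff_zero (f : ℂ → ℂ) : taylorCoeff f 0 = f 0 := by
  simp [taylorCoeff]

theorem taylorCoeff_eq_coeff {f : ℂ → ℂ} {p : FormalMultilinearSeries ℂ ℂ ℂ}
    (h : HasFPowerSeriesAt f p 0) (j : ℕ) : taylorCoeff f j = p.coeff j := by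
  have h' := h.analyticAt.hasFPowerSeriesAt
  rw [h.eq_formalMultilinearSeries h', FormalMultilinearSeries.coeff_ofScalars, taylorCoeff]

theorem taylorCoeff_succ {f : ℂ → ℂ} (hf : AnalyticAt ℂ f 0) (n : ℕ) :
    taylorCoeff f (n + 1) = taylorCoeff (dslope f 0) n := by
  obtain ⟨p, hp⟩ := hf
  rw [taylorCoeff_eq_coeff hp, taylorCoeff_eq_coeff hp.has_fpower_series_dslope_fslope,
    FormalMultilinearSeries.coeff_fslope]

theorem analyticAt_dslope {f : ℂ → ℂ} {c : ℂ} (hf : AnalyticAt ℂ f c) :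
    AnalyticAt ℂ (dslope f c) c := by
  obtain ⟨p, hp⟩ := hf
  exact hp.has_fpower_series_dslope_fslope.analyticAt

/-- Off `0` this is cancellation; at `0` the slope of `x u(x)` is `u(x)`, so continuity of `u`
already gives the derivative `u(0)`. -/
theorem dslope_id_mul {u : ℂ → ℂ} (hu : ContinuousAt u 0) :
    dslope (fun x => x * u x) 0 = u := by
  have h := dslope_sub_smul u 0
  simp only [sub_zero, smul_eq_mul] at h
  have hd : HasDerivAt (fun x => x * u x) (u 0) 0 := by
    rw [hasDerivAt_iff_tendsto_slope]
    refine (hu.tendsto.mono_left nhdsWithin_le_nhds).congr' ?_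
    filter_upwards [self_mem_nhdsWithin] with x hx
    have hx' : x ≠ 0 := hx
    simp [slope_def_field, hx']
  rw [h, hd.deriv, Function.update_eq_self]

theorem taylorCoeff_pow_mul {g : ℂ → ℂ} (hg : AnalyticAt ℂ g 0) (k : ℕ) :
    taylorCoeff (fun x => x ^ k * g x) k = g 0 := by
  induction k with
  | zero => simp [taylorCoeff_zero]
  | succ k ih =>
    have ha : AnalyticAt ℂ (fun x : ℂ => x ^ k * g x) 0 := (analyticAt_id.pow k).mul hg
    have he : (fun x : ℂ => x ^ (k + 1) * g x) = fun x => x * (x ^ k * g x) := by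
      ext x; ring
    have hm : AnalyticAt ℂ (fun x : ℂ => x * (x ^ k * g x)) 0 := analyticAt_id.mul ha
    rw [he, taylorCoeff_succ hm, dslope_id_mul ha.continuousAt, ih]

theorem taylorCoeff_eq_zero_of_isBigO {f : ℂ → ℂ} (hf : AnalyticAt ℂ f 0) {n : ℕ}
    (h : f =O[𝓝 0] fun x => x ^ n) {j : ℕ} (hj : j < n) : taylorCoeff f j = 0 := by
  induction n generalizing f j with
  | zero => omega
  | succ n ih =>
    have h0 : f 0 = 0 := by
      obtain ⟨C, hC⟩ := h.bound
      have := hC.self_of_nhds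
      simpa using this
    cases j with
    | zero => rw [taylorCoeff_zero, h0]
    | succ j =>
      rw [taylorCoeff_succ hf]
      have ha := analyticAt_dslope hf
      refine ih ha ?_ (by omega)
      have hp : dslope f 0 =O[𝓝[≠] 0] fun x => x ^ n := by
        obtain ⟨C, hC⟩ := h.bound
        refine Asymptotics.IsBigO.of_bound C ?_
        filter_upwards [hC.filter_mono nhdsWithin_le_nhds, self_mem_nhdsWithin] with x hx hx0
        have hx0' : x ≠ 0 := hx0
        rw [dslope_of_ne _ hx0', slope_def_field, h0, sub_zero, sub_zero, norm_div,
          div_le_iff₀ (norm_pos_iff.2 hx0')]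
        simpa [pow_succ, mul_assoc] using hx
      -- The bound is known only off `0`; both sides are continuous, so it passes to the limit.
      have hz : ‖dslope f 0 0‖ ≤ (hp.bound.choose) * ‖(0 : ℂ) ^ n‖ := by
        have hb := hp.bound.choose_spec
        refine le_of_tendsto_of_tendsto (b := 𝓝[≠] (0 : ℂ))
          (ha.continuousAt.norm.tendsto.mono_left nhdsWithin_le_nhds) ?_ hb
        have : ContinuousAt (fun x : ℂ => hp.bound.choose * ‖x ^ n‖) 0 := by fun_prop
        exact this.tendsto.mono_left nhdsWithin_le_nhds
      refine Asymptotics.IsBigO.of_bound hp.bound.choose ?_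
      have hb := eventually_nhdsWithin_iff.1 hp.bound.choose_spec
      filter_upwards [hb] with x hx
      by_cases hx0 : x = 0
      · rw [hx0]; exact hz
      · exact hx hx0

/-- Schwarz's lemma applied to `f - f(0)`, which is bounded by `2M`. Each division by `x` costs a
factor `2/r`, the origin of the powers `(2/r)^n` below. -/
theorem norm_dslope_le {f : ℂ → ℂ} {r M : ℝ} (hf : DifferentiableOn ℂ f (ball 0 r))
    (hM : ∀ x ∈ ball (0 : ℂ) r, ‖f x‖ ≤ M) (hr : 0 < r) :
    ∀ x ∈ ball (0 : ℂ) r, ‖dslope f 0 x‖ ≤ M * (2 / r) := by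
  intro x hx
  have h := Complex.norm_dslope_le_div_of_mapsTo_ball (R₂ := 2 * M) hf (fun y hy => ?_) hx
  · calc _ ≤ _ := h
      _ = _ := by ring
  · rw [mem_closedBall, dist_eq_norm]
    calc ‖f y - f 0‖ ≤ ‖f y‖ + ‖f 0‖ := norm_sub_le _ _
      _ ≤ 2 * M := by linarith [hM y hy, hM 0 (mem_ball_self hr)]

/-- Taylor's formula on a disk, with a remainder factor controlled by a bound on the disk. -/
theorem exists_taylor_factor {f : ℂ → ℂ} {r M : ℝ} (hr : 0 < r)
    (hf : DifferentiableOn ℂ f (ball 0 r)) (hM : ∀ x ∈ ball (0 : ℂ) r, ‖f x‖ ≤ M) (n : ℕ) :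
    ∃ h : ℂ → ℂ, DifferentiableOn ℂ h (ball 0 r) ∧ h 0 = taylorCoeff f n ∧
      ∀ x ∈ ball (0 : ℂ) r, ‖h x‖ ≤ M * (2 / r) ^ n ∧
        f x = ∑ l ∈ Finset.range n, taylorCoeff f l * x ^ l + x ^ n * h x := by
  induction n generalizing f M with
  | zero => exact ⟨f, hf, (taylorCoeff_zero f).symm, fun x hx => by simpa using hM x hx⟩
  | succ n ih =>
    have ha : AnalyticAt ℂ f 0 := hf.analyticAt (ball_mem_nhds 0 hr)
    have hd : DifferentiableOn ℂ (dslope f 0) (ball 0 r) :=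
      (Complex.differentiableOn_dslope (ball_mem_nhds 0 hr)).2 hf
    obtain ⟨h, h1, h2, h3⟩ := ih hd (norm_dslope_le hf hM hr)
    refine ⟨h, h1, by rw [h2, taylorCoeff_succ ha], fun x hx => ⟨?_, ?_⟩⟩
    · calc _ ≤ _ := (h3 x hx).1
        _ = _ := by ring
    · have hs : x * dslope f 0 x = f x - f 0 := by
        simpa using sub_smul_dslope f 0 x
      have hl : ∀ l ∈ Finset.range n, taylorCoeff f (l + 1) * x ^ (l + 1)
          = x * (taylorCoeff (dslope f 0) l * x ^ l) := by
        intro l _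
        rw [taylorCoeff_succ ha]; ring
      rw [Finset.sum_range_succ', taylorCoeff_zero, Finset.sum_congr rfl hl, ← Finset.mul_sum]
      rw [(h3 x hx).2] at hs
      linear_combination -hs

theorem norm_taylorCoeff_le_and_remainder {f : ℂ → ℂ} {r M : ℝ} (hr : 0 < r)
    (hf : DifferentiableOn ℂ f (ball 0 r)) (hM : ∀ x ∈ ball (0 : ℂ) r, ‖f x‖ ≤ M) (n : ℕ) :
    ‖taylorCoeff f n‖ ≤ M * (2 / r) ^ n ∧ ∀ x ∈ ball (0 : ℂ) r,
      ‖f x - ∑ l ∈ Finset.range n, taylorCoeff f l * x ^ l‖ ≤ M * (2 / r) ^ n * ‖x‖ ^ n := by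
  obtain ⟨h, -, h0, h1⟩ := exists_taylor_factor hr hf hM n
  refine ⟨h0 ▸ (h1 0 (mem_ball_self hr)).1, fun x hx => ?_⟩
  rw [(h1 x hx).2, add_sub_cancel_left, norm_mul, norm_pow, mul_comm]
  exact mul_le_mul_of_nonneg_right (h1 x hx).1 (by positivity)

/-! ### Laplace integrals along a segment -/

/-- `∫₀^∞ t ^ l e^{- s t ^ k} dt`, in closed form. -/
def laplaceMoment (k l : ℕ) (s : ℝ) : ℝ :=
  1 / (k : ℝ) * Real.Gamma (((l : ℝ) + 1) / k) * s ^ (-(((l : ℝ) + 1) / (k : ℝ)))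

theorem integral_pow_mul_exp_neg {k : ℕ} (hk : 1 ≤ k) (l : ℕ) {s : ℝ} (hs : 0 < s) :
    ∫ t in Ioi (0 : ℝ), t ^ l * Real.exp (-s * t ^ k) = laplaceMoment k l s := by
  have h := integral_rpow_mul_exp_neg_mul_rpow (p := k) (q := l) (b := s)
    (by exact_mod_cast hk) (by linarith [(Nat.cast_nonneg l : (0 : ℝ) ≤ l)]) hs
  simp only [Real.rpow_natCast] at h
  rw [h, laplaceMoment, neg_div]
  ring

theorem integrableOn_pow_mul_exp_neg {k : ℕ} (hk : 1 ≤ k) (l : ℕ) {s : ℝ} (hs : 0 < s) :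
    IntegrableOn (fun t : ℝ => t ^ l * Real.exp (-s * t ^ k)) (Ioi 0) := by
  have h := integrableOn_rpow_mul_exp_neg_mul_rpow (p := k) (s := l) (b := s)
    (by linarith [(Nat.cast_nonneg l : (0 : ℝ) ≤ l)]) (by exact_mod_cast hk) hs
  simpa only [Real.rpow_natCast] using h

theorem laplaceMoment_nonneg (k l : ℕ) {s : ℝ} (hs : 0 < s) : 0 ≤ laplaceMoment k l s := by
  have : 0 ≤ Real.Gamma (((l : ℝ) + 1) / k) := Real.Gamma_nonneg_of_nonneg (by positivity)
  unfold laplaceMoment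
  positivity

/-- The tail beyond `R` is compared with a higher moment through `1 ≤ (t/R)^{n-l}`, so truncating
any moment of order `l ≤ n` costs no more than the order of the remainder. -/
theorem abs_integral_sub_laplaceMoment_le {k : ℕ} (hk : 1 ≤ k) {l n : ℕ} (hl : l ≤ n) {s R : ℝ}
    (hs : 0 < s) (hR : 0 < R) :
    |(∫ t in (0 : ℝ)..R, t ^ l * Real.exp (-s * t ^ k)) - laplaceMoment k l s|
      ≤ (R⁻¹) ^ (n - l) * laplaceMoment k n s := by
  have hi := integrableOn_pow_mul_exp_neg hk l hs
  have hin := integrableOn_pow_mul_exp_neg hk n hs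
  have hsub : Ioi R ⊆ Ioi (0 : ℝ) := Ioi_subset_Ioi hR.le
  have h1 : laplaceMoment k l s = (∫ t in (0 : ℝ)..R, t ^ l * Real.exp (-s * t ^ k))
      + ∫ t in Ioi R, t ^ l * Real.exp (-s * t ^ k) := by
    rw [← integral_pow_mul_exp_neg hk l hs,
      ← intervalIntegral.integral_interval_add_Ioi hi (hi.mono_set hsub)]
  have h0 : 0 ≤ ∫ t in Ioi R, t ^ l * Real.exp (-s * t ^ k) :=
    setIntegral_nonneg measurableSet_Ioi fun t ht => by
      have : 0 < t := hR.trans ht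
      positivity
  rw [h1, sub_add_cancel_left, abs_neg, abs_of_nonneg h0]
  calc ∫ t in Ioi R, t ^ l * Real.exp (-s * t ^ k)
      ≤ ∫ t in Ioi R, (R⁻¹) ^ (n - l) * (t ^ n * Real.exp (-s * t ^ k)) := by
        refine setIntegral_mono_on (hi.mono_set hsub) ((hin.mono_set hsub).const_mul _)
          measurableSet_Ioi fun t ht => ?_
        have ht0 : 0 < t := hR.trans ht
        have h2 : 1 ≤ (R⁻¹ * t) ^ (n - l) := by
          refine one_le_pow₀ ?_
          rw [inv_mul_eq_div, one_le_div hR]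
          exact (le_of_lt ht)
        have h3 : t ^ n = t ^ (n - l) * t ^ l := by rw [← pow_add]; congr 1; omega
        calc t ^ l * Real.exp (-s * t ^ k)
            ≤ (R⁻¹ * t) ^ (n - l) * (t ^ l * Real.exp (-s * t ^ k)) :=
              le_mul_of_one_le_left (by positivity) h2
          _ = _ := by rw [h3, mul_pow]; ring
    _ = (R⁻¹) ^ (n - l) * ∫ t in Ioi R, t ^ n * Real.exp (-s * t ^ k) := by
        rw [integral_const_mul]
    _ ≤ _ := by
        rw [← integral_pow_mul_exp_neg hk n hs]
        refine mul_le_mul_of_nonneg_left ?_ (by positivity)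
        refine setIntegral_mono_set hin ?_ (LE.le.eventuallyLE hsub)
        filter_upwards [ae_restrict_mem measurableSet_Ioi] with t ht
        have : (0 : ℝ) < t := ht
        simp only [Pi.zero_apply]
        positivity

/-- Watson's lemma: the Taylor polynomial of `B` is integrated term by term and the remainder is at
most a constant times `t^n`. The lower bound `R₀` for `R` keeps the constant independent of `R`. -/
theorem norm_integral_sub_sum_laplaceMoment_le {k : ℕ} (hk : 1 ≤ k) {B : ℂ → ℂ} {r M R₀ R s : ℝ}
    {ω : ℂ} (hr : 0 < r) (hB : DifferentiableOn ℂ B (ball 0 r))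
    (hM : ∀ x ∈ ball (0 : ℂ) r, ‖B x‖ ≤ M) (hω : ‖ω‖ = 1) (hR₀ : 0 < R₀) (hR : R₀ ≤ R)
    (hRr : R < r) (hs : 0 < s) (n : ℕ) :
    ‖(∫ t in (0 : ℝ)..R, B (t * ω) * ω * (Real.exp (-s * t ^ k) : ℂ))
        - ∑ l ∈ Finset.range n, taylorCoeff B l * ω ^ (l + 1) * (laplaceMoment k l s : ℂ)‖
      ≤ ((∑ l ∈ Finset.range n, M * (2 / r) ^ l * (R₀⁻¹) ^ (n - l)) + M * (2 / r) ^ n)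
          * laplaceMoment k n s := by
  have hR0 : 0 < R := hR₀.trans_le hR
  have hM0 : 0 ≤ M := (norm_nonneg _).trans (hM 0 (mem_ball_self hr))
  have hmem : ∀ t ∈ Icc (0 : ℝ) R, (t : ℂ) * ω ∈ ball (0 : ℂ) r := by
    intro t ht
    rw [mem_ball_zero_iff, norm_mul, hω, mul_one, Complex.norm_real, Real.norm_eq_abs,
      abs_of_nonneg ht.1]
    exact ht.2.trans_lt hRr
  have hcB : ContinuousOn (fun t : ℝ => B (t * ω)) (Icc 0 R) :=
    hB.continuousOn.comp (by fun_prop) hmem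
  set I : ℕ → ℝ := fun l => ∫ t in (0 : ℝ)..R, t ^ l * Real.exp (-s * t ^ k) with hI
  have hsplit : (∫ t in (0 : ℝ)..R, B (t * ω) * ω * (Real.exp (-s * t ^ k) : ℂ))
      = (∫ t in (0 : ℝ)..R, (B (t * ω) - ∑ l ∈ Finset.range n, taylorCoeff B l * (t * ω) ^ l) * ω *
          (Real.exp (-s * t ^ k) : ℂ))
        + ∑ l ∈ Finset.range n, taylorCoeff B l * ω ^ (l + 1) * (I l : ℂ) := by
    have e1 : ∀ l ∈ Finset.range n, taylorCoeff B l * ω ^ (l + 1) * (I l : ℂ)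
        = ∫ t in (0 : ℝ)..R, taylorCoeff B l * ω ^ (l + 1) *
          ((t ^ l * Real.exp (-s * t ^ k) : ℝ) : ℂ) := by
      intro l _
      rw [intervalIntegral.integral_const_mul, intervalIntegral.integral_ofReal]
    rw [Finset.sum_congr rfl e1, ← intervalIntegral.integral_finsetSum,
      ← intervalIntegral.integral_add]
    · refine intervalIntegral.integral_congr fun t _ => ?_
      have e2 : ∑ l ∈ Finset.range n, taylorCoeff B l * ω ^ (l + 1) *
          ((t ^ l * Real.exp (-s * t ^ k) : ℝ) : ℂ)
          = (∑ l ∈ Finset.range n, taylorCoeff B l * (t * ω) ^ l) * ω *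
            (Real.exp (-s * t ^ k) : ℂ) := by
        rw [Finset.sum_mul, Finset.sum_mul]
        refine Finset.sum_congr rfl fun l _ => ?_
        push_cast
        ring
      simp only [e2]
      ring
    · refine ContinuousOn.intervalIntegrable ?_
      rw [uIcc_of_le hR0.le]
      exact ((hcB.sub (by fun_prop)).mul continuousOn_const).mul (by fun_prop)
    · exact Continuous.intervalIntegrable (by fun_prop) _ _
    · intro l _
      exact Continuous.intervalIntegrable (by fun_prop) _ _
  rw [hsplit, add_sub_assoc, ← Finset.sum_sub_distrib]
  refine (norm_add_le _ _).trans ?_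
  rw [add_mul, add_comm]
  refine add_le_add ?_ ?_
  · rw [Finset.sum_mul]
    refine (norm_sum_le _ _).trans (Finset.sum_le_sum fun l hl => ?_)
    rw [← mul_sub, ← Complex.ofReal_sub, norm_mul, norm_mul, norm_pow, hω, one_pow, mul_one,
      Complex.norm_real, Real.norm_eq_abs]
    have hln : l ≤ n := (Finset.mem_range.1 hl).le
    have h1 := abs_integral_sub_laplaceMoment_le hk hln hs hR0
    have h2 := (norm_taylorCoeff_le_and_remainder hr hB hM l).1
    have h3 := laplaceMoment_nonneg k n hs
    calc _ ≤ (M * (2 / r) ^ l) * ((R⁻¹) ^ (n - l) * laplaceMoment k n s) := by gcongr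
      _ ≤ (M * (2 / r) ^ l) * ((R₀⁻¹) ^ (n - l) * laplaceMoment k n s) := by gcongr
      _ = _ := by ring
  · have hin := integrableOn_pow_mul_exp_neg hk n hs
    calc _ ≤ ∫ t in (0 : ℝ)..R, M * (2 / r) ^ n * (t ^ n * Real.exp (-s * t ^ k)) := by
          refine intervalIntegral.norm_integral_le_of_norm_le hR0.le ?_ ?_
          · refine ae_of_all _ fun t ht => ?_
            have ht' : t ∈ Icc 0 R := ⟨ht.1.le, ht.2⟩
            have h := (norm_taylorCoeff_le_and_remainder hr hB hM n).2 _ (hmem t ht')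
            rw [norm_mul, norm_mul, hω, mul_one, Complex.norm_real, Real.norm_eq_abs,
              Real.abs_exp]
            rw [norm_mul, hω, mul_one, Complex.norm_real, Real.norm_eq_abs,
              abs_of_pos ht.1] at h
            calc _ ≤ _ := mul_le_mul_of_nonneg_right h (Real.exp_nonneg _)
              _ = _ := by ring
          · exact Continuous.intervalIntegrable (by fun_prop) _ _
      _ = M * (2 / r) ^ n * ∫ t in (0 : ℝ)..R, t ^ n * Real.exp (-s * t ^ k) := by
          rw [intervalIntegral.integral_const_mul]
      _ ≤ _ := by
          refine mul_le_mul_of_nonneg_left ?_ (by positivity)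
          rw [← integral_pow_mul_exp_neg hk n hs, intervalIntegral.integral_of_le hR0.le]
          refine setIntegral_mono_set hin ?_ (LE.le.eventuallyLE Ioc_subset_Ioi_self)
          filter_upwards [ae_restrict_mem measurableSet_Ioi] with t ht
          have : (0 : ℝ) < t := ht
          simp only [Pi.zero_apply]
          positivity

/-! ### Endpoint contributions of `∫ B(y) e^{- s y ^ k} dy` -/

/-- Mean value inequality along the arc of radius `R` from `Rω` through the angle `β/k`. There `x^k
= R^k e^{iφ}` with `φ` between `0` and `β`, and `cos` decreases on `[0, π]`, so `Re x^k` is at least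
its value at the far end. The speed is `R/k ≤ R` and the parameter length is `|β| < π`. -/
theorem norm_sub_le_of_arc {k : ℕ} (hk : 1 ≤ k) {B Q : ℂ → ℂ} {r M R s m β : ℝ} {ω : ℂ}
    (hM : ∀ x ∈ ball (0 : ℂ) r, ‖B x‖ ≤ M)
    (hQ : ∀ x ∈ ball (0 : ℂ) r, HasDerivAt Q (B x * Complex.exp (-s * x ^ k)) x)
    (hω : ω ^ k = 1) (hR : 0 ≤ R) (hRr : R < r) (hs : 0 ≤ s) (hβ : |β| < Real.pi)
    (hm : m ≤ R ^ k * Real.cos β) :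
    ‖Q (R * ω * Complex.exp (Complex.I * (β / k))) - Q (R * ω)‖
      ≤ M * Real.exp (-s * m) * R * Real.pi := by
  have hωn : ‖ω‖ = 1 := by
    have h := congrArg norm hω
    rw [norm_pow, norm_one] at h
    exact (pow_eq_one_iff_of_nonneg (norm_nonneg _) (by omega)).1 h
  have hk0 : (k : ℂ) ≠ 0 := by exact_mod_cast (by omega : k ≠ 0)
  set γ : ℝ → ℂ := fun φ => R * ω * Complex.exp (Complex.I * (φ / k)) with hγ
  have hγn : ∀ φ, ‖γ φ‖ = R := by
    intro φ
    have : Complex.I * ((φ : ℂ) / k) = ((φ / k : ℝ) : ℂ) * Complex.I := by push_cast; ring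
    rw [hγ]
    simp only
    rw [this, norm_mul, norm_mul, hωn, Complex.norm_exp_ofReal_mul_I, Complex.norm_real,
      Real.norm_eq_abs, abs_of_nonneg hR, mul_one, mul_one]
  have hγm : ∀ φ, γ φ ∈ ball (0 : ℂ) r := fun φ => by
    rw [mem_ball_zero_iff, hγn]; exact hRr
  have hγk : ∀ φ, γ φ ^ k = (R : ℂ) ^ k * Complex.exp (φ * Complex.I) := by
    intro φ
    rw [hγ]
    simp only
    rw [mul_pow, mul_pow, hω, mul_one, ← Complex.exp_nat_mul]
    congr 2
    field_simp
  have hγd : ∀ φ : ℝ, HasDerivAt γ (γ φ * (Complex.I * (1 / k))) φ := by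
    intro φ
    have h1 : HasDerivAt (fun φ : ℝ => Complex.I * ((φ : ℂ) / k)) (Complex.I * (1 / k)) φ :=
      ((Complex.ofRealCLM.hasDerivAt (x := φ)).div_const (k : ℂ)).const_mul Complex.I
    have h2 := (h1.cexp).const_mul (R * ω)
    exact h2.congr_deriv (by rw [hγ]; ring)
  have hpos : ∀ φ ∈ uIcc 0 β, m ≤ R ^ k * Real.cos φ := by
    intro φ hφ
    refine hm.trans (mul_le_mul_of_nonneg_left ?_ (by positivity))
    rw [← Real.cos_abs β, ← Real.cos_abs φ]
    refine Real.cos_le_cos_of_nonneg_of_le_pi (abs_nonneg _) hβ.le ?_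
    rcases le_total 0 β with h | h
    · rw [uIcc_of_le h] at hφ
      exact abs_le_abs hφ.2 (by linarith [hφ.1])
    · rw [uIcc_of_ge h] at hφ
      rw [abs_of_nonpos hφ.2, abs_of_nonpos h]; linarith [hφ.1]
  have key := Convex.norm_image_sub_le_of_norm_hasDerivWithin_le (𝕜 := ℝ) (f := fun φ => Q (γ φ))
    (s := uIcc 0 β) (x := 0) (y := β) (C := M * Real.exp (-s * m) * R)
    (f' := fun φ => (B (γ φ) * Complex.exp (-s * γ φ ^ k)) * (γ φ * (Complex.I * (1 / k))))
    (fun φ _ => ((hQ _ (hγm φ)).comp φ (hγd φ)).hasDerivWithinAt)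
    (fun φ hφ => ?_) (convex_uIcc _ _) left_mem_uIcc right_mem_uIcc
  · have h0 : γ 0 = R * ω := by simp [hγ]
    simp only [h0] at key
    have hM0 : 0 ≤ M := (norm_nonneg _).trans (hM 0 (mem_ball_self (hR.trans_lt hRr)))
    refine key.trans ?_
    rw [sub_zero, Real.norm_eq_abs]
    gcongr
  · rw [norm_mul, norm_mul, norm_mul, hγn, Complex.norm_exp]
    have e1 : (-(s : ℂ) * γ φ ^ k).re = -s * (R ^ k * Real.cos φ) := by
      rw [hγk, ← Complex.ofReal_pow, Complex.exp_mul_I, ← Complex.ofReal_cos,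
        ← Complex.ofReal_sin, neg_mul, neg_mul, Complex.neg_re, Complex.re_ofReal_mul,
        Complex.re_ofReal_mul]
      simp [Complex.cos_ofReal_re]
    rw [e1]
    have e2 : ‖Complex.I * (1 / (k : ℂ))‖ ≤ 1 := by
      rw [norm_mul, Complex.norm_I, one_mul, norm_div, norm_one, Complex.norm_natCast]
      rw [div_le_one (by exact_mod_cast hk)]
      exact_mod_cast hk
    have hM0 : 0 ≤ M := (norm_nonneg _).trans (hM 0 (mem_ball_self (hR.trans_lt hRr)))
    have e3 : Real.exp (-s * (R ^ k * Real.cos φ)) ≤ Real.exp (-s * m) := by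
      refine Real.exp_le_exp.2 ?_
      have := mul_le_mul_of_nonneg_left (hpos φ hφ) hs
      linarith
    calc _ ≤ M * Real.exp (-s * m) * (R * 1) := by
          gcongr
          exact hM _ (hγm φ)
      _ = _ := by ring

theorem segment_eq_integral {k : ℕ} {B Q : ℂ → ℂ} {r R s : ℝ} {ω : ℂ}
    (hB : DifferentiableOn ℂ B (ball 0 r))
    (hQ : ∀ x ∈ ball (0 : ℂ) r, HasDerivAt Q (B x * Complex.exp (-s * x ^ k)) x)
    (hω : ω ^ k = 1) (hωn : ‖ω‖ = 1) (hR : 0 ≤ R) (hRr : R < r) :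
    Q (R * ω) - Q 0 = ∫ t in (0 : ℝ)..R, B (t * ω) * ω * (Real.exp (-s * t ^ k) : ℂ) := by
  have hmem : ∀ t ∈ uIcc (0 : ℝ) R, (t : ℂ) * ω ∈ ball (0 : ℂ) r := by
    intro t ht
    rw [uIcc_of_le hR] at ht
    rw [mem_ball_zero_iff, norm_mul, hωn, mul_one, Complex.norm_real, Real.norm_eq_abs,
      abs_of_nonneg ht.1]
    exact ht.2.trans_lt hRr
  have hd : ∀ t ∈ uIcc (0 : ℝ) R, HasDerivAt (fun t : ℝ => Q (t * ω))
      (B (t * ω) * ω * (Real.exp (-s * t ^ k) : ℂ)) t := by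
    intro t ht
    have h1 : HasDerivAt (fun t : ℝ => (t : ℂ) * ω) (1 * ω) t :=
      (Complex.ofRealCLM.hasDerivAt (x := t)).mul_const ω
    refine ((hQ _ (hmem t ht)).comp t h1).congr_deriv ?_
    rw [mul_pow, hω]
    push_cast
    ring_nf
  rw [intervalIntegral.integral_eq_sub_of_hasDerivAt hd]
  · simp
  · refine ContinuousOn.intervalIntegrable ?_
    exact ((hB.continuousOn.comp (by fun_prop) hmem).mul continuousOn_const).mul (by fun_prop)

/-- The ray from `0` to `Rω` carries the expansion; the arc from `Rω` to the endpoint adds only the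
exponential term. -/
theorem norm_endpoint_sub_sum_le {k : ℕ} (hk : 1 ≤ k) {B Q : ℂ → ℂ} {r M R₀ R s m β : ℝ} {ω : ℂ}
    (hr : 0 < r) (hB : DifferentiableOn ℂ B (ball 0 r))
    (hM : ∀ x ∈ ball (0 : ℂ) r, ‖B x‖ ≤ M)
    (hQ : ∀ x ∈ ball (0 : ℂ) r, HasDerivAt Q (B x * Complex.exp (-s * x ^ k)) x)
    (hω : ω ^ k = 1) (hR₀ : 0 < R₀) (hR : R₀ ≤ R) (hRr : R < r) (hs : 0 < s)
    (hβ : |β| < Real.pi) (hm : m ≤ R ^ k * Real.cos β) (n : ℕ) :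
    ‖Q (R * ω * Complex.exp (Complex.I * (β / k))) - Q 0
        - ∑ l ∈ Finset.range n, taylorCoeff B l * ω ^ (l + 1) * (laplaceMoment k l s : ℂ)‖
      ≤ ((∑ l ∈ Finset.range n, M * (2 / r) ^ l * (R₀⁻¹) ^ (n - l)) + M * (2 / r) ^ n)
          * laplaceMoment k n s + M * Real.exp (-s * m) * r * Real.pi := by
  have hωn : ‖ω‖ = 1 := by
    have h := congrArg norm hω
    rw [norm_pow, norm_one] at h
    exact (pow_eq_one_iff_of_nonneg (norm_nonneg _) (by omega)).1 h
  have hR0 : 0 ≤ R := hR₀.le.trans hR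
  have hM0 : 0 ≤ M := (norm_nonneg _).trans (hM 0 (mem_ball_self hr))
  have h1 := norm_sub_le_of_arc hk hM hQ hω hR0 hRr hs.le hβ hm
  have h2 := norm_integral_sub_sum_laplaceMoment_le hk hr hB hM hωn hR₀ hR hRr hs n
  rw [← segment_eq_integral hB hQ hω hωn hR0 hRr] at h2
  have h3 : M * Real.exp (-s * m) * R * Real.pi ≤ M * Real.exp (-s * m) * r * Real.pi := by
    have := Real.pi_pos
    gcongr
  calc _ = ‖(Q (R * ω) - Q 0 - ∑ l ∈ Finset.range n,
            taylorCoeff B l * ω ^ (l + 1) * (laplaceMoment k l s : ℂ))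
          + (Q (R * ω * Complex.exp (Complex.I * (β / k))) - Q (R * ω))‖ := by
        congr 1; ring
    _ ≤ _ := (norm_add_le _ _).trans (add_le_add h2 (h1.trans h3))

/-- One term of the exponential series gives decay `s^{-(n+1)}`, which for `s ≥ 1` is stronger than
the required `s^{-(n+1)/k}`. -/
theorem exists_exp_neg_le_laplaceMoment {k : ℕ} (hk : 1 ≤ k) (n : ℕ) {m : ℝ} (hm : 0 < m) :
    ∃ C : ℝ, 0 ≤ C ∧ ∀ s : ℝ, 1 ≤ s → Real.exp (-s * m) ≤ C * laplaceMoment k n s := by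
  have hk0 : (0 : ℝ) < k := by exact_mod_cast hk
  have hG : 0 < 1 / (k : ℝ) * Real.Gamma (((n : ℝ) + 1) / k) :=
    mul_pos (by positivity) (Real.Gamma_pos_of_pos (by positivity))
  refine ⟨((n + 1).factorial / m ^ (n + 1)) / (1 / (k : ℝ) * Real.Gamma (((n : ℝ) + 1) / k)),
    by positivity, fun s hs => ?_⟩
  have hs0 : 0 < s := by linarith
  have h1 : Real.exp (-s * m) ≤ (n + 1).factorial / m ^ (n + 1) * s ^ (-((n : ℝ) + 1)) := by
    have h := Real.pow_div_factorial_le_exp (s * m) (by positivity) (n + 1)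
    have he : s ^ (-((n : ℝ) + 1)) = (s ^ (n + 1))⁻¹ := by
      rw [Real.rpow_neg hs0.le]
      congr 1
      exact_mod_cast Real.rpow_natCast s (n + 1)
    have he' : ((n + 1).factorial : ℝ) / m ^ (n + 1) * (s ^ (n + 1))⁻¹
        = ((s * m) ^ (n + 1) / (n + 1).factorial)⁻¹ := by
      rw [mul_pow, inv_div]; field_simp
    rw [he, neg_mul, Real.exp_neg, he']
    exact inv_anti₀ (by positivity) h
  have h2 : s ^ (-((n : ℝ) + 1)) ≤ s ^ (-(((n : ℝ) + 1) / (k : ℝ))) := by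
    refine Real.rpow_le_rpow_of_exponent_le hs (neg_le_neg ?_)
    exact div_le_self (by positivity) (by exact_mod_cast hk)
  unfold laplaceMoment
  rw [← mul_assoc, div_mul_cancel₀ _ hG.ne']
  exact h1.trans (mul_le_mul_of_nonneg_left h2 (by positivity))

/-! ### A quantitative inverse of `x ↦ x q(x)` with `q 0 = 1` -/

/-- The radii depend on `r` alone, which the uniform version needs and the plain inverse function
theorem does not give. On the disk of radius `r/24` the derivative of `x q(x)` is within `1/2` of
`1`, so the map is a small Lipschitz perturbation of the identity. -/
theorem exists_inverse_id_mul {q : ℂ → ℂ} {r : ℝ} (hr : 0 < r)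
    (hq : DifferentiableOn ℂ q (ball 0 r)) (hq0 : q 0 = 1) (hq2 : ∀ x ∈ ball (0 : ℂ) r, ‖q x‖ ≤ 2) :
    ∃ W : ℂ → ℂ, W 0 = 0 ∧ DifferentiableOn ℂ W (ball 0 (r / 96)) ∧
      (∀ t ∈ ball (0 : ℂ) (r / 96), W t ∈ ball (0 : ℂ) (r / 24) ∧ W t * q (W t) = t ∧
        ‖deriv W t‖ ≤ 2) ∧
      ∀ x ∈ ball (0 : ℂ) (r / 24), W (x * q x) = x := by
  set V : ℂ → ℂ := fun x => x * q x with hV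
  have hdq : ∀ x ∈ ball (0 : ℂ) r, DifferentiableAt ℂ q x := fun x hx =>
    hq.differentiableAt (isOpen_ball.mem_nhds hx)
  have hV' : ∀ x ∈ ball (0 : ℂ) r, HasDerivAt V (q x + x * deriv q x) x := fun x hx =>
    ((hasDerivAt_id' x).mul (hdq x hx).hasDerivAt).congr_deriv (by ring)
  have hsub : ball (0 : ℂ) (r / 24) ⊆ ball 0 r := ball_subset_ball (by linarith)
  -- Schwarz gives `|q - 1| ≤ 3|x|/r` and Cauchy on a disk of radius `r/2` gives `|q'| ≤ 8/r`; the
  -- total `11|x|/r` is below `1/2` when `|x| < r/24`.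
  have hVd : ∀ x ∈ ball (0 : ℂ) (r / 24), ‖q x + x * deriv q x - 1‖ ≤ 1 / 2 := by
    intro x hx
    have hxr := mem_ball_zero_iff.1 hx
    have h1 : ‖q x - 1‖ ≤ 3 / r * ‖x‖ := by
      have := Complex.dist_le_div_mul_dist_of_mapsTo_ball (R₂ := 3) hq (fun y hy => ?_) (hsub hx)
      · simpa [dist_eq_norm, hq0] using this
      · rw [mem_closedBall, dist_eq_norm, hq0]
        calc _ ≤ ‖q y‖ + ‖(1 : ℂ)‖ := norm_sub_le _ _
          _ ≤ 3 := by rw [norm_one]; linarith [hq2 y hy]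
    have h2 : ‖deriv q x‖ ≤ 4 / (r / 2) := by
      have hb : ball x (r / 2) ⊆ ball (0 : ℂ) r := by
        refine ball_subset_ball' ?_
        rw [dist_zero_right]; linarith
      refine Complex.norm_deriv_le_div_of_mapsTo_ball (hq.mono hb) (fun y hy => ?_) (by linarith)
      rw [mem_closedBall, dist_eq_norm]
      calc _ ≤ ‖q y‖ + ‖q x‖ := norm_sub_le _ _
        _ ≤ 4 := by linarith [hq2 y (hb hy), hq2 x (hsub hx)]
    calc ‖q x + x * deriv q x - 1‖ = ‖(q x - 1) + x * deriv q x‖ := by congr 1; ring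
      _ ≤ ‖q x - 1‖ + ‖x‖ * ‖deriv q x‖ := by
          rw [← norm_mul]; exact norm_add_le _ _
      _ ≤ 3 / r * ‖x‖ + ‖x‖ * (4 / (r / 2)) := by gcongr
      _ = 11 / r * ‖x‖ := by field_simp; ring
      _ ≤ 11 / r * (r / 24) := by gcongr
      _ ≤ 1 / 2 := by field_simp; norm_num
  have hA : ApproximatesLinearOn V ((ContinuousLinearEquiv.refl ℂ ℂ : ℂ ≃L[ℂ] ℂ) : ℂ →L[ℂ] ℂ)
      (ball 0 (r / 24)) (1 / 2) := by
    intro x hx y hy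
    have := Convex.norm_image_sub_le_of_norm_hasDerivWithin_le (𝕜 := ℂ) (f := fun z => V z - z)
      (f' := fun z => q z + z * deriv q z - 1) (s := ball 0 (r / 24)) (C := 1 / 2)
      (fun z hz => ((hV' z (hsub hz)).sub (hasDerivAt_id z)).hasDerivWithinAt) hVd
      (convex_ball _ _) hy hx
    calc _ = ‖V x - x - (V y - y)‖ := by congr 1; simp; ring
      _ ≤ _ := by simpa using this
  have hc : Subsingleton ℂ ∨ (1 / 2 : NNReal) <
      ‖((ContinuousLinearEquiv.refl ℂ ℂ).symm : ℂ →L[ℂ] ℂ)‖₊⁻¹ := by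
    right
    have : ‖((ContinuousLinearEquiv.refl ℂ ℂ).symm : ℂ →L[ℂ] ℂ)‖₊ = 1 := by
      ext; simp
    rw [this, inv_one]
    exact NNReal.half_lt_self one_ne_zero
  set e := hA.toOpenPartialHomeomorph V (ball 0 (r / 24)) hc isOpen_ball with he
  have hV0 : V 0 = 0 := by simp [hV]
  have htgt : ball (0 : ℂ) (r / 96) ⊆ e.target := by
    -- The image contains the ball of radius `(1 - 1/2) · r/48 = r/96`.
    have h := hA.closedBall_subset_target hc isOpen_ball (b := 0) (ε := r / 48) (by positivity)
      (closedBall_subset_ball (by linarith))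
    rw [hV0] at h
    refine (ball_subset_closedBall.trans (closedBall_subset_closedBall ?_)).trans h
    have : ‖((ContinuousLinearEquiv.refl ℂ ℂ).symm : ℂ →L[ℂ] ℂ)‖₊ = 1 := by
      ext; simp
    rw [this]
    push_cast
    linarith
  have hcoe : ∀ x, e x = V x := fun x => rfl
  have hsrc : e.source = ball 0 (r / 24) := rfl
  have hleft : ∀ x ∈ ball (0 : ℂ) (r / 24), e.symm (V x) = x := fun x hx =>
    e.left_inv (hsrc ▸ hx)
  have hW : ∀ t ∈ ball (0 : ℂ) (r / 96), e.symm t ∈ ball (0 : ℂ) (r / 24) := fun t ht =>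
    hsrc ▸ e.map_target (htgt ht)
  have hne : ∀ x ∈ ball (0 : ℂ) (r / 24), 1 / 2 ≤ ‖q x + x * deriv q x‖ := fun x hx => by
    have h1 := hVd x hx
    have h2 := norm_sub_norm_le (1 : ℂ) (1 - (q x + x * deriv q x))
    rw [norm_one, norm_sub_rev 1 (q x + x * deriv q x), sub_sub_cancel] at h2
    linarith
  have hWd : ∀ t ∈ ball (0 : ℂ) (r / 96), HasDerivAt e.symm
      (q (e.symm t) + e.symm t * deriv q (e.symm t))⁻¹ t := fun t ht => by
    refine e.hasDerivAt_symm (htgt ht) ?_ (hV' _ (hsub (hW t ht)))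
    intro h0
    have := hne _ (hW t ht)
    rw [h0, norm_zero] at this
    linarith
  refine ⟨e.symm, ?_, fun t ht => (hWd t ht).differentiableAt.differentiableWithinAt,
    fun t ht => ⟨hW t ht, e.right_inv (htgt ht), ?_⟩, hleft⟩
  · have := hleft 0 (mem_ball_self (by positivity))
    rwa [hV0] at this
  · rw [(hWd t ht).deriv, norm_inv]
    calc _ ≤ (1 / 2 : ℝ)⁻¹ := inv_anti₀ (by norm_num) (hne _ (hW t ht))
      _ = 2 := by norm_num

/-! ### The phase as a power of a local coordinate -/

theorem cpow_inv_natCast_eq (k : ℕ) {w : ℂ} (hw : w ≠ 0) :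
    w ^ (1 / (k : ℂ)) = (‖w‖ ^ (1 / (k : ℝ)) : ℝ) * Complex.exp (Complex.I * (w.arg / k)) := by
  rw [Complex.cpow_def_of_ne_zero hw, Complex.log, add_mul, Complex.exp_add,
    Real.rpow_def_of_pos (norm_pos_iff.2 hw)]
  push_cast
  congr 2
  ring

theorem norm_cpow_inv_natCast (k : ℕ) (w : ℂ) :
    ‖w ^ (1 / (k : ℂ))‖ = ‖w‖ ^ (1 / (k : ℝ)) := by
  have h : (1 / (k : ℂ)) = ((1 / (k : ℝ) : ℝ) : ℂ) := by push_cast; ring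
  rw [h, Complex.norm_cpow_real]

theorem cpow_inv_natCast_pow {k : ℕ} (hk : 1 ≤ k) (w : ℂ) : (w ^ (1 / (k : ℂ))) ^ k = w := by
  rw [one_div, Complex.cpow_nat_inv_pow _ (by omega)]

/-- A function with a zero of order exactly `k` at `0`, bounded on a disk and with leading
coefficient bounded below, is `x ^ k h(x)` with `h` close to its value at `0`, on a disk whose radius
depends on the bounds only. -/
theorem exists_leading_factor (k : ℕ) {r M c₀ : ℝ} (hr : 0 < r) (hc₀ : 0 < c₀) :
    ∃ ρ > 0, ρ ≤ r ∧ ∃ M' > 0, ∀ F : ℂ → ℂ, DifferentiableOn ℂ F (ball 0 r) →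
      (∀ x ∈ ball (0 : ℂ) r, ‖F x‖ ≤ M) → analyticOrderAt F 0 = k → c₀ ≤ ‖taylorCoeff F k‖ →
      ∃ h : ℂ → ℂ, DifferentiableOn ℂ h (ball 0 ρ) ∧ h 0 = taylorCoeff F k ∧ ‖h 0‖ ≤ M' ∧
        ∀ x ∈ ball (0 : ℂ) ρ, F x = x ^ k * h x ∧ ‖h x / h 0 - 1‖ ≤ 1 / 2 := by
  set M' : ℝ := max (M * (2 / r) ^ k) 1 with hM'
  have hM'0 : 0 < M' := lt_max_of_lt_right one_pos
  refine ⟨min r (c₀ * r / (4 * M')), by positivity, min_le_left _ _, M', hM'0,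
    fun F hF hFM ho hc => ?_⟩
  have ha : AnalyticAt ℂ F 0 := hF.analyticAt (ball_mem_nhds 0 hr)
  obtain ⟨h, h1, h2, h3⟩ := exists_taylor_factor hr hF hFM k
  have hsub : ball (0 : ℂ) (min r (c₀ * r / (4 * M'))) ⊆ ball 0 r :=
    ball_subset_ball (min_le_left _ _)
  have hb : ∀ x ∈ ball (0 : ℂ) r, ‖h x‖ ≤ M' := fun x hx => (h3 x hx).1.trans (le_max_left _ _)
  have hbig : F =O[𝓝 0] fun x => x ^ k := by
    obtain ⟨g, hg, -, he⟩ := ha.analyticOrderAt_eq_natCast.1 ho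
    have hg1 : g =O[𝓝 0] fun _ => (1 : ℂ) := hg.continuousAt.isBigO_one ℂ
    have := (Asymptotics.isBigO_refl (fun x : ℂ => x ^ k) (𝓝 0)).mul hg1
    refine (Asymptotics.IsBigO.congr' this ?_ ?_)
    · filter_upwards [he] with x hx
      rw [hx, sub_zero, smul_eq_mul]
    · exact Eventually.of_forall fun x => mul_one _
  have hz : ∀ l ∈ Finset.range k, taylorCoeff F l = 0 := fun l hl =>
    taylorCoeff_eq_zero_of_isBigO ha hbig (Finset.mem_range.1 hl)
  have h00 : 0 < ‖h 0‖ := by rw [h2]; linarith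
  refine ⟨h, h1.mono hsub, h2, hb 0 (mem_ball_self hr), fun x hx => ⟨?_, ?_⟩⟩
  · rw [(h3 x (hsub hx)).2, Finset.sum_eq_zero fun l hl => by rw [hz l hl, zero_mul], zero_add]
  · have hd := Complex.dist_le_div_mul_dist_of_mapsTo_ball (R₂ := 2 * M') h1 (fun y hy => ?_)
      (hsub hx)
    · rw [dist_eq_norm, dist_zero_right] at hd
      have hxr : ‖x‖ ≤ c₀ * r / (4 * M') :=
        (mem_ball_zero_iff.1 hx).le.trans (min_le_right _ _)
      have he : h x / h 0 - 1 = (h x - h 0) / h 0 := by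
        rw [sub_div, div_self (norm_pos_iff.1 h00)]
      rw [he, norm_div, div_le_iff₀ h00]
      calc _ ≤ _ := hd
        _ ≤ 2 * M' / r * (c₀ * r / (4 * M')) := by gcongr
        _ = 1 / 2 * c₀ := by field_simp; ring
        _ ≤ _ := by rw [h2]; gcongr
    · rw [mem_closedBall, dist_eq_norm]
      calc ‖h y - h 0‖ ≤ ‖h y‖ + ‖h 0‖ := norm_sub_le _ _
        _ ≤ 2 * M' := by linarith [hb y hy, hb 0 (mem_ball_self hr)]

theorem re_ge_half_of_norm_sub_one_le {u : ℂ} (h : ‖u - 1‖ ≤ 1 / 2) : 1 / 2 ≤ u.re := by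
  have h1 := (Complex.abs_re_le_norm (u - 1)).trans h
  rw [Complex.sub_re, Complex.one_re] at h1
  linarith [(abs_le.1 h1).1]

/-- The local coordinate `y = f ^ {1/k}` and its inverse, on disks depending on the bounds only. -/
theorem exists_root_coordinate {k : ℕ} (hk : 1 ≤ k) {r M c₀ : ℝ} (hr : 0 < r) (hc₀ : 0 < c₀) :
    ∃ δ₀ > 0, δ₀ < r ∧ ∃ ρ > 0, ∃ A > 0, ∀ F : ℂ → ℂ, DifferentiableOn ℂ F (ball 0 r) →
      (∀ x ∈ ball (0 : ℂ) r, ‖F x‖ ≤ M) → analyticOrderAt F 0 = k → c₀ ≤ ‖taylorCoeff F k‖ →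
      ∃ (u Y η : ℂ → ℂ), η 0 = 0 ∧ DifferentiableOn ℂ η (ball 0 ρ) ∧
        (∀ t ∈ ball (0 : ℂ) ρ, η t ∈ ball (0 : ℂ) r ∧ Y (η t) = t ∧ ‖deriv η t‖ ≤ A) ∧
        (∀ x ∈ ball (0 : ℂ) (2 * δ₀), x ∈ ball (0 : ℂ) r ∧ Y x ∈ ball (0 : ℂ) ρ ∧ η (Y x) = x ∧
          DifferentiableAt ℂ Y x ∧ Y x ^ k = F x ∧ Y x = rootPhase F k x ∧
          ‖u x - 1‖ ≤ 1 / 2 ∧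
          Y x = taylorCoeff F k ^ (1 / (k : ℂ)) * x * u x ^ (1 / (k : ℂ))) := by
  obtain ⟨ρ, hρ, hρr, M', hM', H⟩ := exists_leading_factor k (M := M) hr hc₀
  have hk0 : (0 : ℝ) < k := by exact_mod_cast hk
  set a₀ : ℝ := c₀ ^ (1 / (k : ℝ)) with ha₀
  set a₁ : ℝ := M' ^ (1 / (k : ℝ)) with ha₁
  have ha₀p : 0 < a₀ := Real.rpow_pos_of_pos hc₀ _
  have ha₁p : 0 < a₁ := Real.rpow_pos_of_pos hM' _
  -- The first entry keeps `x` where `W` inverts `x q(x)`. The second keeps `|a x q(x)| ≤ 2 a₁ |x|`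
  -- below `a₀ ρ/96`, a radius on which `W(t/a)` is defined for every `|a| ≥ a₀`.
  have hδp : 0 < min (ρ / 24) (a₀ * (ρ / 96) / (2 * a₁)) := by positivity
  set δ₀ : ℝ := min (ρ / 24) (a₀ * (ρ / 96) / (2 * a₁)) / 2 with hδ₀
  have hδ24 : 2 * δ₀ ≤ ρ / 24 := by
    rw [hδ₀]; linarith [min_le_left (ρ / 24) (a₀ * (ρ / 96) / (2 * a₁))]
  have hδa : 2 * δ₀ ≤ a₀ * (ρ / 96) / (2 * a₁) := by
    rw [hδ₀]; linarith [min_le_right (ρ / 24) (a₀ * (ρ / 96) / (2 * a₁))]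
  refine ⟨δ₀, by positivity, by linarith, a₀ * (ρ / 96), by positivity, 2 / a₀, by positivity,
    fun F hF hFM ho hc => ?_⟩
  obtain ⟨h, hd, h0, hM0, hx⟩ := H F hF hFM ho hc
  set c := taylorCoeff F k with hcdef
  have hcpos : 0 < ‖c‖ := hc₀.trans_le hc
  have hc0 : c ≠ 0 := norm_pos_iff.1 hcpos
  set a : ℂ := c ^ (1 / (k : ℂ)) with hadef
  have han : ‖a‖ = ‖c‖ ^ (1 / (k : ℝ)) := norm_cpow_inv_natCast k c
  have haa₀ : a₀ ≤ ‖a‖ := by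
    rw [han]; exact Real.rpow_le_rpow hc₀.le hc (by positivity)
  have haa₁ : ‖a‖ ≤ a₁ := by
    rw [han]; exact Real.rpow_le_rpow hcpos.le (h0 ▸ hM0) (by positivity)
  have hapos : 0 < ‖a‖ := ha₀p.trans_le haa₀
  have ha0 : a ≠ 0 := norm_pos_iff.1 hapos
  set u : ℂ → ℂ := fun x => h x / c with hu
  have hu1 : ∀ x ∈ ball (0 : ℂ) ρ, ‖u x - 1‖ ≤ 1 / 2 := fun x hxm => by
    have := (hx x hxm).2
    rwa [h0] at this
  have hure : ∀ x ∈ ball (0 : ℂ) ρ, 1 / 2 ≤ (u x).re := fun x hxm =>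
    re_ge_half_of_norm_sub_one_le (hu1 x hxm)
  have hune : ∀ x ∈ ball (0 : ℂ) ρ, u x ≠ 0 := fun x hxm h => by
    have := hure x hxm
    rw [h, Complex.zero_re] at this
    linarith
  set q : ℂ → ℂ := fun x => u x ^ (1 / (k : ℂ)) with hq
  -- Since `u` stays within `1/2` of `1`, it avoids the cut of the principal power.
  have hqd : DifferentiableOn ℂ q (ball 0 ρ) := by
    refine (hd.div_const c).cpow (differentiableOn_const _) fun x hxm => ?_
    exact Or.inl (by have := hure x hxm; simp only [hu] at this; linarith)
  have hq0 : q 0 = 1 := by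
    simp only [hq, hu]
    rw [h0, div_self hc0, Complex.one_cpow]
  have hq2 : ∀ x ∈ ball (0 : ℂ) ρ, ‖q x‖ ≤ 2 := by
    intro x hxm
    have h1 : ‖u x‖ ≤ 2 := by
      have := norm_le_norm_add_norm_sub (1 : ℂ) (u x)
      rw [norm_one, norm_sub_rev] at this
      have h2 := hu1 x hxm
      have h3 := norm_sub_rev (1 : ℂ) (u x)
      linarith
    simp only [hq]
    rw [norm_cpow_inv_natCast k _]
    calc ‖u x‖ ^ (1 / (k : ℝ)) ≤ 2 ^ (1 / (k : ℝ)) :=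
          Real.rpow_le_rpow (norm_nonneg _) h1 (by positivity)
      _ ≤ 2 ^ (1 : ℝ) := by
          refine Real.rpow_le_rpow_of_exponent_le (by norm_num) ?_
          rw [div_le_one hk0]; exact_mod_cast hk
      _ = 2 := Real.rpow_one _
  obtain ⟨W, hW0, hWd, hW1, hW2⟩ := exists_inverse_id_mul hρ hqd hq0 hq2
  have hta : ∀ t ∈ ball (0 : ℂ) (a₀ * (ρ / 96)), t / a ∈ ball (0 : ℂ) (ρ / 96) := by
    intro t ht
    rw [mem_ball_zero_iff] at ht ⊢
    rw [norm_div, div_lt_iff₀ hapos, mul_comm]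
    exact ht.trans_le (by gcongr)
  have hsub : ball (0 : ℂ) (ρ / 24) ⊆ ball 0 ρ := ball_subset_ball (by linarith)
  refine ⟨u, fun x => a * x * q x, fun t => W (t / a), by simp [hW0], ?_, fun t ht => ?_,
    fun x hxm => ?_⟩
  · exact hWd.comp (differentiableOn_id.div_const a) hta
  · obtain ⟨h1, h2, h3⟩ := hW1 _ (hta t ht)
    refine ⟨ball_subset_ball (by linarith) h1, ?_, ?_⟩
    · simp only
      rw [mul_assoc, h2, mul_div_cancel₀ _ ha0]
    · have hdW := (hWd.differentiableAt (isOpen_ball.mem_nhds (hta t ht))).hasDerivAt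
      have hd' : HasDerivAt (fun t => W (t / a)) (deriv W (t / a) * (1 / a)) t :=
        hdW.comp t ((hasDerivAt_id t).div_const a)
      rw [hd'.deriv, norm_mul, norm_div, norm_one, ← div_eq_mul_one_div]
      gcongr
  · have hx24 : x ∈ ball (0 : ℂ) (ρ / 24) := ball_subset_ball hδ24 hxm
    have hxρ := hsub hx24
    have hxn : ‖x‖ < 2 * δ₀ := mem_ball_zero_iff.1 hxm
    have hk' : (a * x * q x) ^ k = F x := by
      rw [mul_pow, mul_pow, hadef, cpow_inv_natCast_pow hk]
      simp only [hq]
      rw [cpow_inv_natCast_pow hk, (hx x hxρ).1]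
      simp only [hu]
      field_simp
    refine ⟨ball_subset_ball hρr hxρ, ?_, ?_, ?_, hk', ?_, hu1 x hxρ, rfl⟩
    · rw [mem_ball_zero_iff, norm_mul, norm_mul]
      calc ‖a‖ * ‖x‖ * ‖q x‖ ≤ a₁ * ‖x‖ * 2 := by
            gcongr
            exact hq2 x hxρ
        _ < a₁ * (a₀ * (ρ / 96) / (2 * a₁)) * 2 := by
            gcongr
            exact hxn.trans_le hδa
        _ = _ := by field_simp
    · simp only
      rw [mul_assoc, mul_div_cancel_left₀ _ ha0]
      exact hW2 x hx24
    · exact ((differentiableAt_const a).mul differentiableAt_id).mul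
        (hqd.differentiableAt (isOpen_ball.mem_nhds hxρ))
    · rw [rootPhase, ← hcdef, ← hadef]
      by_cases hx0 : x = 0
      · simp [hx0]
      · have : 1 + (F x - c * x ^ k) / (c * x ^ k) = u x := by
          rw [(hx x hxρ).1]
          simp only [hu]
          field_simp
          ring
        rw [this]

/-! ### Uniqueness of the inverse germ -/

/-- Both germs invert `y`, so `η₂ = η₂ ∘ y ∘ η₁ = η₁`. This transfers Taylor coefficients from the
chosen inverse to the explicit one. -/
theorem IsInverseAtZero.eventuallyEq {y η₁ η₂ : ℂ → ℂ} (h₁ : IsInverseAtZero y η₁)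
    (h₂ : IsInverseAtZero y η₂) : η₁ =ᶠ[𝓝 0] η₂ := by
  have ht : Tendsto η₁ (𝓝 0) (𝓝 0) := by
    have := h₁.1.continuousAt.tendsto
    rwa [h₁.2.1] at this
  filter_upwards [h₁.2.2.2, ht.eventually h₂.2.2.1] with t h3 h4
  rw [← h4, h3]

theorem rootPhase_congr {f F : ℂ → ℂ} (h : f =ᶠ[𝓝 0] F) (k : ℕ) :
    rootPhase f k =ᶠ[𝓝 0] rootPhase F k := by
  filter_upwards [h] with x hx
  rw [rootPhase, rootPhase, taylorCoeff_congr h, hx]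

/-! ### The arguments of the endpoints -/

/-- The leading coefficient is the limit of `F(x)/x^k`. Approaching `0` from the right gives a
nonnegative real part; for odd `k` the approach from the left gives the opposite sign. -/
theorem re_leading_coeff {F : ℂ → ℂ} {k : ℕ} (ha : AnalyticAt ℂ F 0)
    (ho : analyticOrderAt F 0 = k) (hre : ∀ᶠ x : ℝ in 𝓝 0, 0 ≤ (F x).re) :
    0 ≤ (taylorCoeff F k).re ∧ (¬ Even k → (taylorCoeff F k).re = 0) := by
  obtain ⟨g, hg, -, he⟩ := ha.analyticOrderAt_eq_natCast.1 ho
  have hc : taylorCoeff F k = g 0 := by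
    rw [← taylorCoeff_pow_mul hg k]
    refine taylorCoeff_congr ?_ k
    filter_upwards [he] with x hx
    rw [hx, sub_zero, smul_eq_mul]
  have hof : Tendsto (fun x : ℝ => (x : ℂ)) (𝓝 0) (𝓝 0) := by
    have := Complex.continuous_ofReal.tendsto 0
    rwa [Complex.ofReal_zero] at this
  have hlim : Tendsto (fun x : ℝ => (g x).re) (𝓝 0) (𝓝 (g 0).re) :=
    (Complex.continuous_re.tendsto _).comp (hg.continuousAt.tendsto.comp hof)
  have hpt : ∀ᶠ x : ℝ in 𝓝 0, 0 ≤ x ^ k * (g x).re := by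
    filter_upwards [hof.eventually he, hre] with x h1 h2
    rw [h1, sub_zero, smul_eq_mul, ← Complex.ofReal_pow, Complex.re_ofReal_mul] at h2
    exact h2
  have hpos : 0 ≤ (g 0).re := by
    refine ge_of_tendsto (hlim.mono_left (nhdsWithin_le_nhds (s := Ioi 0))) ?_
    filter_upwards [hpt.filter_mono nhdsWithin_le_nhds, self_mem_nhdsWithin] with x h1 h2
    exact nonneg_of_mul_nonneg_right h1 (pow_pos h2 k)
  rw [hc]
  refine ⟨hpos, fun hk => le_antisymm ?_ hpos⟩
  refine le_of_tendsto (hlim.mono_left (nhdsWithin_le_nhds (s := Iio 0))) ?_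
  filter_upwards [hpt.filter_mono nhdsWithin_le_nhds, self_mem_nhdsWithin] with x h1 h2
  have : x ^ k < 0 := (Nat.not_even_iff_odd.1 hk).pow_neg h2
  by_contra! h3
  exact absurd h1 (not_le.2 (mul_neg_of_neg_of_pos this h3))

/-- The argument is `(arg c + arg u)/k` with the sum not reduced modulo `2π`, which is what decides
the ray from which the endpoint is reached. -/
theorem root_polar (k : ℕ) {c u : ℂ} (hc : c ≠ 0) (hu : u ≠ 0) {x : ℝ} (hx : 0 ≤ x) :
    c ^ (1 / (k : ℂ)) * x * u ^ (1 / (k : ℂ)) =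
      ‖c ^ (1 / (k : ℂ)) * x * u ^ (1 / (k : ℂ))‖
        * Complex.exp (Complex.I * (((c.arg + u.arg : ℝ) : ℂ) / k)) := by
  have h : c ^ (1 / (k : ℂ)) * x * u ^ (1 / (k : ℂ)) =
      ((‖c‖ ^ (1 / (k : ℝ)) * x * ‖u‖ ^ (1 / (k : ℝ)) : ℝ) : ℂ)
        * Complex.exp (Complex.I * (((c.arg + u.arg : ℝ) : ℂ) / k)) := by
    rw [cpow_inv_natCast_eq k hc, cpow_inv_natCast_eq k hu]
    have : Complex.I * (((c.arg + u.arg : ℝ) : ℂ) / k)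
        = Complex.I * (c.arg / k) + Complex.I * (u.arg / k) := by push_cast; ring
    rw [this, Complex.exp_add]
    push_cast
    ring
  have he : ‖Complex.exp (Complex.I * (((c.arg + u.arg : ℝ) : ℂ) / k))‖ = 1 := by
    have : Complex.I * (((c.arg + u.arg : ℝ) : ℂ) / k)
        = (((c.arg + u.arg) / k : ℝ) : ℂ) * Complex.I := by push_cast; ring
    rw [this, Complex.norm_exp_ofReal_mul_I]
  have hn : ‖c ^ (1 / (k : ℂ)) * x * u ^ (1 / (k : ℂ))‖
      = ‖c‖ ^ (1 / (k : ℝ)) * x * ‖u‖ ^ (1 / (k : ℝ)) := by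
    rw [h, norm_mul, he, mul_one, Complex.norm_real, Real.norm_eq_abs,
      abs_of_nonneg (by positivity)]
  rw [hn]
  exact h

/-- The `k`-th root of unity along whose ray the path leaves `0` on the side of negative angles. -/
def negRay (c : ℂ) (k : ℕ) : ℂ :=
  if Even k then -1
  else -Complex.exp (Complex.I * (((if 0 ≤ c.im then Real.pi else -Real.pi : ℝ) : ℂ) / k))

theorem negRay_pow {k : ℕ} (hk : 1 ≤ k) (c : ℂ) : negRay c k ^ k = 1 := by
  unfold negRay
  split_ifs with h h'
  · exact h.neg_one_pow
  all_goals
    have hk0 : (k : ℂ) ≠ 0 := by exact_mod_cast (by omega : k ≠ 0)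
    rw [neg_pow, (Nat.not_even_iff_odd.1 h).neg_one_pow, ← Complex.exp_nat_mul]
  · have : (k : ℂ) * (Complex.I * ((Real.pi : ℝ) / k)) = Real.pi * Complex.I := by field_simp
    rw [this, Complex.exp_pi_mul_I]; ring
  · have : (k : ℂ) * (Complex.I * ((-Real.pi : ℝ) / k)) = -(Real.pi * Complex.I) := by
      push_cast; field_simp
    rw [this, Complex.exp_neg, Complex.exp_pi_mul_I]; norm_num

theorem exists_angle_pos {c u : ℂ} (hre : 0 ≤ c.re) (hu : ‖u - 1‖ ≤ 1 / 2) :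
    |c.arg + u.arg| < Real.pi := by
  have h1 := Complex.abs_arg_le_pi_div_two_iff.2 hre
  have h2 : |u.arg| < Real.pi / 2 :=
    Complex.abs_arg_lt_pi_div_two_iff.2
      (Or.inl (by linarith [re_ge_half_of_norm_sub_one_le hu]))
  calc _ ≤ |c.arg| + |u.arg| := abs_add_le _ _
    _ < _ := by linarith

/-- For even `k` the sign is itself a `k`-th root of unity. For odd `k` it is not, but then `arg c =
±π/2`, and turning by `±π/k` gives a root of unity while changing the residual angle to `arg u ∓
π/2`, still inside `(-π, π)`. -/
theorem exists_angle_neg {k : ℕ} {c u : ℂ} (hc : c ≠ 0) (hre : 0 ≤ c.re)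
    (hodd : ¬ Even k → c.re = 0) (hu : ‖u - 1‖ ≤ 1 / 2) :
    ∃ β : ℝ, |β| < Real.pi ∧ ∀ R : ℂ,
      -(R * Complex.exp (Complex.I * (((c.arg + u.arg : ℝ) : ℂ) / k)))
        = R * negRay c k * Complex.exp (Complex.I * ((β : ℂ) / k)) := by
  unfold negRay
  have h2 : |u.arg| < Real.pi / 2 :=
    Complex.abs_arg_lt_pi_div_two_iff.2
      (Or.inl (by linarith [re_ge_half_of_norm_sub_one_le hu]))
  split_ifs with h h'
  · exact ⟨c.arg + u.arg, exists_angle_pos hre hu, fun R => by ring⟩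
  · have him : 0 < c.im := lt_of_le_of_ne h' fun h0 => hc (Complex.ext (hodd h) h0.symm)
    have harg : c.arg = Real.pi / 2 := Complex.arg_eq_pi_div_two_iff.2 ⟨hodd h, him⟩
    refine ⟨c.arg + u.arg - Real.pi, ?_, fun R => ?_⟩
    · rw [harg]
      rw [abs_lt] at h2 ⊢
      constructor <;> linarith
    · have : Complex.I * (((c.arg + u.arg : ℝ) : ℂ) / k) = Complex.I * ((Real.pi : ℝ) / k)
          + Complex.I * (((c.arg + u.arg - Real.pi : ℝ) : ℂ) / k) := by push_cast; ring
      rw [this, Complex.exp_add]; ring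
  · have him : c.im < 0 := not_le.1 h'
    have harg : c.arg = -(Real.pi / 2) := Complex.arg_eq_neg_pi_div_two_iff.2 ⟨hodd h, him⟩
    refine ⟨c.arg + u.arg + Real.pi, ?_, fun R => ?_⟩
    · rw [harg]
      rw [abs_lt] at h2 ⊢
      constructor <;> linarith
    · have : Complex.I * (((c.arg + u.arg : ℝ) : ℂ) / k) = Complex.I * ((-Real.pi : ℝ) / k)
          + Complex.I * (((c.arg + u.arg + Real.pi : ℝ) : ℂ) / k) := by push_cast; ring
      rw [this, Complex.exp_add]; ring

theorem re_pow_eq {k : ℕ} (hk : 1 ≤ k) {ω : ℂ} (hω : ω ^ k = 1) (R β : ℝ) :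
    ((R * ω * Complex.exp (Complex.I * ((β : ℂ) / k))) ^ k).re = R ^ k * Real.cos β := by
  have hk0 : (k : ℂ) ≠ 0 := by exact_mod_cast (by omega : k ≠ 0)
  have : (k : ℂ) * (Complex.I * ((β : ℂ) / k)) = β * Complex.I := by field_simp
  rw [mul_pow, mul_pow, hω, mul_one, ← Complex.exp_nat_mul, this, ← Complex.ofReal_pow,
    Complex.re_ofReal_mul, Complex.exp_ofReal_mul_I_re]

/-- The rays `1` and `ω = negRay` contribute `1` and `ω^{l+1}` times the same moment. For even `k`
the difference is `2` or `0` by the parity of `l`; for odd `k`, conjugating `A(k, l)` corresponds to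
replacing `π` by `-π` in `ω`. -/
theorem constScriptA_mul {k : ℕ} (c : ℂ) (l : ℕ) (s : ℝ) :
    constScriptA c k l * ((s ^ (-(((l : ℝ) + 1) / (k : ℝ))) : ℝ) : ℂ)
      = (1 - negRay c k ^ (l + 1)) * (laplaceMoment k l s : ℂ) := by
  unfold constScriptA constA negRay laplaceMoment
  by_cases hk : Even k
  · simp only [hk, if_true]
    by_cases hl : Even l
    · have h1 : (-1 : ℂ) ^ (l + 1) = -1 := (hl.add_one).neg_one_pow
      simp only [hl, if_true, Complex.conj_ofReal, ite_self, h1]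
      push_cast
      ring
    · have h1 : (-1 : ℂ) ^ (l + 1) = 1 := (Nat.not_even_iff_odd.1 hl).add_one.neg_one_pow
      simp [hl, h1]
  · simp only [hk, if_false]
    have key : ∀ τ : ℝ, (1 : ℂ) - (-Complex.exp (Complex.I * ((τ : ℂ) / k))) ^ (l + 1)
        = 1 + (-1) ^ l * Complex.exp (Complex.I * τ * (((l : ℂ) + 1) / k)) := by
      intro τ
      rw [neg_pow, ← Complex.exp_nat_mul, pow_succ]
      have : ((l + 1 : ℕ) : ℂ) * (Complex.I * ((τ : ℂ) / k))
          = Complex.I * τ * (((l : ℂ) + 1) / k) := by push_cast; ring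
      rw [this]; ring
    rw [key]
    split_ifs with h
    · push_cast
      ring
    · rw [map_mul, Complex.conj_ofReal, map_add, map_one, map_mul, map_pow, map_neg, map_one,
        ← Complex.exp_conj]
      have : (starRingEnd ℂ) (Complex.I * Real.pi * (((l : ℂ) + 1) / k))
          = Complex.I * (-Real.pi : ℝ) * (((l : ℂ) + 1) / k) := by
        simp
      rw [this]
      push_cast
      ring

theorem isInverseAtZero_of_coordinate {y Y η : ℂ → ℂ} {ρ δ : ℝ} (hρ : 0 < ρ) (hδ : 0 < δ)
    (hη0 : η 0 = 0) (hηd : DifferentiableOn ℂ η (ball 0 ρ))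
    (hη : ∀ t ∈ ball (0 : ℂ) ρ, Y (η t) = t) (hY : ∀ x ∈ ball (0 : ℂ) δ, η (Y x) = x)
    (hy : y =ᶠ[𝓝 0] Y) : IsInverseAtZero y η := by
  have hηa : AnalyticAt ℂ η 0 := hηd.analyticAt (ball_mem_nhds 0 hρ)
  have hηt : Tendsto η (𝓝 0) (𝓝 0) := by
    have := hηa.continuousAt.tendsto
    rwa [hη0] at this
  refine ⟨hηa, hη0, ?_, ?_⟩
  · filter_upwards [hy, ball_mem_nhds (0 : ℂ) hδ] with x h1 h2
    rw [h1, hY x h2]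
  · filter_upwards [hηt.eventually hy, ball_mem_nhds (0 : ℂ) hρ] with t h1 h2
    rw [h1, hη t h2]

/-! ### The uniform Laplace expansion -/

/-- The expansion of one endpoint, with all constants depending on the bounds only. -/
theorem exists_endpoint_bound {k : ℕ} (hk : 1 ≤ k) {r M m : ℝ} (hr : 0 < r) (hm : 0 < m) (n : ℕ) :
    ∃ C : ℝ, 0 ≤ C ∧ ∀ (B Q : ℂ → ℂ) (s β : ℝ) (y ω : ℂ), DifferentiableOn ℂ B (ball 0 r) →
      (∀ x ∈ ball (0 : ℂ) r, ‖B x‖ ≤ M) →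
      (∀ x ∈ ball (0 : ℂ) r, HasDerivAt Q (B x * Complex.exp (-s * x ^ k)) x) →
      ω ^ k = 1 → y ∈ ball (0 : ℂ) r → y = ‖y‖ * ω * Complex.exp (Complex.I * (β / k)) →
      |β| < Real.pi → m ≤ (y ^ k).re → 1 ≤ s →
      ‖Q y - Q 0 - ∑ l ∈ Finset.range n,
          taylorCoeff B l * ω ^ (l + 1) * (laplaceMoment k l s : ℂ)‖ ≤ C * laplaceMoment k n s := by
  obtain ⟨C₁, hC₁, hexp⟩ := exists_exp_neg_le_laplaceMoment hk n hm
  set R₀ : ℝ := m ^ ((k : ℝ)⁻¹) with hR₀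
  have hR₀p : 0 < R₀ := Real.rpow_pos_of_pos hm _
  set K : ℝ := (∑ l ∈ Finset.range n, |M| * (2 / r) ^ l * (R₀⁻¹) ^ (n - l)) + |M| * (2 / r) ^ n
    with hK
  refine ⟨K + |M| * C₁ * r * Real.pi, by have := Real.pi_pos; positivity, ?_⟩
  intro B Q s β y ω hB hM hQ hω hy hyeq hβ hmy hs
  have hs0 : 0 < s := by linarith
  have hM' : ∀ x ∈ ball (0 : ℂ) r, ‖B x‖ ≤ |M| := fun x hx => (hM x hx).trans (le_abs_self M)
  have hcos : m ≤ ‖y‖ ^ k * Real.cos β := by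
    rw [← re_pow_eq hk hω, ← hyeq]; exact hmy
  -- From `|y|^k ≥ Re y^k ≥ m`, so `R₀ = m^{1/k}` is a lower bound common to all admissible
  -- endpoints.
  have hRy : R₀ ≤ ‖y‖ := by
    refine le_of_pow_le_pow_left₀ (n := k) (by omega) (norm_nonneg _) ?_
    rw [hR₀, Real.rpow_inv_natCast_pow hm.le (by omega), ← norm_pow]
    exact hmy.trans (Complex.re_le_norm _)
  have h := norm_endpoint_sub_sum_le hk hr hB hM' hQ hω hR₀p hRy (mem_ball_zero_iff.1 hy) hs0 hβ
    hcos n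
  rw [← hyeq] at h
  refine h.trans ?_
  have h1 := hexp s hs
  have h2 : |M| * Real.exp (-s * m) * r * Real.pi
      ≤ |M| * (C₁ * laplaceMoment k n s) * r * Real.pi := by
    have := Real.pi_pos
    gcongr
  calc _ ≤ K * laplaceMoment k n s + |M| * (C₁ * laplaceMoment k n s) * r * Real.pi :=
        add_le_add le_rfl h2
    _ = _ := by ring

/-- The order of quantifiers is the point: `δ₀` comes first, since the lower bound `m` for `Re
F(±δ)` can only be named once `δ` is fixed, and `C` is chosen before the functions. The germs `f`,
`ψ` define the coefficients, while `F`, `Ψ` are representatives on a fixed disk. -/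
theorem laplace_expansion_uniform {k : ℕ} (hk : 1 ≤ k) {r M c₀ : ℝ} (hr : 0 < r) (hc₀ : 0 < c₀) :
    ∃ δ₀ > 0, δ₀ < r ∧ ∀ δ : ℝ, 0 < δ → δ ≤ δ₀ → ∀ (M₂ m : ℝ), 0 < m → ∀ n : ℕ,
      ∃ C : ℝ, 0 ≤ C ∧ ∀ F Ψ f ψ : ℂ → ℂ, DifferentiableOn ℂ F (ball 0 r) →
        DifferentiableOn ℂ Ψ (ball 0 r) → (∀ x ∈ ball (0 : ℂ) r, ‖F x‖ ≤ M) →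
        (∀ x ∈ ball (0 : ℂ) r, ‖Ψ x‖ ≤ M₂) → f =ᶠ[𝓝 0] F → ψ =ᶠ[𝓝 0] Ψ →
        analyticOrderAt f 0 = k → c₀ ≤ ‖taylorCoeff f k‖ → (∀ᶠ x : ℝ in 𝓝 0, 0 ≤ (F x).re) →
        m ≤ (F δ).re → m ≤ (F (-δ)).re → ∀ s : ℝ, 1 ≤ s →
        ‖(∫ x in (-δ)..δ, Ψ x * Complex.exp (-s * F x)) -
          ∑ l ∈ Finset.range n, constScriptA (taylorCoeff f k) k l *
            taylorCoeff (fun t => ψ (inverseAtZero (rootPhase f k) t)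
              * deriv (inverseAtZero (rootPhase f k)) t) l *
            ((s ^ (-(((l : ℝ) + 1) / (k : ℝ))) : ℝ) : ℂ)‖
          ≤ C * s ^ (-(((n : ℝ) + 1) / (k : ℝ))) := by
  obtain ⟨δ₀, hδ₀, hδr, ρ, hρ, A, hA, H⟩ := exists_root_coordinate hk (M := M) hr hc₀
  refine ⟨δ₀, hδ₀, hδr, fun δ hδ hδδ M₂ m hm n => ?_⟩
  obtain ⟨C, hC, hend⟩ := exists_endpoint_bound hk (M := M₂ * A) hρ hm n
  have hG : 0 ≤ 1 / (k : ℝ) * Real.Gamma (((n : ℝ) + 1) / k) :=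
    mul_nonneg (by positivity) (Real.Gamma_nonneg_of_nonneg (by positivity))
  refine ⟨2 * C * (1 / (k : ℝ) * Real.Gamma (((n : ℝ) + 1) / k)), by positivity, ?_⟩
  intro F Ψ f ψ hF hΨ hFM hΨM hfF hψΨ ho hc hre hm₁ hm₂ s hs
  have hcF : taylorCoeff f k = taylorCoeff F k := taylorCoeff_congr hfF k
  have hoF : analyticOrderAt F 0 = k := by rw [← analyticOrderAt_congr hfF, ho]
  obtain ⟨u, Y, η, hη0, hηd, hη, hY⟩ := H F hF hFM hoF (hcF ▸ hc)
  set c := taylorCoeff F k with hcdef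
  have hc0 : c ≠ 0 := norm_pos_iff.1 (hc₀.trans_le (hcF ▸ hc))
  have hFa : AnalyticAt ℂ F 0 := hF.analyticAt (ball_mem_nhds 0 hr)
  obtain ⟨hcre, hcodd⟩ := re_leading_coeff hFa hoF hre
  have hM₂ : 0 ≤ M₂ := (norm_nonneg _).trans (hΨM 0 (mem_ball_self hr))
  -- the inverse germ
  have hηa : AnalyticAt ℂ η 0 := hηd.analyticAt (ball_mem_nhds 0 hρ)
  have hYroot : rootPhase f k =ᶠ[𝓝 0] Y := by
    filter_upwards [rootPhase_congr hfF k, ball_mem_nhds (0 : ℂ) (by linarith : 0 < 2 * δ₀)]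
      with x h1 h2
    rw [h1, (hY x h2).2.2.2.2.2.1]
  have hηt : Tendsto η (𝓝 0) (𝓝 0) := by
    have := hηa.continuousAt.tendsto
    rwa [hη0] at this
  have hinv : IsInverseAtZero (rootPhase f k) η :=
    isInverseAtZero_of_coordinate hρ (by linarith : 0 < 2 * δ₀) hη0 hηd (fun t ht => (hη t ht).2.1)
      (fun x hx => (hY x hx).2.2.1) hYroot
  have hinv' : IsInverseAtZero (rootPhase f k) (inverseAtZero (rootPhase f k)) :=
    Classical.epsilon_spec (p := IsInverseAtZero (rootPhase f k)) ⟨η, hinv⟩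
  have hηη := hinv'.eventuallyEq hinv
  set B : ℂ → ℂ := fun t => Ψ (η t) * deriv η t with hBdef
  have hBeq : (fun t => ψ (inverseAtZero (rootPhase f k) t)
      * deriv (inverseAtZero (rootPhase f k)) t) =ᶠ[𝓝 0] B := by
    filter_upwards [hηη, hηη.deriv, hηt.eventually hψΨ] with t h1 h2 h3
    rw [h1, h2, h3]
  have hBd : DifferentiableOn ℂ B (ball 0 ρ) :=
    (hΨ.comp hηd fun t ht => (hη t ht).1).mul (hηd.deriv isOpen_ball)
  have hBM : ∀ t ∈ ball (0 : ℂ) ρ, ‖B t‖ ≤ M₂ * A := fun t ht => by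
    rw [hBdef]
    simp only
    rw [norm_mul]
    exact mul_le_mul (hΨM _ (hη t ht).1) (hη t ht).2.2 (norm_nonneg _) hM₂
  -- a primitive in the coordinate
  have hex : DifferentiableOn ℂ (fun y => B y * Complex.exp (-s * y ^ k)) (ball 0 ρ) :=
    hBd.mul (by fun_prop)
  obtain ⟨Q, hQ⟩ := hex.isExactOn_ball
  have hδm : ∀ x : ℝ, x ∈ Icc (-δ) δ → (x : ℂ) ∈ ball (0 : ℂ) (2 * δ₀) := by
    intro x hx
    rw [mem_ball_zero_iff, Complex.norm_real, Real.norm_eq_abs]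
    exact (abs_le.2 hx).trans_lt (by linarith)
  -- Change of variables through the primitive: `η ∘ Y = id` gives `η'(Y) Y' = 1`, so `Q ∘ Y` is an
  -- antiderivative of the original integrand.
  have hder : ∀ x ∈ uIcc (-δ) δ, HasDerivAt (fun x : ℝ => Q (Y x))
      (Ψ x * Complex.exp (-s * F x)) x := by
    intro x hx
    rw [uIcc_of_le (by linarith)] at hx
    have hxm := hδm x hx
    obtain ⟨-, h2, h3, h4, h5, -⟩ := hY x hxm
    have h6 : HasDerivAt (fun z : ℂ => η (Y z)) (deriv η (Y x) * deriv Y x) x :=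
      ((hηd.differentiableAt (isOpen_ball.mem_nhds h2)).hasDerivAt).comp (x : ℂ) h4.hasDerivAt
    have h7 : (fun z : ℂ => η (Y z)) =ᶠ[𝓝 (x : ℂ)] fun z => z := by
      filter_upwards [isOpen_ball.mem_nhds hxm] with z hz using (hY z hz).2.2.1
    have h8 : deriv η (Y x) * deriv Y x = 1 :=
      (h6.congr_of_eventuallyEq h7.symm).unique (hasDerivAt_id (x : ℂ))
    have h9 := ((hQ _ h2).comp (x : ℂ) h4.hasDerivAt).comp_ofReal
    refine h9.congr_deriv ?_
    rw [hBdef]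
    simp only
    rw [h3, h5]
    linear_combination Ψ x * Complex.exp (-s * F x) * h8
  have hsub : ∀ x : ℝ, x ∈ uIcc (-δ) δ → (x : ℂ) ∈ ball (0 : ℂ) r := fun x hx => by
    rw [uIcc_of_le (by linarith)] at hx
    exact (hY x (hδm x hx)).1
  have hint : (∫ x in (-δ)..δ, Ψ x * Complex.exp (-s * F x)) = Q (Y δ) - Q (Y (-δ)) := by
    rw [intervalIntegral.integral_eq_sub_of_hasDerivAt hder]
    · simp
    · refine ContinuousOn.intervalIntegrable ?_
      have h1 : ContinuousOn (fun x : ℝ => Ψ x) (uIcc (-δ) δ) :=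
        hΨ.continuousOn.comp (by fun_prop) hsub
      have h2 : ContinuousOn (fun x : ℝ => F x) (uIcc (-δ) δ) :=
        hF.continuousOn.comp (by fun_prop) hsub
      exact h1.mul (Complex.continuous_exp.comp_continuousOn (continuousOn_const.mul h2))
  -- the two endpoints
  have hpd := hδm δ ⟨by linarith, le_rfl⟩
  have hnd : (-δ : ℂ) ∈ ball (0 : ℂ) (2 * δ₀) := by
    have := hδm (-δ) ⟨le_rfl, by linarith⟩
    rwa [Complex.ofReal_neg] at this
  obtain ⟨-, p2, -, -, p5, -, p7, p8⟩ := hY _ hpd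
  obtain ⟨-, n2, -, -, n5, -, n7, n8⟩ := hY _ hnd
  have une : ∀ {z : ℂ}, ‖z - 1‖ ≤ 1 / 2 → z ≠ 0 := fun {z} hz h0 => by
    have := re_ge_half_of_norm_sub_one_le hz
    rw [h0, Complex.zero_re] at this
    linarith
  have e₁ := hend B Q s (c.arg + (u δ).arg) (Y δ) 1 hBd hBM hQ (one_pow k) p2
    (by rw [mul_one, p8]; exact root_polar k hc0 (une p7) hδ.le)
    (exists_angle_pos hcre p7) (by rw [p5]; exact hm₁) hs
  obtain ⟨β, hβ, hβe⟩ := exists_angle_neg (k := k) hc0 hcre hcodd n7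
  have e₂ := hend B Q s β (Y (-δ)) (negRay c k) hBd hBM hQ (negRay_pow hk c) n2
    (by
      -- The sign is pulled out because the polar form is available only for a nonnegative factor
      -- `x`.
      have h1 : Y (-δ) = -(c ^ (1 / (k : ℂ)) * δ * u (-δ) ^ (1 / (k : ℂ))) := by rw [n8]; ring
      rw [h1, norm_neg, ← hβe, ← root_polar k hc0 (une n7) hδ.le])
    hβ (by rw [n5]; exact hm₂) hs
  rw [hint]
  have hsum : ∑ l ∈ Finset.range n, constScriptA (taylorCoeff f k) k l *
      taylorCoeff (fun t => ψ (inverseAtZero (rootPhase f k) t)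
        * deriv (inverseAtZero (rootPhase f k)) t) l *
        ((s ^ (-(((l : ℝ) + 1) / (k : ℝ))) : ℝ) : ℂ)
      = ∑ l ∈ Finset.range n, taylorCoeff B l * 1 ^ (l + 1) * (laplaceMoment k l s : ℂ)
        - ∑ l ∈ Finset.range n,
          taylorCoeff B l * negRay c k ^ (l + 1) * (laplaceMoment k l s : ℂ) := by
    rw [← Finset.sum_sub_distrib]
    refine Finset.sum_congr rfl fun l _ => ?_
    rw [taylorCoeff_congr hBeq, mul_right_comm, hcF, constScriptA_mul]
    ring
  rw [hsum]
  calc _ = ‖(Q (Y δ) - Q 0 - ∑ l ∈ Finset.range n,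
            taylorCoeff B l * 1 ^ (l + 1) * (laplaceMoment k l s : ℂ))
          - (Q (Y (-δ)) - Q 0 - ∑ l ∈ Finset.range n,
            taylorCoeff B l * negRay c k ^ (l + 1) * (laplaceMoment k l s : ℂ))‖ := by
        congr 1; ring
    _ ≤ C * laplaceMoment k n s + C * laplaceMoment k n s :=
        (norm_sub_le _ _).trans (add_le_add e₁ e₂)
    _ = _ := by rw [laplaceMoment]; ring

/-! ### Circle integrals -/

theorem hasSum_circleIntegral {ι : Type*} [Countable ι] {f : ι → ℂ → ℂ} {g : ℂ → ℂ} {R : ℝ}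
    (hR : 0 < R) (b : ι → ℝ) (hf : ∀ i, ContinuousOn (f i) (sphere 0 R))
    (hb : ∀ i, ∀ u ∈ sphere (0 : ℂ) R, ‖f i u‖ ≤ b i) (hs : Summable b)
    (hg : ∀ u ∈ sphere (0 : ℂ) R, HasSum (fun i => f i u) (g u)) :
    HasSum (fun i => ∮ u in C(0, R), f i u) (∮ u in C(0, R), g u) := by
  have hmem : ∀ θ, circleMap 0 R θ ∈ sphere (0 : ℂ) R := fun θ => circleMap_mem_sphere 0 hR.le θ
  refine intervalIntegral.hasSum_integral_of_dominated_convergence (fun i _ => R * b i) ?_ ?_ ?_ ?_ ?_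
  · intro i
    refine Continuous.aestronglyMeasurable ?_
    have h1 : Continuous fun θ => f i (circleMap 0 R θ) :=
      (hf i).comp_continuous (continuous_circleMap 0 R) hmem
    have h2 : Continuous (deriv (circleMap 0 R)) := by
      have : deriv (circleMap 0 R) = fun θ => circleMap 0 R θ * Complex.I := by
        ext θ; exact deriv_circleMap 0 R θ
      rw [this]
      exact (continuous_circleMap 0 R).mul continuous_const
    exact h2.smul h1
  · intro i
    refine ae_of_all _ fun θ _ => ?_
    rw [norm_smul, deriv_circleMap, norm_mul, Complex.norm_I, mul_one, norm_circleMap_zero,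
      abs_of_pos hR]
    exact mul_le_mul_of_nonneg_left (hb i _ (hmem θ)) hR.le
  · exact ae_of_all _ fun θ _ => hs.mul_left R
  · exact intervalIntegrable_const
  · exact ae_of_all _ fun θ _ => (hg _ (hmem θ)).const_smul _

theorem circleIntegral_inv_pow_mul_pow {R : ℝ} (hR : 0 < R) (s n : ℕ) :
    (∮ u in C(0, R), (u ^ (s + 1))⁻¹ * u ^ n) = if n = s then 2 * Real.pi * Complex.I else 0 := by
  have h : (∮ u in C(0, R), (u ^ (s + 1))⁻¹ * u ^ n)
      = ∮ u in C(0, R), (u - 0) ^ ((n : ℤ) - (s + 1)) := by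
    refine circleIntegral.integral_congr hR.le fun u hu => ?_
    have hu0 : u ≠ 0 := by
      rintro rfl
      simp only [mem_sphere_iff_norm, sub_zero, norm_zero] at hu
      exact hR.ne hu
    rw [sub_zero, zpow_sub₀ hu0, zpow_natCast]
    have : u ^ ((s : ℤ) + 1) = u ^ (s + 1) := by exact_mod_cast zpow_natCast u (s + 1)
    rw [this, div_eq_mul_inv, mul_comm]
  rw [h]
  split_ifs with hn
  · have : (n : ℤ) - (s + 1) = -1 := by omega
    simp only [this, zpow_neg_one]
    exact circleIntegral.integral_sub_center_inv 0 hR.ne'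
  · exact circleIntegral.integral_sub_zpow_of_ne (by omega) 0 0 R

theorem continuousOn_inv_pow_sphere {R : ℝ} (hR : 0 < R) (n : ℕ) :
    ContinuousOn (fun u : ℂ => (u ^ n)⁻¹) (sphere 0 R) := by
  refine (continuousOn_id.pow n).inv₀ fun u hu => pow_ne_zero _ ?_
  rintro h
  simp only [id] at h
  rw [h, mem_sphere_zero_iff_norm, norm_zero] at hu
  exact hR.ne hu

/-- The coefficients of a convergent double power series as iterated circle integrals. -/
theorem iterated_circleIntegral_eq_coeff {F : ℂ × ℂ → ℂ} {a : ℕ → ℕ → ℂ}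
    (hF : ∀ᶠ q : ℂ × ℂ in 𝓝 0,
      HasSum (fun n : ℕ × ℕ => a n.1 n.2 * q.1 ^ n.1 * q.2 ^ n.2) (F q)) :
    ∃ ρ₀ > 0, ∀ ρ₁ ρ₂ : ℝ, 0 < ρ₁ → ρ₁ ≤ ρ₀ → 0 < ρ₂ → ρ₂ ≤ ρ₀ → ∀ r s : ℕ,
      (∮ ζ in C(0, ρ₁), (ζ ^ (r + 1))⁻¹ * ∮ u in C(0, ρ₂), (u ^ (s + 1))⁻¹ * F (ζ, u))
        = (2 * Real.pi * Complex.I) ^ 2 * a r s := by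
  obtain ⟨ε, hε, hball⟩ := Metric.eventually_nhds_iff_ball.1 hF
  refine ⟨ε / 2, by positivity, fun ρ₁ ρ₂ h1 h1' h2 h2' r s => ?_⟩
  have hsum : ∀ ζ ∈ sphere (0 : ℂ) ρ₁, ∀ u ∈ sphere (0 : ℂ) ρ₂,
      HasSum (fun n : ℕ × ℕ => a n.1 n.2 * ζ ^ n.1 * u ^ n.2) (F (ζ, u)) := by
    intro ζ hζ u hu
    rw [mem_sphere_zero_iff_norm] at hζ hu
    refine hball (ζ, u) ?_
    rw [mem_ball_zero_iff, Prod.norm_def, max_lt_iff]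
    exact ⟨by simp only; rw [hζ]; linarith, by simp only; rw [hu]; linarith⟩
  set b : ℕ × ℕ → ℝ := fun n => ‖a n.1 n.2‖ * ρ₁ ^ n.1 * ρ₂ ^ n.2 with hb
  -- Convergence at the single point `(ρ₁, ρ₂)` is absolute and dominates the series on the whole
  -- torus of these radii.
  have hbs : Summable b := by
    have h := (hsum (ρ₁ : ℂ) (by simp [h1.le]) (ρ₂ : ℂ) (by simp [h2.le])).summable.norm
    refine h.congr fun n => ?_
    simp [hb, abs_of_pos h1, abs_of_pos h2]
  have inner : ∀ ζ ∈ sphere (0 : ℂ) ρ₁,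
      HasSum (fun n : ℕ × ℕ => (a n.1 n.2 * ζ ^ n.1) *
        (if n.2 = s then 2 * Real.pi * Complex.I else 0))
        (∮ u in C(0, ρ₂), (u ^ (s + 1))⁻¹ * F (ζ, u)) := by
    intro ζ hζ
    have hζn : ‖ζ‖ = ρ₁ := mem_sphere_zero_iff_norm.1 hζ
    have h := hasSum_circleIntegral h2 (fun n : ℕ × ℕ => (ρ₂ ^ (s + 1))⁻¹ * b n)
      (f := fun n u => (u ^ (s + 1))⁻¹ * (a n.1 n.2 * ζ ^ n.1 * u ^ n.2))
      (g := fun u => (u ^ (s + 1))⁻¹ * F (ζ, u))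
      (fun n => (continuousOn_inv_pow_sphere h2 _).mul (by fun_prop)) ?_ (hbs.mul_left _)
      (fun u hu => (hsum ζ hζ u hu).mul_left _)
    · convert h using 2 with n
      rw [← circleIntegral_inv_pow_mul_pow h2 s n.2, ← circleIntegral.integral_const_mul]
      congr 1
      ext u
      ring
    · intro n u hu
      have hun : ‖u‖ = ρ₂ := mem_sphere_zero_iff_norm.1 hu
      simp only [hb, norm_mul, norm_inv, norm_pow, hun, hζn]
      exact le_rfl
  have outer := hasSum_circleIntegral h1
    (fun n : ℕ × ℕ => (ρ₁ ^ (r + 1))⁻¹ * ((2 * Real.pi * (ρ₂ ^ s)⁻¹) * b n))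
    (f := fun n ζ => (ζ ^ (r + 1))⁻¹ * ((a n.1 n.2 * ζ ^ n.1) *
        (if n.2 = s then 2 * Real.pi * Complex.I else 0)))
    (g := fun ζ => (ζ ^ (r + 1))⁻¹ * ∮ u in C(0, ρ₂), (u ^ (s + 1))⁻¹ * F (ζ, u))
    (fun n => (continuousOn_inv_pow_sphere h1 _).mul (by fun_prop)) ?_
    ((hbs.mul_left _).mul_left _) (fun ζ hζ => (inner ζ hζ).mul_left _)
  · refine outer.unique ?_
    have hterm : ∀ n : ℕ × ℕ, (∮ ζ in C(0, ρ₁), (ζ ^ (r + 1))⁻¹ * ((a n.1 n.2 * ζ ^ n.1) *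
        (if n.2 = s then 2 * Real.pi * Complex.I else 0)))
        = a n.1 n.2 * (if n.2 = s then 2 * Real.pi * Complex.I else 0) *
          (if n.1 = r then 2 * Real.pi * Complex.I else 0) := by
      intro n
      rw [← circleIntegral_inv_pow_mul_pow h1 r n.1, ← circleIntegral.integral_const_mul]
      congr 1
      ext u
      ring
    simp only [hterm]
    convert hasSum_single (r, s) ?_ using 1
    · simp only [if_true]; ring
    · intro n hn
      by_cases h : n.1 = r
      · have : n.2 ≠ s := fun h' => hn (Prod.ext h h')
        simp [this]
      · simp [h]
  · intro n ζ hζ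
    have hζn : ‖ζ‖ = ρ₁ := mem_sphere_zero_iff_norm.1 hζ
    rw [norm_mul, norm_inv, norm_pow, hζn]
    refine mul_le_mul_of_nonneg_left ?_ (by positivity)
    split_ifs with h
    · simp only [hb, norm_mul, norm_pow, hζn, Complex.norm_I, mul_one, Complex.norm_real,
        Complex.norm_ofNat, Real.norm_eq_abs, abs_of_pos Real.pi_pos]
      rw [h]
      refine le_of_eq ?_
      field_simp
    · simp only [mul_zero, norm_zero, hb]
      have := Real.pi_pos
      positivity

theorem circleIntegral_swap {f : ℂ → ℂ → ℂ} {R₁ R₂ : ℝ} (h1 : 0 ≤ R₁) (h2 : 0 ≤ R₂)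
    (hf : ContinuousOn (fun q : ℂ × ℂ => f q.1 q.2) (sphere 0 R₁ ×ˢ sphere 0 R₂)) :
    (∮ ζ in C(0, R₁), ∮ u in C(0, R₂), f ζ u) = ∮ u in C(0, R₂), ∮ ζ in C(0, R₁), f ζ u := by
  have hc : Continuous fun q : ℝ × ℝ => f (circleMap 0 R₁ q.1) (circleMap 0 R₂ q.2) :=
    hf.comp_continuous (f := fun q : ℝ × ℝ => (circleMap 0 R₁ q.1, circleMap 0 R₂ q.2))
      (((continuous_circleMap 0 R₁).comp continuous_fst).prodMk
        ((continuous_circleMap 0 R₂).comp continuous_snd))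
      fun q => ⟨circleMap_mem_sphere 0 h1 _, circleMap_mem_sphere 0 h2 _⟩
  simp only [circleIntegral, deriv_circleMap, ← intervalIntegral.integral_smul]
  rw [intervalIntegral_intervalIntegral_swap]
  · refine intervalIntegral.integral_congr fun θ _ => intervalIntegral.integral_congr fun φ _ => ?_
    simp only [smul_eq_mul]
    ring
  · have hc' : Continuous (Function.uncurry fun θ φ : ℝ => (circleMap 0 R₁ θ * Complex.I) •
        (circleMap 0 R₂ φ * Complex.I) • f (circleMap 0 R₁ θ) (circleMap 0 R₂ φ)) :=
      (((continuous_circleMap 0 R₁).comp continuous_fst).mul continuous_const).smul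
        ((((continuous_circleMap 0 R₂).comp continuous_snd).mul continuous_const).smul hc)
    refine (hc'.continuousOn.integrableOn_compact
      (isCompact_uIcc.prod isCompact_uIcc)).mono_set (prod_mono uIoc_subset_uIcc uIoc_subset_uIcc)

/-- Moving the outer circle across a region where the integrand has no singularity. -/
theorem iterated_circleIntegral_radius {F : ℂ × ℂ → ℂ} {ρ ρ₁ R₁ : ℝ} (hρ : 0 < ρ) (h1 : 0 < ρ₁)
    (hle : ρ₁ ≤ R₁) (hF : ∀ ζ ∈ closedBall (0 : ℂ) R₁, ∀ u ∈ sphere (0 : ℂ) ρ,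
      DifferentiableAt ℂ F (ζ, u)) (r s : ℕ) :
    (∮ ζ in C(0, R₁), (ζ ^ (r + 1))⁻¹ * ∮ u in C(0, ρ), (u ^ (s + 1))⁻¹ * F (ζ, u))
      = ∮ ζ in C(0, ρ₁), (ζ ^ (r + 1))⁻¹ * ∮ u in C(0, ρ), (u ^ (s + 1))⁻¹ * F (ζ, u) := by
  -- After exchanging the integrals, `u` is fixed and the integrand in `ζ` is singular at most at
  -- `0`, which the annulus avoids.
  have hsw : ∀ R, 0 < R → R ≤ R₁ →
      (∮ ζ in C(0, R), (ζ ^ (r + 1))⁻¹ * ∮ u in C(0, ρ), (u ^ (s + 1))⁻¹ * F (ζ, u))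
        = ∮ u in C(0, ρ), (u ^ (s + 1))⁻¹ * ∮ ζ in C(0, R), (ζ ^ (r + 1))⁻¹ * F (ζ, u) := by
    intro R hR hRR
    simp only [← circleIntegral.integral_const_mul]
    rw [circleIntegral_swap hR.le hρ.le]
    · congr 1
      ext u
      congr 1
      ext ζ
      ring
    · refine ((continuousOn_inv_pow_sphere hR _).comp continuousOn_fst fun q hq => hq.1).mul
        (((continuousOn_inv_pow_sphere hρ _).comp continuousOn_snd fun q hq => hq.2).mul ?_)
      intro q hq
      have hq1 : q.1 ∈ closedBall (0 : ℂ) R₁ :=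
        closedBall_subset_closedBall hRR (sphere_subset_closedBall hq.1)
      exact (hF q.1 hq1 q.2 hq.2).continuousAt.continuousWithinAt
  rw [hsw R₁ (h1.trans_le hle) le_rfl, hsw ρ₁ h1 hle]
  refine circleIntegral.integral_congr hρ.le fun u hu => ?_
  congr 1
  have hd : ∀ ζ ∈ closedBall (0 : ℂ) R₁ \ ball 0 ρ₁,
      DifferentiableAt ℂ (fun ζ => (ζ ^ (r + 1))⁻¹ * F (ζ, u)) ζ := by
    intro ζ hζ
    have hζ0 : ζ ≠ 0 := by
      rintro rfl
      exact hζ.2 (mem_ball_self h1)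
    have h3 : DifferentiableAt ℂ (fun ζ => F (ζ, u)) ζ :=
      (hF ζ hζ.1 u hu).comp ζ (differentiableAt_id.prodMk (differentiableAt_const u))
    exact ((differentiableAt_id.pow _).inv (pow_ne_zero _ hζ0)).mul h3
  exact Complex.circleIntegral_eq_of_differentiable_on_annulus_off_countable h1 hle
    (countable_empty) (fun ζ hζ => (hd ζ hζ).continuousAt.continuousWithinAt)
    fun ζ hζ => hd ζ ⟨ball_subset_closedBall hζ.1.1, fun h => hζ.1.2 (ball_subset_closedBall h)⟩

theorem circleIntegral_inv_pow_radius {φ : ℂ → ℂ} {ρ R : ℝ} (hρ : 0 < ρ) (hR : ρ ≤ R)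
    (hφ : ∀ u ∈ closedBall (0 : ℂ) R, DifferentiableAt ℂ φ u) (s : ℕ) :
    (∮ u in C(0, ρ), (u ^ (s + 1))⁻¹ * φ u) = ∮ u in C(0, R), (u ^ (s + 1))⁻¹ * φ u := by
  have hd : ∀ u ∈ closedBall (0 : ℂ) R \ ball 0 ρ,
      DifferentiableAt ℂ (fun u => (u ^ (s + 1))⁻¹ * φ u) u := by
    intro u hu
    have hu0 : u ≠ 0 := by
      rintro rfl
      exact hu.2 (mem_ball_self hρ)
    exact ((differentiableAt_id.pow _).inv (pow_ne_zero _ hu0)).mul (hφ u hu.1)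
  exact (Complex.circleIntegral_eq_of_differentiable_on_annulus_off_countable hρ hR
    (countable_empty) (fun u hu => (hd u hu).continuousAt.continuousWithinAt)
    fun u hu => hd u ⟨ball_subset_closedBall hu.1.1, fun h => hu.1.2 (ball_subset_closedBall h)⟩).symm

theorem norm_circleIntegral_inv_pow_le {φ : ℂ → ℂ} {R M : ℝ} (hR : 0 < R)
    (hM : ∀ u ∈ sphere (0 : ℂ) R, ‖φ u‖ ≤ M) (s : ℕ) :
    ‖∮ u in C(0, R), (u ^ (s + 1))⁻¹ * φ u‖ ≤ 2 * Real.pi * (M * (R ^ s)⁻¹) := by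
  have h := circleIntegral.norm_integral_le_of_norm_le_const (c := 0) (R := R)
    (f := fun u => (u ^ (s + 1))⁻¹ * φ u) (C := (R ^ (s + 1))⁻¹ * M) hR.le (fun u hu => ?_)
  · calc _ ≤ _ := h
      _ = _ := by rw [pow_succ]; field_simp
  · rw [norm_mul, norm_inv, norm_pow, mem_sphere_zero_iff_norm.1 hu]
    exact mul_le_mul_of_nonneg_left (hM u hu) (by positivity)

/-- Partial fractions: `1/(u^{n+1}(u-g)) = g⁻¹ (1/(u^n(u-g)) - 1/u^{n+1})`. The recursion replaces a
residue computation at a pole of high order. -/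
theorem circleIntegral_inv_pow_mul_inv_sub_succ {R : ℝ} (hR : 0 < R) {g : ℂ} (hg : g ≠ 0)
    (hgR : ‖g‖ ≠ R) (n : ℕ) :
    (∮ u in C(0, R), (u ^ (n + 1))⁻¹ * (u - g)⁻¹)
      = g⁻¹ * ((∮ u in C(0, R), (u ^ n)⁻¹ * (u - g)⁻¹)
        - if n = 0 then 2 * Real.pi * Complex.I else 0) := by
  have h0 : ∀ u ∈ sphere (0 : ℂ) R, u ≠ 0 ∧ u - g ≠ 0 := by
    intro u hu
    rw [mem_sphere_zero_iff_norm] at hu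
    refine ⟨?_, ?_⟩
    · rintro rfl
      rw [norm_zero] at hu
      exact hR.ne hu
    · intro h
      rw [sub_eq_zero.1 h] at hu
      exact hgR hu
  have hci : CircleIntegrable (fun u : ℂ => (u ^ n)⁻¹ * (u - g)⁻¹) 0 R :=
    ((continuousOn_inv_pow_sphere hR n).mul
      ((continuousOn_id.sub continuousOn_const).inv₀ fun u hu => (h0 u hu).2)).circleIntegrable hR.le
  have hci' : CircleIntegrable (fun u : ℂ => (u ^ (n + 1))⁻¹ * u ^ 0) 0 R :=
    ((continuousOn_inv_pow_sphere hR (n + 1)).mul (by fun_prop)).circleIntegrable hR.le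
  have hpow := circleIntegral_inv_pow_mul_pow hR n 0
  have he : (if n = 0 then 2 * Real.pi * Complex.I else 0)
      = ∮ u in C(0, R), (u ^ (n + 1))⁻¹ * u ^ 0 := by
    rw [hpow]
    exact if_congr eq_comm rfl rfl
  rw [he, ← circleIntegral.integral_sub hci hci', ← circleIntegral.integral_const_mul]
  refine circleIntegral.integral_congr hR.le fun u hu => ?_
  obtain ⟨hu0, hug⟩ := h0 u hu
  simp only [pow_zero, mul_one]
  field_simp
  ring

theorem circleIntegral_inv_pow_mul_inv_sub_of_mem {R : ℝ} (hR : 0 < R) {g : ℂ} (hg : g ≠ 0)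
    (hgR : ‖g‖ < R) (n : ℕ) : (∮ u in C(0, R), (u ^ (n + 1))⁻¹ * (u - g)⁻¹) = 0 := by
  induction n with
  | zero =>
    rw [circleIntegral_inv_pow_mul_inv_sub_succ hR hg hgR.ne]
    simp [circleIntegral.integral_sub_inv_of_mem_ball (mem_ball_zero_iff.2 hgR)]
  | succ n ih =>
    rw [circleIntegral_inv_pow_mul_inv_sub_succ hR hg hgR.ne, ih]
    simp

theorem circleIntegral_inv_pow_mul_inv_sub_of_lt {R : ℝ} (hR : 0 < R) {g : ℂ} (hg : g ≠ 0)
    (hgR : R < ‖g‖) (n : ℕ) : (∮ u in C(0, R), (u ^ (n + 1))⁻¹ * (u - g)⁻¹)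
      = -(2 * Real.pi * Complex.I) * (g ^ (n + 1))⁻¹ := by
  induction n with
  | zero =>
    rw [circleIntegral_inv_pow_mul_inv_sub_succ hR hg hgR.ne']
    have h0 : (∮ u in C(0, R), (u ^ 0)⁻¹ * (u - g)⁻¹) = 0 := by
      refine Complex.circleIntegral_eq_zero_of_differentiable_on_off_countable hR.le
        countable_empty ?_ ?_
      · refine ContinuousOn.mul (by simp [continuousOn_const])
          ((continuousOn_id.sub continuousOn_const).inv₀ fun u hu h => ?_)
        have h' : u = g := sub_eq_zero.1 h
        rw [h', mem_closedBall_zero_iff] at hu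
        linarith
      · intro u hu
        have hug : u - g ≠ 0 := fun h => by
          have := hu.1
          rw [sub_eq_zero.1 h, mem_ball_zero_iff] at this
          linarith
        have := ((differentiableAt_id (𝕜 := ℂ) (x := u)).sub_const g).inv hug
        simp only [pow_zero, inv_one, one_mul]
        exact this
    rw [h0]
    simp
    ring
  | succ n ih =>
    rw [circleIntegral_inv_pow_mul_inv_sub_succ hR hg hgR.ne', ih]
    simp
    field_simp
    ring

/-- Enlarging the circle past a simple pole. -/
theorem circleIntegral_inv_pow_simple_pole {φ N : ℂ → ℂ} {ρ R : ℝ} {g : ℂ} (hρ : 0 < ρ)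
    (hρg : ρ < ‖g‖) (hgR : ‖g‖ < R) (hN : ∀ u ∈ closedBall (0 : ℂ) R, DifferentiableAt ℂ N u)
    (hφ : ∀ u ∈ closedBall (0 : ℂ) R, u ≠ g → φ u = N u * (u - g)⁻¹) (s : ℕ) :
    (∮ u in C(0, ρ), (u ^ (s + 1))⁻¹ * φ u) = (∮ u in C(0, R), (u ^ (s + 1))⁻¹ * φ u)
      - 2 * Real.pi * Complex.I * (N g * (g ^ (s + 1))⁻¹) := by
  have hg0 : g ≠ 0 := by
    rintro rfl
    rw [norm_zero] at hρg
    linarith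
  have hR : 0 < R := (norm_nonneg g).trans_lt hgR
  have hga : AnalyticAt ℂ N g := by
    have h : DifferentiableOn ℂ N (ball 0 R) := fun u hu =>
      (hN u (ball_subset_closedBall hu)).differentiableWithinAt
    exact h.analyticAt (isOpen_ball.mem_nhds (mem_ball_zero_iff.2 hgR))
  have hE : ∀ u ∈ closedBall (0 : ℂ) R, DifferentiableAt ℂ (dslope N g) u := by
    intro u hu
    by_cases h : u = g
    · rw [h]; exact (analyticAt_dslope hga).differentiableAt
    · exact (differentiableAt_dslope_of_ne h).2 (hN u hu)
  -- Write `N(u)/(u-g) = N(g)/(u-g) + dslope N g u`. The second term is holomorphic, so its integral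
  -- does not depend on the radius; the first is explicit inside and outside the pole.
  have split : ∀ R', 0 < R' → R' ≤ R → ‖g‖ ≠ R' → (∮ u in C(0, R'), (u ^ (s + 1))⁻¹ * φ u)
      = N g * (∮ u in C(0, R'), (u ^ (s + 1))⁻¹ * (u - g)⁻¹)
        + ∮ u in C(0, R'), (u ^ (s + 1))⁻¹ * dslope N g u := by
    intro R' h1 h2 h3
    have hne : ∀ u ∈ sphere (0 : ℂ) R', u ≠ g := by
      rintro u hu rfl
      exact h3 (mem_sphere_zero_iff_norm.1 hu)
    have hsub : ∀ u ∈ sphere (0 : ℂ) R', u ∈ closedBall (0 : ℂ) R := fun u hu =>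
      closedBall_subset_closedBall h2 (sphere_subset_closedBall hu)
    have c1 : CircleIntegrable (fun u : ℂ => N g * ((u ^ (s + 1))⁻¹ * (u - g)⁻¹)) 0 R' :=
      (continuousOn_const.mul ((continuousOn_inv_pow_sphere h1 _).mul
        ((continuousOn_id.sub continuousOn_const).inv₀
          fun u hu => sub_ne_zero.2 (hne u hu)))).circleIntegrable h1.le
    have c2 : CircleIntegrable (fun u : ℂ => (u ^ (s + 1))⁻¹ * dslope N g u) 0 R' :=
      ((continuousOn_inv_pow_sphere h1 _).mul fun u hu =>
        (hE u (hsub u hu)).continuousAt.continuousWithinAt).circleIntegrable h1.le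
    rw [← circleIntegral.integral_const_mul, ← circleIntegral.integral_add c1 c2]
    refine circleIntegral.integral_congr h1.le fun u hu => ?_
    rw [hφ u (hsub u hu) (hne u hu), dslope_of_ne _ (hne u hu), slope_def_field, div_eq_mul_inv]
    ring
  rw [split ρ hρ (hρg.trans hgR).le hρg.ne', split R hR le_rfl hgR.ne,
    circleIntegral_inv_pow_mul_inv_sub_of_mem hR hg0 hgR,
    circleIntegral_inv_pow_mul_inv_sub_of_lt hρ hg0 hρg,
    circleIntegral_inv_pow_radius hρ (hρg.trans hgR).le hE]
  ring

/-- A circle integral in the angle measured from a given point of the circle. -/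
theorem circleIntegral_eq_integral_angle {z : ℂ} (f : ℂ → ℂ) :
    (∮ ζ in C(0, ‖z‖), f ζ) = ∫ θ in (-Real.pi)..Real.pi,
      Complex.I * (z * Complex.exp (Complex.I * θ)) * f (z * Complex.exp (Complex.I * θ)) := by
  set h : ℝ → ℂ := fun θ => deriv (circleMap 0 ‖z‖) θ • f (circleMap 0 ‖z‖ θ) with hh
  have hper : Function.Periodic h (2 * Real.pi) := by
    intro θ
    simp only [hh, deriv_circleMap]
    rw [periodic_circleMap 0 ‖z‖ θ]
  have hz : ∀ θ : ℝ, z * Complex.exp (Complex.I * θ) = circleMap 0 ‖z‖ (θ + z.arg) := by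
    intro θ
    rw [circleMap, zero_add]
    conv_lhs => rw [← Complex.norm_mul_exp_arg_mul_I z]
    rw [mul_assoc, ← Complex.exp_add]
    congr 2
    push_cast
    ring
  have e1 : ∀ θ : ℝ, Complex.I * (z * Complex.exp (Complex.I * θ)) *
      f (z * Complex.exp (Complex.I * θ)) = h (θ + z.arg) := by
    intro θ
    simp only [hh, deriv_circleMap, hz, smul_eq_mul]
    ring
  simp only [e1]
  rw [intervalIntegral.integral_comp_add_right]
  have e2 := hper.intervalIntegral_add_eq (-Real.pi + z.arg) 0
  rw [zero_add] at e2
  have e3 : -Real.pi + z.arg + 2 * Real.pi = Real.pi + z.arg := by ring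
  rw [e3] at e2
  rw [e2]
  rfl

/-! ### Localization of the Cauchy integral -/

/-- The outer circle is parametrized by the angle from `z`. The errors `E(π-δ)`, `2δE` and `E(π-δ)`
add up to `2πE`, cancelling the prefactor `1/(2π)`. -/
theorem norm_coeff_sub_integral_le {F : ℂ × ℂ → ℂ} {a z : ℂ} {r s : ℕ} {ρ δ E : ℝ} {P : ℝ → ℂ}
    (hz : z ≠ 0) (hρ : 0 < ρ) (hδ : 0 < δ) (hδπ : δ ≤ Real.pi)
    (hcoeff : (∮ ζ in C(0, ‖z‖), (ζ ^ (r + 1))⁻¹ * ∮ u in C(0, ρ), (u ^ (s + 1))⁻¹ * F (ζ, u))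
      = (2 * Real.pi * Complex.I) ^ 2 * a)
    (hF : ∀ ζ ∈ sphere (0 : ℂ) ‖z‖, ∀ u ∈ sphere (0 : ℂ) ρ, ContinuousAt F (ζ, u))
    (hfar : ∀ θ : ℝ, δ ≤ |θ| → |θ| ≤ Real.pi →
      ‖∮ u in C(0, ρ), (u ^ (s + 1))⁻¹ * F (z * Complex.exp (Complex.I * θ), u)‖
        ≤ 2 * Real.pi * E)
    (hnear : ∀ θ : ℝ, |θ| ≤ δ →
      ‖(∮ u in C(0, ρ), (u ^ (s + 1))⁻¹ * F (z * Complex.exp (Complex.I * θ), u))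
        - 2 * Real.pi * Complex.I * P θ‖ ≤ 2 * Real.pi * E)
    (hP : ContinuousOn P (Icc (-δ) δ)) :
    ‖a * z ^ r - 1 / (2 * Real.pi) * ∫ θ in (-δ)..δ, Complex.exp (-(Complex.I * r * θ)) * P θ‖
      ≤ E := by
  have hπ := Real.pi_pos
  have hπ0 : (Real.pi : ℂ) ≠ 0 := by exact_mod_cast hπ.ne'
  set J : ℝ → ℂ := fun θ => (2 * Real.pi * Complex.I)⁻¹ *
    ∮ u in C(0, ρ), (u ^ (s + 1))⁻¹ * F (z * Complex.exp (Complex.I * θ), u) with hJ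
  have hnorm : ∀ θ : ℝ, ‖Complex.exp (Complex.I * θ)‖ = 1 := fun θ => by
    rw [mul_comm, Complex.norm_exp_ofReal_mul_I]
  have hnorm' : ∀ θ : ℝ, ‖Complex.exp (-(Complex.I * r * θ))‖ = 1 := fun θ => by
    have : -(Complex.I * r * θ) = ((-(r * θ) : ℝ) : ℂ) * Complex.I := by push_cast; ring
    rw [this, Complex.norm_exp_ofReal_mul_I]
  have hJc : Continuous J := by
    refine continuous_const.mul ?_
    simp only [circleIntegral, deriv_circleMap]
    refine intervalIntegral.continuous_parametric_intervalIntegral_of_continuous' ?_ _ _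
    have hin : Continuous fun q : ℝ × ℝ =>
        (z * Complex.exp (Complex.I * q.1), circleMap 0 ρ q.2) := by
      refine Continuous.prodMk (by fun_prop) ((continuous_circleMap 0 ρ).comp continuous_snd)
    have hcm : Continuous fun q : ℝ × ℝ => circleMap 0 ρ q.2 :=
      (continuous_circleMap 0 ρ).comp continuous_snd
    have h1 : Continuous fun q : ℝ × ℝ => F (z * Complex.exp (Complex.I * q.1), circleMap 0 ρ q.2) := by
      refine continuous_iff_continuousAt.2 fun q => ?_
      refine ContinuousAt.comp (g := F) (hF _ ?_ _ (circleMap_mem_sphere 0 hρ.le _)) hin.continuousAt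
      rw [mem_sphere_zero_iff_norm, norm_mul, hnorm, mul_one]
    have h2 : Continuous fun q : ℝ × ℝ => ((circleMap 0 ρ q.2) ^ (s + 1))⁻¹ :=
      (hcm.pow _).inv₀ fun q => pow_ne_zero _ (circleMap_ne_center hρ.ne')
    exact (hcm.mul continuous_const).smul (h2.mul h1)
  set D : ℝ → ℂ := fun θ => Complex.exp (-(Complex.I * r * θ)) * J θ with hD
  have hDc : Continuous D := (by fun_prop : Continuous fun θ : ℝ =>
    Complex.exp (-(Complex.I * r * θ))).mul hJc
  have hmain : a * z ^ r = 1 / (2 * Real.pi) * ∫ θ in (-Real.pi)..Real.pi, D θ := by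
    rw [circleIntegral_eq_integral_angle] at hcoeff
    have e : ∀ θ : ℝ, D θ = (2 * Real.pi * Complex.I)⁻¹ * Complex.I⁻¹ * z ^ r *
        (Complex.I * (z * Complex.exp (Complex.I * θ)) *
        (((z * Complex.exp (Complex.I * θ)) ^ (r + 1))⁻¹ *
          ∮ u in C(0, ρ), (u ^ (s + 1))⁻¹ * F (z * Complex.exp (Complex.I * θ), u))) := by
      intro θ
      have h1 : Complex.exp (-(Complex.I * r * θ)) = (Complex.exp (Complex.I * θ) ^ r)⁻¹ := by
        rw [← Complex.exp_nat_mul, ← Complex.exp_neg]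
        congr 1
        ring
      have h2 : Complex.exp (Complex.I * θ) ≠ 0 := Complex.exp_ne_zero _
      simp only [hD, hJ, h1]
      have h3 := Complex.I_ne_zero
      field_simp
      ring
    simp only [e]
    rw [intervalIntegral.integral_const_mul, hcoeff]
    have h3 := Complex.I_ne_zero
    field_simp
  have hsplit : (∫ θ in (-Real.pi)..Real.pi, D θ) = (∫ θ in (-Real.pi)..(-δ), D θ)
      + (∫ θ in (-δ)..δ, D θ) + ∫ θ in δ..Real.pi, D θ := by
    rw [intervalIntegral.integral_add_adjacent_intervals (hDc.intervalIntegrable _ _)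
      (hDc.intervalIntegrable _ _), intervalIntegral.integral_add_adjacent_intervals
      (hDc.intervalIntegrable _ _) (hDc.intervalIntegrable _ _)]
  have hinv : ‖(2 * Real.pi * Complex.I : ℂ)⁻¹‖ = (2 * Real.pi)⁻¹ := by
    rw [norm_inv, norm_mul, norm_mul, Complex.norm_I, mul_one, Complex.norm_real,
      Complex.norm_ofNat, Real.norm_eq_abs, abs_of_pos hπ]
  have hDfar : ∀ θ : ℝ, δ ≤ |θ| → |θ| ≤ Real.pi → ‖D θ‖ ≤ E := by
    intro θ h1 h2
    simp only [hD, hJ]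
    rw [norm_mul, hnorm', one_mul, norm_mul, hinv]
    calc _ ≤ (2 * Real.pi)⁻¹ * (2 * Real.pi * E) := by gcongr; exact hfar θ h1 h2
      _ = E := by field_simp
  have hDnear : ∀ θ : ℝ, |θ| ≤ δ → ‖D θ - Complex.exp (-(Complex.I * r * θ)) * P θ‖ ≤ E := by
    intro θ h1
    have h2 : D θ - Complex.exp (-(Complex.I * r * θ)) * P θ
        = Complex.exp (-(Complex.I * r * θ)) * ((2 * Real.pi * Complex.I)⁻¹ *
          ((∮ u in C(0, ρ), (u ^ (s + 1))⁻¹ * F (z * Complex.exp (Complex.I * θ), u))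
            - 2 * Real.pi * Complex.I * P θ)) := by
      simp only [hD, hJ]
      have h3 := Complex.I_ne_zero
      field_simp
    rw [h2, norm_mul, hnorm', one_mul, norm_mul, hinv]
    calc _ ≤ (2 * Real.pi)⁻¹ * (2 * Real.pi * E) := by gcongr; exact hnear θ h1
      _ = E := by field_simp
  have i1 : ‖∫ θ in (-Real.pi)..(-δ), D θ‖ ≤ E * (Real.pi - δ) := by
    have := intervalIntegral.norm_integral_le_of_norm_le_const (a := -Real.pi) (b := -δ) (f := D)
      (C := E) (fun θ hθ => ?_)
    · rwa [abs_of_nonneg (by linarith), neg_sub_neg] at this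
    · rw [uIoc_of_le (by linarith)] at hθ
      have h0 : |θ| = -θ := abs_of_nonpos (by linarith [hθ.2])
      exact hDfar θ (by linarith [hθ.2]) (by linarith [hθ.1])
  have i3 : ‖∫ θ in δ..Real.pi, D θ‖ ≤ E * (Real.pi - δ) := by
    have := intervalIntegral.norm_integral_le_of_norm_le_const (a := δ) (b := Real.pi) (f := D)
      (C := E) (fun θ hθ => ?_)
    · rwa [abs_of_nonneg (by linarith)] at this
    · rw [uIoc_of_le hδπ] at hθ
      have h0 : |θ| = θ := abs_of_nonneg (by linarith [hθ.1])
      exact hDfar θ (by linarith [hθ.1]) (by linarith [hθ.2])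
  have i2 : ‖(∫ θ in (-δ)..δ, D θ) - ∫ θ in (-δ)..δ, Complex.exp (-(Complex.I * r * θ)) * P θ‖
      ≤ E * (2 * δ) := by
    rw [← intervalIntegral.integral_sub (hDc.intervalIntegrable _ _)]
    · have := intervalIntegral.norm_integral_le_of_norm_le_const (a := -δ) (b := δ)
        (f := fun θ => D θ - Complex.exp (-(Complex.I * r * θ)) * P θ) (C := E) (fun θ hθ => ?_)
      · rwa [abs_of_nonneg (by linarith), sub_neg_eq_add, ← two_mul] at this
      · rw [uIoc_of_le (by linarith)] at hθ
        exact hDnear θ (abs_le.2 ⟨hθ.1.le, hθ.2⟩)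
    · refine ContinuousOn.intervalIntegrable ?_
      rw [uIcc_of_le (by linarith)]
      exact (by fun_prop : Continuous fun θ : ℝ =>
        Complex.exp (-(Complex.I * r * θ))).continuousOn.mul hP
  rw [hmain, hsplit, ← mul_sub, norm_mul]
  have hn : ‖(1 / (2 * Real.pi) : ℂ)‖ = 1 / (2 * Real.pi) := by
    rw [norm_div, norm_one, norm_mul, Complex.norm_real, Complex.norm_ofNat, Real.norm_eq_abs,
      abs_of_pos hπ]
  rw [hn]
  set I₁ := ∫ θ in (-Real.pi)..(-δ), D θ
  set I₂ := ∫ θ in (-δ)..δ, D θ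
  set I₃ := ∫ θ in δ..Real.pi, D θ
  set I₄ := ∫ θ in (-δ)..δ, Complex.exp (-(Complex.I * r * θ)) * P θ
  have htot : ‖I₁ + I₂ + I₃ - I₄‖ ≤ 2 * Real.pi * E := by
    calc ‖I₁ + I₂ + I₃ - I₄‖ = ‖I₁ + (I₂ - I₄) + I₃‖ := by congr 1; ring
      _ ≤ ‖I₁‖ + ‖I₂ - I₄‖ + ‖I₃‖ := norm_add₃_le
      _ ≤ E * (Real.pi - δ) + E * (2 * δ) + E * (Real.pi - δ) := by gcongr
      _ = _ := by ring
  calc _ ≤ 1 / (2 * Real.pi) * (2 * Real.pi * E) := by gcongr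
    _ = E := by field_simp

/-! ### Bounds on the fibres `z' = const` -/

theorem exp_I_mul_ne_one {θ : ℝ} (h0 : θ ≠ 0) (h1 : |θ| ≤ Real.pi) :
    Complex.exp (Complex.I * θ) ≠ 1 := by
  intro h
  obtain ⟨n, hn⟩ := Complex.exp_eq_one_iff.1 h
  have h2 : (θ : ℂ) = ((n * (2 * Real.pi) : ℝ) : ℂ) := by
    have : Complex.I * (θ : ℂ) = Complex.I * ((n * (2 * Real.pi) : ℝ) : ℂ) := by
      rw [hn]; push_cast; ring
    exact mul_left_cancel₀ Complex.I_ne_zero this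
  have h3 : θ = n * (2 * Real.pi) := Complex.ofReal_injective h2
  have hn0 : n ≠ 0 := by
    rintro rfl
    simp at h3
    exact h0 h3
  have h4 : (1 : ℝ) ≤ |(n : ℝ)| := by exact_mod_cast Int.one_le_abs hn0
  rw [h3, abs_mul, abs_of_pos (by positivity : 0 < 2 * Real.pi)] at h1
  nlinarith [Real.pi_pos]

theorem zeroSet_inter_polydisk {H : ℂ × ℂ → ℂ} {p : ℂ × ℂ} (h : IsStrictlyMinimal H p) :
    zeroSet H ∩ polydisk p = {p} := by
  obtain ⟨x, hx⟩ := Set.encard_eq_one.1 h.2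
  have : p ∈ zeroSet H ∩ polydisk p := ⟨h.1.1, le_rfl, le_rfl⟩
  rw [hx, mem_singleton_iff] at this
  rw [hx, this]

/-- Compactness turns a condition on the closed disk of radius `b` into one on a strictly larger
disk, uniformly in nearby `ζ`. The gap `R > b` is the source of the exponential gain. -/
theorem exists_tube {A : Set ℂ} (hA : IsCompact A) {b : ℝ} (hb : 0 ≤ b) {S : Set (ℂ × ℂ)}
    (hS : ∀ ζ ∈ A, ∀ u ∈ closedBall (0 : ℂ) b, S ∈ 𝓝 (ζ, u)) :
    ∃ U, IsOpen U ∧ A ⊆ U ∧ ∃ R > b, ∀ ζ ∈ U, ∀ u ∈ closedBall (0 : ℂ) R, (ζ, u) ∈ S := by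
  obtain ⟨U, V, hU, hV, hAU, hbV, hUV⟩ := generalized_tube_lemma hA
    (isCompact_closedBall (0 : ℂ) b) (isOpen_interior (s := S))
    (fun q hq => mem_interior_iff_mem_nhds.2 (hS q.1 hq.1 q.2 hq.2))
  obtain ⟨ε, hε, hεV⟩ := (isCompact_closedBall (0 : ℂ) b).exists_cthickening_subset_open hV hbV
  rw [cthickening_closedBall hε.le hb] at hεV
  exact ⟨U, hU, hAU, ε + b, by linarith, fun ζ hζ u hu => interior_subset (hUV ⟨hζ, hεV hu⟩)⟩

/-- `- G / (w H_w)` on the curve `w = g(ζ)`. -/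
def poleWeight (G H : ℂ × ℂ → ℂ) (g : ℂ → ℂ) (ζ : ℂ) : ℂ :=
  -(G (ζ, g ζ) / (fderiv ℂ H (ζ, g ζ) (0, 1) * g ζ))

theorem hasDerivAt_snd {H : ℂ × ℂ → ℂ} {ζ u : ℂ} (hH : DifferentiableAt ℂ H (ζ, u)) :
    HasDerivAt (fun v => H (ζ, v)) (fderiv ℂ H (ζ, u) (0, 1)) u := by
  have h2 : HasDerivAt (fun v : ℂ => (ζ, v)) ((0 : ℂ), (1 : ℂ)) u :=
    (hasDerivAt_const _ _).prodMk (hasDerivAt_id _)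
  exact hH.hasFDerivAt.comp_hasDerivAt u h2

theorem hasDerivAt_fst {H : ℂ × ℂ → ℂ} {ζ u : ℂ} (hH : DifferentiableAt ℂ H (ζ, u)) :
    HasDerivAt (fun v => H (v, u)) (fderiv ℂ H (ζ, u) (1, 0)) ζ := by
  have h2 : HasDerivAt (fun v : ℂ => (v, u)) ((1 : ℂ), (0 : ℂ)) ζ :=
    (hasDerivAt_id _).prodMk (hasDerivAt_const _ _)
  exact HasFDerivAt.comp_hasDerivAt (f := fun v : ℂ => (v, u)) ζ hH.hasFDerivAt h2

/-- Coefficient extraction in `w` on a fibre with a single simple pole in the disk of radius `R`. -/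
theorem norm_fibre_coeff_sub_le {G H : ℂ × ℂ → ℂ} {g : ℂ → ℂ} {ζ : ℂ} {ρ R M : ℝ}
    (han : ∀ u ∈ closedBall (0 : ℂ) R, AnalyticAt ℂ G (ζ, u) ∧ AnalyticAt ℂ H (ζ, u) ∧
      (H (ζ, u) = 0 → u = g ζ))
    (h0 : H (ζ, g ζ) = 0) (hd : fderiv ℂ H (ζ, g ζ) (0, 1) ≠ 0) (hρ : 0 < ρ) (hρg : ρ < ‖g ζ‖)
    (hgR : ‖g ζ‖ < R) (hM : ∀ u ∈ sphere (0 : ℂ) R, ‖G (ζ, u) / H (ζ, u)‖ ≤ M) (s : ℕ) :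
    ‖(∮ u in C(0, ρ), (u ^ (s + 1))⁻¹ * (G (ζ, u) / H (ζ, u)))
      - 2 * Real.pi * Complex.I * (poleWeight G H g ζ * (g ζ ^ s)⁻¹)‖
        ≤ 2 * Real.pi * (M * (R ^ s)⁻¹) := by
  have hgm : g ζ ∈ closedBall (0 : ℂ) R := mem_closedBall_zero_iff.2 hgR.le
  have hg0 : g ζ ≠ 0 := norm_pos_iff.1 (hρ.trans hρg)
  have hderiv := hasDerivAt_snd (han _ hgm).2.1.differentiableAt
  set K : ℂ → ℂ := dslope (fun v => H (ζ, v)) (g ζ) with hK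
  have hin : ∀ u, AnalyticAt ℂ (fun v : ℂ => (ζ, v)) u := fun u =>
    analyticAt_const.prod analyticAt_id
  have hKd : ∀ u ∈ closedBall (0 : ℂ) R, DifferentiableAt ℂ K u := by
    intro u hu
    have hHa : AnalyticAt ℂ (fun v => H (ζ, v)) u :=
      AnalyticAt.fun_comp (f := fun v : ℂ => (ζ, v)) (han u hu).2.1 (hin u)
    by_cases h : u = g ζ
    · rw [h] at hHa ⊢
      exact (analyticAt_dslope hHa).differentiableAt
    · exact (differentiableAt_dslope_of_ne h).2 hHa.differentiableAt
  have hKg : K (g ζ) = fderiv ℂ H (ζ, g ζ) (0, 1) := by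
    rw [hK, dslope_same, hderiv.deriv]
  have hKu : ∀ u, H (ζ, u) = (u - g ζ) * K u := by
    intro u
    have := sub_smul_dslope (fun v => H (ζ, v)) (g ζ) u
    simp only [smul_eq_mul, h0, sub_zero] at this
    exact this.symm
  -- Away from `g ζ` there are no zeros of `H` on the fibre, and at `g ζ` the quotient equals `H_w ≠
  -- 0`; hence `G/K` is a holomorphic numerator.
  have hKne : ∀ u ∈ closedBall (0 : ℂ) R, K u ≠ 0 := by
    intro u hu hk
    have h1 : H (ζ, u) = 0 := by rw [hKu, hk, mul_zero]
    have h2 := (han u hu).2.2 h1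
    rw [h2, hKg] at hk
    exact hd hk
  have key := circleIntegral_inv_pow_simple_pole (φ := fun u => G (ζ, u) / H (ζ, u))
    (N := fun u => G (ζ, u) / K u) hρ hρg hgR
    (fun u hu => by
      have hGa : DifferentiableAt ℂ (fun v => G (ζ, v)) u :=
        (hasDerivAt_snd (han u hu).1.differentiableAt).differentiableAt
      exact hGa.div (hKd u hu) (hKne u hu))
    (fun u hu hne => by
      have h1 : u - g ζ ≠ 0 := sub_ne_zero.2 hne
      have h2 := hKne u hu
      rw [hKu]
      field_simp) s
  have hb := norm_circleIntegral_inv_pow_le (φ := fun u => G (ζ, u) / H (ζ, u))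
    ((norm_nonneg _).trans_lt hgR) hM s
  have he : (∮ u in C(0, ρ), (u ^ (s + 1))⁻¹ * (G (ζ, u) / H (ζ, u)))
      - 2 * Real.pi * Complex.I * (poleWeight G H g ζ * (g ζ ^ s)⁻¹)
      = ∮ u in C(0, R), (u ^ (s + 1))⁻¹ * (G (ζ, u) / H (ζ, u)) := by
    rw [key]
    simp only [hKg, poleWeight]
    field_simp
    ring
  rw [he]
  exact hb

/-- By strict minimality the only zero of `H` on the fibre over `p₀.1` in the closed disk of radius
`|p₀.2|` is `p₀.2`, and near it the zeros lie on the graph of `g`. A tube argument keeps `g ζ` the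
only possible zero on nearby fibres in a larger disk. -/
theorem exists_near_bound {G H : ℂ × ℂ → ℂ} {p₀ : ℂ × ℂ} {g : ℂ → ℂ}
    (hG : AnalyticOnNhd ℂ G (polydisk p₀)) (hH : AnalyticOnNhd ℂ H (polydisk p₀))
    (hmin : IsStrictlyMinimal H p₀) (hg : IsZeroParam H p₀ g) (hw : p₀.2 ≠ 0)
    (hd : fderiv ℂ H p₀ (0, 1) ≠ 0) :
    ∃ R > ‖p₀.2‖, ∃ M : ℝ, ∀ᶠ ζ in 𝓝 p₀.1, AnalyticAt ℂ g ζ ∧ AnalyticAt ℂ (poleWeight G H g) ζ ∧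
      g ζ ≠ 0 ∧ ∀ (s : ℕ) (ρ : ℝ), 0 < ρ → ρ ≤ ‖p₀.2‖ / 2 →
        ‖(∮ u in C(0, ρ), (u ^ (s + 1))⁻¹ * (G (ζ, u) / H (ζ, u)))
          - 2 * Real.pi * Complex.I * (poleWeight G H g ζ * (g ζ ^ s)⁻¹)‖
            ≤ 2 * Real.pi * (M * (R ^ s)⁻¹) := by
  obtain ⟨hga, hg0, hgz⟩ := hg
  have hwn : 0 < ‖p₀.2‖ := norm_pos_iff.2 hw
  have hp₀ : p₀ ∈ polydisk p₀ := ⟨le_rfl, le_rfl⟩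
  have hx := zeroSet_inter_polydisk hmin
  set S : Set (ℂ × ℂ) := {q | AnalyticAt ℂ G q ∧ AnalyticAt ℂ H q ∧ (H q = 0 → q.2 = g q.1)}
    with hS
  obtain ⟨U, hU, hAU, R, hR, hUR⟩ := exists_tube (isCompact_singleton (x := p₀.1)) (norm_nonneg p₀.2)
    (S := S) (fun ζ hζ u hu => by
      rw [mem_singleton_iff.1 hζ]
      have hm : (p₀.1, u) ∈ polydisk p₀ := ⟨le_rfl, mem_closedBall_zero_iff.1 hu⟩
      have h3 : ∀ᶠ q in 𝓝 (p₀.1, u), (H q = 0 → q.2 = g q.1) := by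
        by_cases h : H (p₀.1, u) = 0
        · have : (p₀.1, u) ∈ zeroSet H ∩ polydisk p₀ := ⟨h, hm⟩
          rw [hx, mem_singleton_iff] at this
          rw [this]
          exact hgz.mono fun q hq => hq.1
        · filter_upwards [(hH _ hm).continuousAt.eventually_ne h] with q hq h' using absurd h' hq
      filter_upwards [(hG _ hm).eventually_analyticAt, (hH _ hm).eventually_analyticAt, h3]
        with q h1 h2 h3 using ⟨h1, h2, h3⟩)
  have hz₀U : p₀.1 ∈ U := hAU rfl
  have hR0 : 0 < R := (norm_nonneg _).trans_lt hR
  -- a bound on the outer circle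
  have hcF : ∀ u ∈ sphere (0 : ℂ) R,
      ContinuousAt (fun q : ℂ × ℂ => G q / H q) (p₀.1, u) := by
    intro u hu
    obtain ⟨h1, h2, h3⟩ := hUR _ hz₀U u (sphere_subset_closedBall hu)
    refine h1.continuousAt.div h2.continuousAt fun h => ?_
    have h4 : u = g p₀.1 := h3 h
    rw [hg0] at h4
    rw [h4, mem_sphere_zero_iff_norm] at hu
    exact hR.ne hu
  obtain ⟨M, hM⟩ := (isCompact_sphere (0 : ℂ) R).exists_bound_of_continuousOn
    (f := fun u => G (p₀.1, u) / H (p₀.1, u)) (fun u hu =>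
      ((hcF u hu).comp (f := fun v : ℂ => (p₀.1, v)) (by fun_prop)).continuousWithinAt)
  have hbd : ∀ᶠ ζ in 𝓝 p₀.1, ∀ u ∈ sphere (0 : ℂ) R, ‖G (ζ, u) / H (ζ, u)‖ < M + 1 := by
    refine (isCompact_sphere (0 : ℂ) R).eventually_forall_of_forall_eventually fun u hu => ?_
    exact (hcF u hu).norm.eventually_lt_const ((hM u hu).trans_lt (lt_add_one M))
  have hcurve : Tendsto (fun ζ => (ζ, g ζ)) (𝓝 p₀.1) (𝓝 p₀) := by
    have : ContinuousAt (fun ζ => (ζ, g ζ)) p₀.1 := continuousAt_id.prodMk hga.continuousAt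
    have h := this.tendsto
    rwa [hg0] at h
  have hHa := hH p₀ hp₀
  have hfd : AnalyticAt ℂ (fun q => fderiv ℂ H q (0, 1)) p₀ :=
    ((ContinuousLinearMap.apply ℂ ℂ ((0 : ℂ), (1 : ℂ))).analyticAt _).comp hHa.fderiv
  have hcv : ∀ {ζ}, AnalyticAt ℂ g ζ → AnalyticAt ℂ (fun ζ => (ζ, g ζ)) ζ := fun h =>
    analyticAt_id.prod h
  refine ⟨R, hR, M + 1, ?_⟩
  filter_upwards [hga.eventually_analyticAt, hcurve.eventually hfd.eventually_analyticAt,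
    hcurve.eventually (hfd.continuousAt.eventually_ne hd),
    hcurve.eventually (hG p₀ hp₀).eventually_analyticAt, hcurve.eventually hgz, hbd,
    hU.mem_nhds hz₀U, hga.continuousAt.norm.eventually_lt_const (hg0 ▸ hR),
    hga.continuousAt.norm.eventually_const_lt
      (show ‖p₀.2‖ / 2 < ‖g p₀.1‖ by rw [hg0]; exact half_lt_self hwn)]
    with ζ h1 h2 h3 h4 h5 h6 h7 h8 h9
  have hgne : g ζ ≠ 0 := norm_pos_iff.1 ((by positivity : 0 < ‖p₀.2‖ / 2).trans h9)
  refine ⟨h1, ?_, hgne, fun s ρ hρ hρ' => ?_⟩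
  · have a1 : AnalyticAt ℂ (fun ζ => G (ζ, g ζ)) ζ :=
      AnalyticAt.fun_comp (f := fun ζ => (ζ, g ζ)) h4 (hcv h1)
    have a2 : AnalyticAt ℂ (fun ζ => fderiv ℂ H (ζ, g ζ) (0, 1)) ζ :=
      AnalyticAt.fun_comp (g := fun q => fderiv ℂ H q (0, 1)) (f := fun ζ => (ζ, g ζ)) h2 (hcv h1)
    exact (a1.div (a2.mul h1) (mul_ne_zero h3 hgne)).neg
  · exact norm_fibre_coeff_sub_le (fun u hu => hUR ζ h7 u hu) (h5.2 rfl) h3 hρ (hρ'.trans_lt h9) h8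
      (fun u hu => (h6 u hu).le) s

/-- Over the compact arc `δ ≤ |θ| ≤ π` strict minimality leaves no zero of `H` in the closed disk,
hence none in a slightly larger one, also for `z` near `p₀.1`; the circle is enlarged without a
residue. -/
theorem exists_far_bound {G H : ℂ × ℂ → ℂ} {p₀ : ℂ × ℂ}
    (hG : AnalyticOnNhd ℂ G (polydisk p₀)) (hH : AnalyticOnNhd ℂ H (polydisk p₀))
    (hmin : IsStrictlyMinimal H p₀) (hz : p₀.1 ≠ 0) {δ : ℝ} (hδ : 0 < δ) :
    ∃ R > ‖p₀.2‖, ∃ M : ℝ, ∀ᶠ z in 𝓝 p₀.1, ∀ θ : ℝ, δ ≤ |θ| → |θ| ≤ Real.pi →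
      ∀ (s : ℕ) (ρ : ℝ), 0 < ρ → ρ ≤ ‖p₀.2‖ →
        ‖∮ u in C(0, ρ), (u ^ (s + 1))⁻¹ * (G (z * Complex.exp (Complex.I * θ), u)
          / H (z * Complex.exp (Complex.I * θ), u))‖ ≤ 2 * Real.pi * (M * (R ^ s)⁻¹) := by
  have hx := zeroSet_inter_polydisk hmin
  set Θ : Set ℝ := {θ | δ ≤ |θ|} ∩ Icc (-Real.pi) Real.pi with hΘ
  have hΘc : IsCompact Θ :=
    isCompact_Icc.inter_left (isClosed_le continuous_const continuous_abs)
  have hΘm : ∀ θ : ℝ, δ ≤ |θ| → |θ| ≤ Real.pi → θ ∈ Θ := fun θ h1 h2 => ⟨h1, abs_le.1 h2⟩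
  set A : Set ℂ := (fun θ : ℝ => p₀.1 * Complex.exp (Complex.I * θ)) '' Θ with hA
  have hAc : IsCompact A := hΘc.image (by fun_prop)
  have hne1 : ∀ θ ∈ Θ, p₀.1 * Complex.exp (Complex.I * θ) ≠ p₀.1 := by
    intro θ hθ h
    have h1 : Complex.exp (Complex.I * θ) = 1 := by
      have := mul_left_cancel₀ hz (h.trans (mul_one p₀.1).symm)
      exact this
    have hθ0 : θ ≠ 0 := by
      rintro rfl
      have := hθ.1
      simp only [mem_ofPred_eq, abs_zero] at this
      linarith
    exact exp_I_mul_ne_one hθ0 (abs_le.2 hθ.2) h1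
  have hpt : ∀ ζ ∈ A, ∀ u ∈ closedBall (0 : ℂ) ‖p₀.2‖,
      AnalyticAt ℂ G (ζ, u) ∧ AnalyticAt ℂ H (ζ, u) ∧ H (ζ, u) ≠ 0 := by
    rintro ζ ⟨θ, hθ, rfl⟩ u hu
    have hm : (p₀.1 * Complex.exp (Complex.I * θ), u) ∈ polydisk p₀ := by
      refine ⟨?_, mem_closedBall_zero_iff.1 hu⟩
      simp only
      rw [norm_mul, mul_comm Complex.I, Complex.norm_exp_ofReal_mul_I, mul_one]
    refine ⟨hG _ hm, hH _ hm, fun h => ?_⟩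
    have : (p₀.1 * Complex.exp (Complex.I * θ), u) ∈ zeroSet H ∩ polydisk p₀ := ⟨h, hm⟩
    rw [hx, mem_singleton_iff] at this
    exact hne1 θ hθ (congrArg Prod.fst this)
  have hcF : ∀ q ∈ A ×ˢ closedBall (0 : ℂ) ‖p₀.2‖, ContinuousAt (fun q => G q / H q) q := by
    intro q hq
    obtain ⟨h1, h2, h3⟩ := hpt q.1 hq.1 q.2 hq.2
    exact h1.continuousAt.div h2.continuousAt h3
  obtain ⟨M, hM⟩ := (hAc.prod (isCompact_closedBall (0 : ℂ) ‖p₀.2‖)).exists_bound_of_continuousOn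
    (f := fun q : ℂ × ℂ => G q / H q) (fun q hq => (hcF q hq).continuousWithinAt)
  set S : Set (ℂ × ℂ) := {q | AnalyticAt ℂ G q ∧ AnalyticAt ℂ H q ∧ H q ≠ 0 ∧
    ‖G q / H q‖ < M + 1} with hS
  obtain ⟨U, hU, hAU, R, hR, hUR⟩ := exists_tube hAc (norm_nonneg p₀.2) (S := S)
    (fun ζ hζ u hu => by
      obtain ⟨h1, h2, h3⟩ := hpt ζ hζ u hu
      filter_upwards [h1.eventually_analyticAt, h2.eventually_analyticAt,
        h2.continuousAt.eventually_ne h3, (hcF (ζ, u) ⟨hζ, hu⟩).norm.eventually_lt_const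
          ((hM (ζ, u) ⟨hζ, hu⟩).trans_lt (lt_add_one M))] with q a b c d using ⟨a, b, c, d⟩)
  refine ⟨R, hR, M + 1, ?_⟩
  have hev : ∀ᶠ z in 𝓝 p₀.1, ∀ θ ∈ Θ, z * Complex.exp (Complex.I * θ) ∈ U := by
    refine hΘc.eventually_forall_of_forall_eventually fun θ hθ => ?_
    have hc : Continuous fun q : ℂ × ℝ => q.1 * Complex.exp (Complex.I * q.2) := by fun_prop
    exact hc.continuousAt.eventually (hU.mem_nhds (hAU ⟨θ, hθ, rfl⟩))
  filter_upwards [hev] with z hzU θ h1 h2 s ρ hρ hρ'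
  have hζ := hzU θ (hΘm θ h1 h2)
  have hR0 : 0 < R := (norm_nonneg _).trans_lt hR
  rw [circleIntegral_inv_pow_radius (φ := fun u => G (z * Complex.exp (Complex.I * θ), u)
          / H (z * Complex.exp (Complex.I * θ), u)) hρ (hρ'.trans hR.le) (fun u hu => ?_)]
  · exact norm_circleIntegral_inv_pow_le hR0
      (fun u hu => (hUR _ hζ u (sphere_subset_closedBall hu)).2.2.2.le) s
  · obtain ⟨a, b, c, -⟩ := hUR _ hζ u hu
    exact (hasDerivAt_snd a.differentiableAt).differentiableAt.div
      (hasDerivAt_snd b.differentiableAt).differentiableAt c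

/-! ### Germs of the parametrization, the weight and the phase -/

theorem IsZeroParam.tendsto_curve {H : ℂ × ℂ → ℂ} {p : ℂ × ℂ} {g : ℂ → ℂ}
    (h : IsZeroParam H p g) : Tendsto (fun ζ => (ζ, g ζ)) (𝓝 p.1) (𝓝 p) := by
  have h1 : ContinuousAt (fun ζ => (ζ, g ζ)) p.1 := continuousAt_id.prodMk h.1.continuousAt
  have h2 := h1.tendsto
  rwa [h.2.1] at h2

theorem IsZeroParam.eventuallyEq {H : ℂ × ℂ → ℂ} {p : ℂ × ℂ} {g₁ g₂ : ℂ → ℂ}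
    (h₁ : IsZeroParam H p g₁) (h₂ : IsZeroParam H p g₂) : g₁ =ᶠ[𝓝 p.1] g₂ := by
  filter_upwards [h₁.tendsto_curve.eventually h₁.2.2, h₁.tendsto_curve.eventually h₂.2.2]
    with ζ h3 h4 using h4.1 (h3.2 rfl)

/-- One `g` serves every zero near `p₀`, so the quantities attached to different poles become values
of a single analytic family. -/
theorem IsZeroParam.eventually {H : ℂ × ℂ → ℂ} {p₀ : ℂ × ℂ} {g : ℂ → ℂ}
    (h : IsZeroParam H p₀ g) : ∀ᶠ p in 𝓝 p₀, H p = 0 → IsZeroParam H p g := by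
  filter_upwards [continuousAt_fst.eventually h.1.eventually_analyticAt, h.2.2,
    h.2.2.eventually_nhds] with p h1 h2 h3 h4 using ⟨h1, (h2.1 h4).symm, h3⟩

theorem partialW_eq {H : ℂ × ℂ → ℂ} {p : ℂ × ℂ} (h : AnalyticAt ℂ H p) :
    partialW H p = fderiv ℂ H p (0, 1) :=
  (hasDerivAt_snd (ζ := p.1) (u := p.2) h.differentiableAt).deriv

theorem partialZ_eq {H : ℂ × ℂ → ℂ} {p : ℂ × ℂ} (h : AnalyticAt ℂ H p) :
    partialZ H p = fderiv ℂ H p (1, 0) :=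
  (hasDerivAt_fst (ζ := p.1) (u := p.2) h.differentiableAt).deriv

theorem analyticAt_fderiv_apply {H : ℂ × ℂ → ℂ} {p : ℂ × ℂ} (h : AnalyticAt ℂ H p) (v : ℂ × ℂ) :
    AnalyticAt ℂ (fun q => fderiv ℂ H q v) p :=
  ((ContinuousLinearMap.apply ℂ ℂ v).analyticAt _).comp h.fderiv

theorem neg_limUnder_eq {G H : ℂ × ℂ → ℂ} {ζ v : ℂ} (hG : ContinuousAt G (ζ, v))
    (hH : DifferentiableAt ℂ H (ζ, v)) (h0 : H (ζ, v) = 0) (hd : fderiv ℂ H (ζ, v) (0, 1) ≠ 0)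
    (hv : v ≠ 0) :
    -limUnder (𝓝[≠] v) (fun u => (u - v) * ((G (ζ, u) / H (ζ, u)) / u))
      = -(G (ζ, v) / (fderiv ℂ H (ζ, v) (0, 1) * v)) := by
  congr 1
  refine Tendsto.limUnder_eq ?_
  have h1 := hasDerivAt_iff_tendsto_slope.1 (hasDerivAt_snd hH)
  have h2 : Tendsto (fun u => G (ζ, u)) (𝓝[≠] v) (𝓝 (G (ζ, v))) :=
    (ContinuousAt.comp (f := fun u : ℂ => (ζ, u)) hG (by fun_prop)).tendsto.mono_left
      nhdsWithin_le_nhds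
  have h3 : Tendsto (fun u : ℂ => u) (𝓝[≠] v) (𝓝 v) := tendsto_id.mono_left nhdsWithin_le_nhds
  refine (h2.div (h1.mul h3) (mul_ne_zero hd hv)).congr' ?_
  filter_upwards [self_mem_nhdsWithin] with u hu
  have hu' : u - v ≠ 0 := sub_ne_zero.2 hu
  simp only [Pi.div_apply]
  rw [slope_def_field, h0, sub_zero]
  field_simp

theorem psi_eventuallyEq {G H : ℂ × ℂ → ℂ} {p : ℂ × ℂ} {g : ℂ → ℂ} (hG : AnalyticAt ℂ G p)
    (hH : AnalyticAt ℂ H p) (hg : IsZeroParam H p g) (hw : p.2 ≠ 0)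
    (hd : fderiv ℂ H p (0, 1) ≠ 0) : psi G H p =ᶠ[𝓝 p.1] poleWeight G H g := by
  have h0 : H p = 0 := hg.2.2.self_of_nhds.2 hg.2.1.symm
  have hz := zeroParam_spec hH h0 (by rwa [partialW_eq hH])
  filter_upwards [hz.eventuallyEq hg, hg.tendsto_curve.eventually hG.eventually_analyticAt,
    hg.tendsto_curve.eventually hH.eventually_analyticAt, hg.tendsto_curve.eventually hg.2.2,
    hg.tendsto_curve.eventually
      ((analyticAt_fderiv_apply hH (0, 1)).continuousAt.eventually_ne hd),
    hg.1.continuousAt.eventually_ne (show g p.1 ≠ 0 by rwa [hg.2.1])] with ζ h1 h2 h3 h4 h5 h6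
  rw [psi, poleWeight, h1]
  exact neg_limUnder_eq h2.continuousAt h3.differentiableAt (h4.2 rfl) h5 h6

/-- The slope of `dir(p)`, as an analytic function of `p`. -/
def slopeFn (H : ℂ × ℂ → ℂ) (p : ℂ × ℂ) : ℂ :=
  p.1 * fderiv ℂ H p (1, 0) / (p.2 * fderiv ℂ H p (0, 1))

theorem dirSlope_eq {H : ℂ × ℂ → ℂ} {p : ℂ × ℂ} (h : AnalyticAt ℂ H p) :
    dirSlope H p = slopeFn H p := by
  rw [dirSlope, slopeFn, partialZ_eq h, partialW_eq h]

theorem analyticAt_slopeFn {H : ℂ × ℂ → ℂ} {p : ℂ × ℂ} (h : AnalyticAt ℂ H p) (hw : p.2 ≠ 0)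
    (hd : fderiv ℂ H p (0, 1) ≠ 0) : AnalyticAt ℂ (slopeFn H) p :=
  (analyticAt_fst.mul (analyticAt_fderiv_apply h _)).div
    (analyticAt_snd.mul (analyticAt_fderiv_apply h _)) (mul_ne_zero hw hd)

/-- The phase `f̃`, as a function of the point and the angle, in terms of a parametrization `g`. -/
def localPhase (H : ℂ × ℂ → ℂ) (g : ℂ → ℂ) (q : (ℂ × ℂ) × ℂ) : ℂ :=
  Complex.log (g (angleMap q.1 q.2) / g q.1.1) + Complex.I * slopeFn H q.1 * q.2

theorem angleMap_zero (p : ℂ × ℂ) : angleMap p 0 = p.1 := by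
  simp [angleMap]

theorem analyticAt_angleMap (q : (ℂ × ℂ) × ℂ) :
    AnalyticAt ℂ (fun q : (ℂ × ℂ) × ℂ => angleMap q.1 q.2) q := by
  have h1 : AnalyticAt ℂ (fun q : (ℂ × ℂ) × ℂ => q.1.1) q :=
    AnalyticAt.fun_comp (g := fun x : ℂ × ℂ => x.1) analyticAt_fst analyticAt_fst
  exact h1.mul (analyticAt_const.mul analyticAt_snd).cexp

theorem tendsto_angleMap (p : ℂ × ℂ) : Tendsto (angleMap p) (𝓝 0) (𝓝 p.1) := by
  have h : Continuous (angleMap p) := by unfold angleMap; fun_prop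
  have := h.tendsto 0
  rwa [angleMap_zero] at this

/-- The quotient inside the logarithm is `1` at angle `0`, off the branch cut. Joint analyticity in
point and angle is what later yields uniform bounds. -/
theorem analyticAt_localPhase {H : ℂ × ℂ → ℂ} {p : ℂ × ℂ} {g : ℂ → ℂ} (hH : AnalyticAt ℂ H p)
    (hg : IsZeroParam H p g) (hw : p.2 ≠ 0) (hd : fderiv ℂ H p (0, 1) ≠ 0) :
    AnalyticAt ℂ (localPhase H g) (p, 0) := by
  have h1 : AnalyticAt ℂ (fun q : (ℂ × ℂ) × ℂ => g (angleMap q.1 q.2)) (p, 0) :=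
    AnalyticAt.fun_comp (f := fun q : (ℂ × ℂ) × ℂ => angleMap q.1 q.2)
      (by simp only [angleMap_zero]; exact hg.1) (analyticAt_angleMap _)
  have h2 : AnalyticAt ℂ (fun q : (ℂ × ℂ) × ℂ => g q.1.1) (p, 0) :=
    AnalyticAt.fun_comp (f := fun q : (ℂ × ℂ) × ℂ => q.1.1) hg.1
      (AnalyticAt.fun_comp (g := fun x : ℂ × ℂ => x.1) analyticAt_fst analyticAt_fst)
  have h3 : AnalyticAt ℂ (fun q : (ℂ × ℂ) × ℂ => slopeFn H q.1) (p, 0) :=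
    AnalyticAt.fun_comp (f := fun q : (ℂ × ℂ) × ℂ => q.1) (analyticAt_slopeFn hH hw hd)
      analyticAt_fst
  have hgp : g p.1 ≠ 0 := by rwa [hg.2.1]
  refine ((h1.div h2 hgp).clog ?_).add ((analyticAt_const.mul h3).mul analyticAt_snd)
  simp only [Pi.div_apply, angleMap_zero, div_self hgp]
  exact Complex.one_mem_slitPlane

theorem fTilde_eventuallyEq {H : ℂ × ℂ → ℂ} {p : ℂ × ℂ} {g : ℂ → ℂ} (hH : AnalyticAt ℂ H p)
    (hg : IsZeroParam H p g) (hd : fderiv ℂ H p (0, 1) ≠ 0) :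
    fTilde H p =ᶠ[𝓝 0] fun θ => localPhase H g (p, θ) := by
  have h0 : H p = 0 := hg.2.2.self_of_nhds.2 hg.2.1.symm
  have hz := (zeroParam_spec hH h0 (by rwa [partialW_eq hH])).eventuallyEq hg
  filter_upwards [(tendsto_angleMap p).eventually hz] with θ hθ
  rw [fTilde, localPhase, hθ, hz.self_of_nhds, dirSlope_eq hH]

theorem analyticAt_fTilde {H : ℂ × ℂ → ℂ} {p : ℂ × ℂ} {g : ℂ → ℂ} (hH : AnalyticAt ℂ H p)
    (hg : IsZeroParam H p g) (hw : p.2 ≠ 0) (hd : fderiv ℂ H p (0, 1) ≠ 0) :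
    AnalyticAt ℂ (fTilde H p) 0 := by
  have h1 : AnalyticAt ℂ (fun θ : ℂ => localPhase H g (p, θ)) 0 :=
    AnalyticAt.fun_comp (f := fun θ : ℂ => (p, θ)) (analyticAt_localPhase hH hg hw hd)
      (analyticAt_const.prod analyticAt_id)
  exact h1.congr (fTilde_eventuallyEq hH hg hd).symm

theorem psiTilde_eventuallyEq {G H : ℂ × ℂ → ℂ} {p : ℂ × ℂ} {g : ℂ → ℂ} (hG : AnalyticAt ℂ G p)
    (hH : AnalyticAt ℂ H p) (hg : IsZeroParam H p g) (hw : p.2 ≠ 0)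
    (hd : fderiv ℂ H p (0, 1) ≠ 0) :
    psiTilde G H p =ᶠ[𝓝 0] fun θ => poleWeight G H g (angleMap p θ) :=
  (tendsto_angleMap p).eventually (psi_eventuallyEq hG hH hg hw hd)

/-! ### Families of analytic functions -/

/-- A product neighbourhood inside the domain of analyticity gives one radius and one bound for all
nearby `p`. -/
theorem exists_uniform_disk {Φ : (ℂ × ℂ) × ℂ → ℂ} {p₀ : ℂ × ℂ} (h : AnalyticAt ℂ Φ (p₀, 0)) :
    ∃ r > 0, ∃ M : ℝ, (∀ᶠ p in 𝓝 p₀, DifferentiableOn ℂ (fun x => Φ (p, x)) (ball 0 r) ∧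
      ∀ x ∈ ball (0 : ℂ) r, ‖Φ (p, x)‖ ≤ M) ∧ ∀ x ∈ ball (0 : ℂ) r, ContinuousAt Φ (p₀, x) := by
  have hS : {q | AnalyticAt ℂ Φ q ∧ ‖Φ q‖ < ‖Φ (p₀, 0)‖ + 1} ∈ 𝓝 (p₀, (0 : ℂ)) := by
    filter_upwards [h.eventually_analyticAt,
      h.continuousAt.norm.eventually_lt_const (lt_add_one _)] with q h1 h2 using ⟨h1, h2⟩
  obtain ⟨U, hU, V, hV, hUV⟩ := mem_nhds_prod_iff.1 hS
  obtain ⟨r, hr, hrV⟩ := Metric.mem_nhds_iff.1 hV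
  refine ⟨r, hr, ‖Φ (p₀, 0)‖ + 1, ?_, fun x hx =>
    (hUV ⟨mem_of_mem_nhds hU, hrV hx⟩).1.continuousAt⟩
  filter_upwards [hU] with p hp
  refine ⟨fun x hx => ?_, fun x hx => (hUV (Set.mk_mem_prod hp (hrV hx))).2.le⟩
  have h1 := (hUV (Set.mk_mem_prod hp (hrV hx))).1.differentiableAt
  exact (DifferentiableAt.comp x (f := fun y : ℂ => (p, y)) h1
    ((differentiableAt_const p).prodMk differentiableAt_id)).differentiableWithinAt

theorem taylorCoeff_sub {f g : ℂ → ℂ} (hf : AnalyticAt ℂ f 0) (hg : AnalyticAt ℂ g 0) (k : ℕ) :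
    taylorCoeff (fun x => f x - g x) k = taylorCoeff f k - taylorCoeff g k := by
  have h := hf.hasFPowerSeriesAt.sub hg.hasFPowerSeriesAt
  have h' : taylorCoeff (f - g) k = _ := taylorCoeff_eq_coeff h k
  change taylorCoeff (f - g) k = _
  rw [h']
  change FormalMultilinearSeries.coeff (FormalMultilinearSeries.ofScalars ℂ _) k -
    FormalMultilinearSeries.coeff (FormalMultilinearSeries.ofScalars ℂ _) k = _
  rw [FormalMultilinearSeries.coeff_ofScalars, FormalMultilinearSeries.coeff_ofScalars]
  rfl

/-- Compactness of a closed disk makes `Φ(p, ·)` uniformly close to `Φ(p₀, ·)`, and a coefficient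
estimate for the difference does the rest. -/
theorem continuousAt_taylorCoeff {Φ : (ℂ × ℂ) × ℂ → ℂ} {p₀ : ℂ × ℂ}
    (h : AnalyticAt ℂ Φ (p₀, 0)) (k : ℕ) :
    ContinuousAt (fun p => taylorCoeff (fun x => Φ (p, x)) k) p₀ := by
  obtain ⟨r, hr, M, hΦ, hc⟩ := exists_uniform_disk h
  rw [Metric.continuousAt_iff']
  intro ε hε
  set η : ℝ := ε / 2 / (2 / (r / 2)) ^ k with hη
  have hηp : 0 < η := by positivity
  have hsub : ball (0 : ℂ) (r / 2) ⊆ ball 0 r := ball_subset_ball (by linarith)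
  have hcl : closedBall (0 : ℂ) (r / 2) ⊆ ball 0 r := closedBall_subset_ball (by linarith)
  have hunif : ∀ᶠ p in 𝓝 p₀, ∀ x ∈ closedBall (0 : ℂ) (r / 2), ‖Φ (p, x) - Φ (p₀, x)‖ < η := by
    refine (isCompact_closedBall (0 : ℂ) (r / 2)).eventually_forall_of_forall_eventually
      fun x hx => ?_
    have h1 : ContinuousAt (fun q : (ℂ × ℂ) × ℂ => ‖Φ (q.1, q.2) - Φ (p₀, q.2)‖) (p₀, x) := by
      refine ((hc x (hcl hx)).sub ?_).norm
      exact ContinuousAt.comp (f := fun q : (ℂ × ℂ) × ℂ => (p₀, q.2)) (g := Φ) (hc x (hcl hx))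
        (by fun_prop)
    refine h1.eventually_lt_const ?_
    simpa using hηp
  filter_upwards [hΦ, hunif] with p h1 h2
  have h0 := hΦ.self_of_nhds
  have ha : ∀ {f : ℂ → ℂ}, DifferentiableOn ℂ f (ball 0 r) → AnalyticAt ℂ f 0 := fun hf =>
    hf.analyticAt (ball_mem_nhds 0 hr)
  rw [dist_eq_norm, ← taylorCoeff_sub (ha h1.1) (ha h0.1)]
  have h3 := (norm_taylorCoeff_le_and_remainder (by linarith : 0 < r / 2)
    ((h1.1.sub h0.1).mono hsub) (M := η)
    (fun x hx => (h2 x (ball_subset_closedBall hx)).le) k).1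
  calc _ ≤ η * (2 / (r / 2)) ^ k := h3
    _ = ε / 2 := by rw [hη]; field_simp
    _ < ε := by linarith

theorem taylorCoeff_ne_zero {f : ℂ → ℂ} {k : ℕ} (hf : AnalyticAt ℂ f 0)
    (h : analyticOrderAt f 0 = k) : taylorCoeff f k ≠ 0 := by
  obtain ⟨g, hg, hg0, he⟩ := hf.analyticOrderAt_eq_natCast.1 h
  have : taylorCoeff f k = g 0 := by
    rw [← taylorCoeff_pow_mul hg k]
    refine taylorCoeff_congr ?_ k
    filter_upwards [he] with x hx
    rw [hx, sub_zero, smul_eq_mul]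
  rwa [this]

/-! ### Positivity of the real part of the phase -/

theorem eventually_angle_curve {H : ℂ × ℂ → ℂ} {p : ℂ × ℂ} {g : ℂ → ℂ}
    (hg : IsZeroParam H p g) :
    ∀ᶠ θ : ℝ in 𝓝 0, (angleMap p θ, g (angleMap p θ)) ∈ zeroSet H := by
  have hof : Tendsto (fun x : ℝ => (x : ℂ)) (𝓝 0) (𝓝 0) := by
    have := Complex.continuous_ofReal.tendsto 0
    rwa [Complex.ofReal_zero] at this
  filter_upwards [((hg.tendsto_curve.comp (tendsto_angleMap p)).comp hof).eventually hg.2.2]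
    with θ hθ using hθ.2 rfl

theorem norm_angleMap (p : ℂ × ℂ) (θ : ℝ) : ‖angleMap p θ‖ = ‖p.1‖ := by
  rw [angleMap, norm_mul, mul_comm Complex.I, Complex.norm_exp_ofReal_mul_I, mul_one]

theorem re_localPhase {H : ℂ × ℂ → ℂ} {p : ℂ × ℂ} {g : ℂ → ℂ} (hρ : (slopeFn H p).im = 0)
    (θ : ℝ) :
    (localPhase H g (p, θ)).re = Real.log (‖g (angleMap p θ)‖ / ‖g p.1‖) := by
  rw [localPhase, Complex.add_re, Complex.log_re, norm_div]
  simp [hρ]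

theorem eventually_re_localPhase_nonneg {H : ℂ × ℂ → ℂ} {p : ℂ × ℂ} {g : ℂ → ℂ}
    (hg : IsZeroParam H p g) (hmin : IsMinimal H p) (hw : p.2 ≠ 0) (hρ : (slopeFn H p).im = 0) :
    ∀ᶠ θ : ℝ in 𝓝 0, 0 ≤ (localPhase H g (p, θ)).re := by
  filter_upwards [eventually_angle_curve hg] with θ hθ
  rw [re_localPhase hρ]
  refine Real.log_nonneg ?_
  rw [hg.2.1, one_le_div (norm_pos_iff.2 hw)]
  by_contra! h
  exact h.ne (hmin.2 ⟨hθ, (norm_angleMap p θ).le, h.le⟩).2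

/-- If `|g(z e^{iθ})| ≤ |w|`, the curve point lies in `𝒱 ∩ D(p) = {p}`, which forces `e^{iθ} = 1`.
-/
theorem exists_re_localPhase_pos {H : ℂ × ℂ → ℂ} {p : ℂ × ℂ} {g : ℂ → ℂ}
    (hg : IsZeroParam H p g) (hmin : IsStrictlyMinimal H p) (hz : p.1 ≠ 0) (hw : p.2 ≠ 0)
    (hρ : (slopeFn H p).im = 0) :
    ∃ δ > 0, ∀ θ : ℝ, θ ≠ 0 → |θ| ≤ δ → 0 < (localPhase H g (p, θ)).re := by
  obtain ⟨ε, hε, hball⟩ := Metric.eventually_nhds_iff_ball.1 (eventually_angle_curve hg)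
  refine ⟨min (ε / 2) Real.pi, lt_min (by positivity) Real.pi_pos, fun θ h0 hθ => ?_⟩
  have hθε : θ ∈ ball (0 : ℝ) ε := by
    rw [mem_ball_zero_iff, Real.norm_eq_abs]
    linarith [hθ.trans (min_le_left _ _)]
  have hV := hball θ hθε
  rw [re_localPhase hρ]
  refine Real.log_pos ?_
  rw [hg.2.1, one_lt_div (norm_pos_iff.2 hw)]
  by_contra! h
  have hm : (angleMap p θ, g (angleMap p θ)) ∈ zeroSet H ∩ polydisk p :=
    ⟨hV, (norm_angleMap p θ).le, h⟩
  rw [zeroSet_inter_polydisk hmin, mem_singleton_iff] at hm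
  have h1 : angleMap p θ = p.1 := congrArg Prod.fst hm
  rw [angleMap] at h1
  exact exp_I_mul_ne_one h0 (hθ.trans (min_le_right _ _))
    (mul_left_cancel₀ hz (h1.trans (mul_one p.1).symm))

/-- No branch question arises, because `s` is a natural number. The relation `r = ρ s` is what
merges both powers into one phase. -/
theorem weight_mul_exp_localPhase {H : ℂ × ℂ → ℂ} {p : ℂ × ℂ} {g : ℂ → ℂ} {r s : ℕ} {θ : ℂ}
    (h0 : g p.1 ≠ 0) (h1 : g (angleMap p θ) ≠ 0) (hrs : (r : ℂ) = slopeFn H p * s) :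
    Complex.exp (-(Complex.I * r * θ)) * (g (angleMap p θ) ^ s)⁻¹ * g p.1 ^ s
      = Complex.exp (-(s : ℂ) * localPhase H g (p, θ)) := by
  have e : -(s : ℂ) * localPhase H g (p, θ)
      = -(Complex.I * r * θ) + -(s * Complex.log (g (angleMap p θ) / g p.1)) := by
    rw [localPhase, hrs]; ring
  rw [e, Complex.exp_add, Complex.exp_neg (s * _), Complex.exp_nat_mul,
    Complex.exp_log (div_ne_zero h1 h0), div_pow, inv_div]
  field_simp

/-! ### Vanishing of the first coefficients -/

theorem analyticAt_poleWeight {G H : ℂ × ℂ → ℂ} {p : ℂ × ℂ} {g : ℂ → ℂ} (hG : AnalyticAt ℂ G p)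
    (hH : AnalyticAt ℂ H p) (hg : IsZeroParam H p g) (hw : p.2 ≠ 0)
    (hd : fderiv ℂ H p (0, 1) ≠ 0) : AnalyticAt ℂ (poleWeight G H g) p.1 := by
  have a0 : AnalyticAt ℂ (fun ζ => (ζ, g ζ)) p.1 := analyticAt_id.prod hg.1
  have hpp : (p.1, g p.1) = p := by rw [hg.2.1]
  have a1 : AnalyticAt ℂ (fun ζ => G (ζ, g ζ)) p.1 :=
    AnalyticAt.fun_comp (f := fun ζ => (ζ, g ζ)) (by simpa only [hpp] using hG) a0
  have a2 : AnalyticAt ℂ (fun ζ => fderiv ℂ H (ζ, g ζ) (0, 1)) p.1 :=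
    AnalyticAt.fun_comp (g := fun q => fderiv ℂ H q (0, 1)) (f := fun ζ => (ζ, g ζ))
      (by simpa only [hpp] using analyticAt_fderiv_apply hH (0, 1)) a0
  refine (a1.div (a2.mul hg.1) ?_).neg
  simp only [Pi.mul_apply, hg.2.1]
  exact mul_ne_zero hd hw

/-- On the curve `|g(ζ) - w| = O(|ζ - z|)`, so both terms of the assumed bound have order `|ζ -
z|^l`; the denominator does not vanish at `p`. -/
theorem poleWeight_isBigO {G H : ℂ × ℂ → ℂ} {p : ℂ × ℂ} {g : ℂ → ℂ} {l : ℕ}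
    (hH : AnalyticAt ℂ H p) (hg : IsZeroParam H p g) (hw : p.2 ≠ 0)
    (hd : fderiv ℂ H p (0, 1) ≠ 0)
    (hl : G =O[𝓝[zeroSet H] p] fun q => ‖q.1 - p.1‖ ^ l + ‖q.2 - p.2‖ ^ l) :
    poleWeight G H g =O[𝓝 p.1] fun ζ => (ζ - p.1) ^ l := by
  have ht : Tendsto (fun ζ => (ζ, g ζ)) (𝓝 p.1) (𝓝[zeroSet H] p) := by
    refine tendsto_nhdsWithin_iff.2 ⟨hg.tendsto_curve, ?_⟩
    filter_upwards [hg.tendsto_curve.eventually hg.2.2] with ζ hζ using hζ.2 rfl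
  have h1 : (fun ζ => G (ζ, g ζ)) =O[𝓝 p.1] fun ζ => ‖ζ - p.1‖ ^ l + ‖g ζ - p.2‖ ^ l :=
    hl.comp_tendsto ht
  have h2 : (fun ζ => g ζ - p.2) =O[𝓝 p.1] fun ζ => ζ - p.1 := by
    have := hg.1.differentiableAt.isBigO_sub
    rwa [hg.2.1] at this
  have h3 : (fun ζ => ‖ζ - p.1‖ ^ l + ‖g ζ - p.2‖ ^ l) =O[𝓝 p.1] fun ζ => (ζ - p.1) ^ l := by
    refine Asymptotics.IsBigO.add ?_ ?_
    · exact (Asymptotics.isBigO_refl (fun ζ => ζ - p.1) (𝓝 p.1)).norm_left.pow l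
    · exact h2.norm_left.pow l
  have h4 : (fun ζ => (fderiv ℂ H (ζ, g ζ) (0, 1) * g ζ)⁻¹) =O[𝓝 p.1] fun _ => (1 : ℂ) := by
    refine Tendsto.isBigO_one ℂ (ContinuousAt.tendsto
      (ContinuousAt.inv₀ (ContinuousAt.mul ?_ hg.1.continuousAt) ?_))
    · have hc := (analyticAt_fderiv_apply hH (0, 1)).continuousAt
      have : Tendsto (fun ζ => fderiv ℂ H (ζ, g ζ) (0, 1)) (𝓝 p.1)
          (𝓝 (fderiv ℂ H (p.1, g p.1) (0, 1))) := by
        rw [hg.2.1]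
        exact hc.tendsto.comp hg.tendsto_curve
      exact this
    · rw [hg.2.1]
      exact mul_ne_zero hd hw
  have h5 := ((h1.trans h3).mul h4).neg_left
  refine h5.congr (fun ζ => ?_) fun ζ => mul_one _
  rw [poleWeight, div_eq_mul_inv]

theorem isInverseAtZero_rootPhase {f : ℂ → ℂ} {k : ℕ} (hk : 1 ≤ k) (hf : AnalyticAt ℂ f 0)
    (ho : analyticOrderAt f 0 = k) :
    IsInverseAtZero (rootPhase f k) (inverseAtZero (rootPhase f k)) := by
  refine Classical.epsilon_spec (p := IsInverseAtZero (rootPhase f k)) ?_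
  have hS : {x | AnalyticAt ℂ f x ∧ ‖f x‖ < ‖f 0‖ + 1} ∈ 𝓝 (0 : ℂ) := by
    filter_upwards [hf.eventually_analyticAt,
      hf.continuousAt.norm.eventually_lt_const (lt_add_one _)] with q h1 h2 using ⟨h1, h2⟩
  obtain ⟨r, hr, hrS⟩ := Metric.mem_nhds_iff.1 hS
  obtain ⟨δ₀, hδ₀, -, ρ, hρ, A, -, hcoord⟩ := exists_root_coordinate hk (M := ‖f 0‖ + 1) hr
    (norm_pos_iff.2 (taylorCoeff_ne_zero hf ho))
  obtain ⟨u, Y, η, hη0, hηd, hη, hY⟩ := hcoord f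
    (fun x hx => (hrS hx).1.differentiableAt.differentiableWithinAt) (fun x hx => (hrS hx).2.le)
    ho le_rfl
  refine ⟨η, isInverseAtZero_of_coordinate hρ (by positivity : 0 < 2 * δ₀) hη0 hηd
    (fun t ht => (hη t ht).2.1) (fun x hx => (hY x hx).2.2.1) ?_⟩
  filter_upwards [ball_mem_nhds (0 : ℂ) (by positivity : 0 < 2 * δ₀)] with x hx
  rw [(hY x hx).2.2.2.2.2.1]

theorem bCoeff_eq_zero {G H : ℂ × ℂ → ℂ} {p : ℂ × ℂ} {g : ℂ → ℂ} {k l₀ l : ℕ} (hk : 1 ≤ k)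
    (hG : AnalyticAt ℂ G p) (hH : AnalyticAt ℂ H p) (hg : IsZeroParam H p g) (hw : p.2 ≠ 0)
    (hd : fderiv ℂ H p (0, 1) ≠ 0) (ho : analyticOrderAt (fTilde H p) 0 = k)
    (hl₀ : G =O[𝓝[zeroSet H] p] fun q => ‖q.1 - p.1‖ ^ l₀ + ‖q.2 - p.2‖ ^ l₀) (hl : l < l₀) :
    bCoeff G H p k l = 0 := by
  have hfa := analyticAt_fTilde hH hg hw hd
  obtain ⟨ha, h0, -, -⟩ := isInverseAtZero_rootPhase hk hfa ho
  set η := inverseAtZero (rootPhase (fTilde H p) k) with hη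
  have hηt : Tendsto η (𝓝 0) (𝓝 0) := by
    have := ha.continuousAt.tendsto
    rwa [h0] at this
  have hψ := psiTilde_eventuallyEq hG hH hg hw hd
  have hψa : AnalyticAt ℂ (psiTilde G H p) 0 := by
    have hpw := analyticAt_poleWeight hG hH hg hw hd
    have h1 : AnalyticAt ℂ (angleMap p) 0 := analyticAt_const.mul
      (analyticAt_const.mul analyticAt_id).cexp
    have h2 : AnalyticAt ℂ (fun θ => poleWeight G H g (angleMap p θ)) 0 :=
      AnalyticAt.fun_comp (by rwa [angleMap_zero]) h1
    exact h2.congr hψ.symm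
  have hψO : psiTilde G H p =O[𝓝 0] fun θ => θ ^ l₀ := by
    have h1 := (poleWeight_isBigO hH hg hw hd hl₀).comp_tendsto (tendsto_angleMap p)
    have hdm : DifferentiableAt ℂ (angleMap p) 0 := by unfold angleMap; fun_prop
    have h2 : (fun θ => angleMap p θ - p.1) =O[𝓝 0] fun θ => θ := by
      simpa [angleMap_zero] using hdm.isBigO_sub
    exact (hψ.trans_isBigO h1).trans (h2.pow l₀)
  have hηO : η =O[𝓝 0] fun t => t := by
    simpa [h0] using ha.differentiableAt.isBigO_sub
  have hA : AnalyticAt ℂ (fun t => psiTilde G H p (η t) * deriv η t) 0 :=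
    (AnalyticAt.fun_comp (by rwa [h0]) ha).mul ha.deriv
  refine taylorCoeff_eq_zero_of_isBigO hA ?_ hl
  have h1 : (fun t => psiTilde G H p (η t)) =O[𝓝 0] fun t => t ^ l₀ :=
    (hψO.comp_tendsto hηt).trans (hηO.pow l₀)
  simpa using h1.mul (ha.deriv.continuousAt.isBigO_one ℂ)

/-! ### The coefficient as an integral over angles -/

theorem fTilde_zero (H : ℂ × ℂ → ℂ) (p : ℂ × ℂ) : fTilde H p 0 = 0 := by
  rw [fTilde, angleMap_zero]
  by_cases h : zeroParam H p p.1 = 0 <;> simp [h]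

/-- If `z = 0`, the slope and the logarithm both vanish identically (with `0/0 = 0` and `log 0 = 0`
in the degenerate case), so the order would be infinite. -/
theorem fst_ne_zero_of_analyticOrderAt {H : ℂ × ℂ → ℂ} {p : ℂ × ℂ} {k : ℕ}
    (ho : analyticOrderAt (fTilde H p) 0 = k) : p.1 ≠ 0 := by
  intro hz
  have : fTilde H p = fun _ => 0 := by
    ext θ
    have h0 : dirSlope H p = 0 := by simp [dirSlope, hz]
    rw [fTilde, h0, angleMap, hz, zero_mul]
    by_cases h : zeroParam H p 0 = 0 <;> simp [h]
  have ht : analyticOrderAt (fTilde H p) 0 = ⊤ := by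
    rw [analyticOrderAt_eq_top, this]
    exact Eventually.of_forall fun _ => rfl
  rw [ht] at ho
  exact ENat.top_ne_natCast k ho

theorem one_le_of_analyticOrderAt {H : ℂ × ℂ → ℂ} {p : ℂ × ℂ} {k : ℕ}
    (ha : AnalyticAt ℂ (fTilde H p) 0) (ho : analyticOrderAt (fTilde H p) 0 = k) : 1 ≤ k := by
  rcases Nat.eq_zero_or_pos k with rfl | h
  · exact absurd (fTilde_zero H p) (ha.analyticOrderAt_eq_zero.1 (by simpa using ho))
  · exact h

theorem eq_slopeFn_mul_of_inDir {H : ℂ × ℂ → ℂ} {p : ℂ × ℂ} {r s : ℕ} (hH : AnalyticAt ℂ H p)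
    (hw : p.2 ≠ 0) (hd : fderiv ℂ H p (0, 1) ≠ 0) (h : InDir H p r s) :
    (r : ℂ) = slopeFn H p * s := by
  obtain ⟨c, -, hr, hs⟩ := h
  rw [hr, hs, slopeFn, partialZ_eq hH, partialW_eq hH]
  field_simp

theorem im_eq_zero_of_natCast_eq_mul {x : ℂ} {r s : ℕ} (hs : s ≠ 0) (h : (r : ℂ) = x * s) :
    x.im = 0 := by
  have := congrArg Complex.im h
  simpa [hs] using this.symm

/-- Strict minimality is used only at `p₀`, to obtain the fibre bounds on a neighbourhood; at nearby
`p` minimality suffices to move the outer circle. -/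
theorem exists_coeff_sub_integral_le {G H : ℂ × ℂ → ℂ} {a : ℕ → ℕ → ℂ} {p₀ : ℂ × ℂ} {g : ℂ → ℂ}
    (hF : ∀ᶠ q : ℂ × ℂ in 𝓝 0,
      HasSum (fun n : ℕ × ℕ => a n.1 n.2 * q.1 ^ n.1 * q.2 ^ n.2) (G q / H q))
    (hG : AnalyticOnNhd ℂ G (polydisk p₀)) (hH : AnalyticOnNhd ℂ H (polydisk p₀))
    (hmin : IsStrictlyMinimal H p₀) (hg : IsZeroParam H p₀ g) (hz : p₀.1 ≠ 0) (hw : p₀.2 ≠ 0)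
    (hd : fderiv ℂ H p₀ (0, 1) ≠ 0) :
    ∃ δ₂ > 0, ∀ δ : ℝ, 0 < δ → δ ≤ δ₂ → ∃ C m : ℝ, 0 ≤ C ∧ 0 < m ∧ ∀ᶠ p in 𝓝 p₀,
      AnalyticOnNhd ℂ G (polydisk p) → AnalyticOnNhd ℂ H (polydisk p) → IsMinimal H p →
      ∀ r s : ℕ, (r : ℂ) = slopeFn H p * s →
        ‖a r s * p.1 ^ r * p.2 ^ s - 1 / (2 * Real.pi) * ∫ θ in (-δ)..δ,
          poleWeight G H g (angleMap p θ) * Complex.exp (-(s : ℂ) * localPhase H g (p, θ))‖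
          ≤ C * Real.exp (-s * m) := by
  obtain ⟨R₁, hR₁, M₁, hnear⟩ := exists_near_bound hG hH hmin hg hw hd
  have hcont : ContinuousAt (fun q : (ℂ × ℂ) × ℂ => angleMap q.1 q.2) (p₀, 0) :=
    (analyticAt_angleMap _).continuousAt
  have hnear' := hcont.tendsto.eventually (by simpa only [angleMap_zero] using hnear)
  obtain ⟨U, hU, V, hV, hUV⟩ := mem_nhds_prod_iff.1 hnear'
  obtain ⟨ε, hε, hεV⟩ := Metric.mem_nhds_iff.1 hV
  refine ⟨min (ε / 2) Real.pi, lt_min (by positivity) Real.pi_pos, fun δ hδ hδ₂ => ?_⟩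
  obtain ⟨R₂, hR₂, M₂, hfar⟩ := exists_far_bound hG hH hmin hz hδ
  obtain ⟨ρ₀, hρ₀, hcoeff⟩ := iterated_circleIntegral_eq_coeff hF
  have hw0 : 0 < ‖p₀.2‖ := norm_pos_iff.2 hw
  set R := min R₁ R₂ with hR
  have hRw : ‖p₀.2‖ < R := lt_min hR₁ hR₂
  have hR0 : 0 < R := hw0.trans hRw
  -- Nearby poles satisfy `|p.2| < R' < R`, so `|p.2|^s R^{-s}` is at most `e^{-s log(R/R')}`.
  set R' := (‖p₀.2‖ + R) / 2 with hR'
  have hR'0 : 0 < R' := by positivity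
  set M := max |M₁| |M₂| with hM
  have hM0 : 0 ≤ M := (abs_nonneg _).trans (le_max_left _ _)
  set ρ := min ρ₀ (‖p₀.2‖ / 2) with hρ
  have hρ0 : 0 < ρ := lt_min hρ₀ (by positivity)
  have hρw : ρ ≤ ‖p₀.2‖ / 2 := min_le_right _ _
  have hE : ∀ {M' R₃ : ℝ} (s : ℕ), |M'| ≤ M → R ≤ R₃ → 2 * Real.pi * (M' * (R₃ ^ s)⁻¹)
      ≤ 2 * Real.pi * (M * (R ^ s)⁻¹) := by
    intro M' R₃ s h1 h2
    have hp := Real.pi_pos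
    have hR₃ : 0 < R₃ := hR0.trans_le h2
    have := (le_abs_self M').trans h1
    gcongr
  refine ⟨M, Real.log (R / R'), hM0, Real.log_pos ?_, ?_⟩
  · rw [one_lt_div hR'0]; linarith
  have hcn : ContinuousAt (fun p : ℂ × ℂ => ‖p.2‖) p₀ := by fun_prop
  filter_upwards [hU, continuousAt_fst.eventually hfar, hg.eventually,
    hcn.eventually_lt_const (show ‖p₀.2‖ < R' by linarith),
    hcn.eventually_const_lt (show ‖p₀.2‖ / 2 < ‖p₀.2‖ by linarith),
    (continuousAt_fst : ContinuousAt Prod.fst p₀).eventually_ne hz] with p hpU hpfar hpg hpR hpρ hpz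
    hpG hpH hpmin r s hrs
  have hgp := hpg hpmin.1
  have hpw : p.2 ≠ 0 := by
    rw [← norm_pos_iff]
    linarith
  have hgw : g p.1 ≠ 0 := by rwa [hgp.2.1]
  have hgood : ∀ θ : ℝ, |θ| ≤ δ → _ := fun θ hθ => hUV (Set.mk_mem_prod hpU (hεV (by
    rw [mem_ball_zero_iff, Complex.norm_real, Real.norm_eq_abs]
    linarith [hθ.trans (hδ₂.trans (min_le_left _ _))])))
  -- A zero of `H` here would lie in the polydisk with `|u| = ρ < |p.2|`, off the torus, against
  -- minimality.
  have hdiff : ∀ ζ ∈ closedBall (0 : ℂ) ‖p.1‖, ∀ u ∈ sphere (0 : ℂ) ρ,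
      DifferentiableAt ℂ (fun q => G q / H q) (ζ, u) := by
    intro ζ hζ u hu
    rw [mem_closedBall_zero_iff] at hζ
    rw [mem_sphere_zero_iff_norm] at hu
    have hq : (ζ, u) ∈ polydisk p := ⟨hζ, by simp only; rw [hu]; linarith⟩
    refine ((hpG _ hq).fun_div (hpH _ hq) fun h0 => ?_).differentiableAt
    have := (hpmin.2 ⟨h0, hq⟩).2
    simp only at this
    linarith
  have hc : (∮ ζ in C(0, ‖p.1‖), (ζ ^ (r + 1))⁻¹ * ∮ u in C(0, ρ), (u ^ (s + 1))⁻¹ *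
      (G (ζ, u) / H (ζ, u))) = (2 * Real.pi * Complex.I) ^ 2 * a r s := by
    have hp1 : 0 < ‖p.1‖ := norm_pos_iff.2 hpz
    rw [iterated_circleIntegral_radius (F := fun q => G q / H q) hρ0 (lt_min hρ₀ hp1)
      (min_le_right _ _) hdiff]
    exact hcoeff _ _ (lt_min hρ₀ hp1) (min_le_left _ _) hρ0 (min_le_left _ _) r s
  have hkey := norm_coeff_sub_integral_le (F := fun q => G q / H q) (a := a r s) (z := p.1)
    (r := r) (s := s) (ρ := ρ) (δ := δ) (E := M * (R ^ s)⁻¹)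
    (P := fun θ : ℝ => poleWeight G H g (angleMap p θ) * (g (angleMap p θ) ^ s)⁻¹) hpz hρ0 hδ
    (hδ₂.trans (min_le_right _ _)) hc
    (fun ζ hζ u hu => (hdiff ζ (sphere_subset_closedBall hζ) u hu).continuousAt)
    (fun θ h1 h2 => (hpfar θ h1 h2 s ρ hρ0 (by linarith)).trans
      (hE s (le_max_right _ _) (min_le_right _ _)))
    (fun θ h1 => ((hgood θ h1).2.2.2 s ρ hρ0 hρw).trans
      (hE s (le_max_left _ _) (min_le_left _ _)))
    (by
      intro θ hθ
      have hθ' := hgood θ (abs_le.2 hθ)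
      have hca : ContinuousAt (fun θ : ℝ => angleMap p θ) θ := by unfold angleMap; fun_prop
      have h1 : ContinuousAt (fun θ : ℝ => g (angleMap p θ)) θ :=
        ContinuousAt.comp (f := fun θ : ℝ => angleMap p θ) hθ'.1.continuousAt hca
      have h2 : ContinuousAt (fun θ : ℝ => poleWeight G H g (angleMap p θ)) θ :=
        ContinuousAt.comp (f := fun θ : ℝ => angleMap p θ) hθ'.2.1.continuousAt hca
      exact (h2.mul ((h1.pow s).inv₀ (pow_ne_zero s hθ'.2.2.1))).continuousWithinAt)
  have hint : (∫ θ in (-δ)..δ, Complex.exp (-(Complex.I * r * θ)) *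
      (poleWeight G H g (angleMap p θ) * (g (angleMap p θ) ^ s)⁻¹)) * p.2 ^ s
      = ∫ θ in (-δ)..δ, poleWeight G H g (angleMap p θ) *
        Complex.exp (-(s : ℂ) * localPhase H g (p, θ)) := by
    rw [← intervalIntegral.integral_mul_const]
    refine intervalIntegral.integral_congr fun θ hθ => ?_
    rw [uIcc_of_le (by linarith)] at hθ
    have hθ' := hgood θ (abs_le.2 hθ)
    rw [← weight_mul_exp_localPhase hgw hθ'.2.2.1 hrs, hgp.2.1]
    ring
  rw [← hint, show ∀ A B C D E : ℂ, A * B * C - D * (E * C) = (A * B - D * E) * C by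
    intros; ring, norm_mul, norm_pow]
  calc _ ≤ M * (R ^ s)⁻¹ * R' ^ s := by gcongr
    _ = M * Real.exp (-s * Real.log (R / R')) := by
      rw [neg_mul, Real.exp_neg, Real.exp_nat_mul, Real.exp_log (by positivity), div_pow R R' s,
        inv_div, div_eq_inv_mul, mul_assoc]

/-! ### The expansion, locally uniformly in the pole -/

theorem exists_local_expansion {G H : ℂ × ℂ → ℂ} {a : ℕ → ℕ → ℂ} {K : Set (ℂ × ℂ)} {k : ℕ}
    (hF : ∀ᶠ q : ℂ × ℂ in 𝓝 0,
      HasSum (fun n : ℕ × ℕ => a n.1 n.2 * q.1 ^ n.1 * q.2 ^ n.2) (G q / H q))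
    (hG : ∀ p ∈ K, AnalyticOnNhd ℂ G (polydisk p)) (hH : ∀ p ∈ K, AnalyticOnNhd ℂ H (polydisk p))
    (hmin : ∀ p ∈ K, IsStrictlyMinimal H p) (hw : ∀ p ∈ K, p.2 * partialW H p ≠ 0)
    (hk : ∀ p ∈ K, analyticOrderAt (fTilde H p) 0 = k) (n : ℕ) {p₀ : ℂ × ℂ} (hp₀ : p₀ ∈ K) :
    ∃ C : ℝ, ∀ᶠ p in 𝓝 p₀, p ∈ K → ∀ r s : ℕ, 1 ≤ s → InDir H p r s →
      ‖a r s * p.1 ^ r * p.2 ^ s - 1 / (2 * Real.pi) * ∑ l ∈ Finset.range n,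
        constScriptA (taylorCoeff (fTilde H p) k) k l * bCoeff G H p k l *
          (((s : ℝ) ^ (-(((l : ℝ) + 1) / (k : ℝ))) : ℝ) : ℂ)‖
        ≤ C * (s : ℝ) ^ (-(((n : ℝ) + 1) / (k : ℝ))) := by
  have hself : ∀ p : ℂ × ℂ, p ∈ polydisk p := fun p => ⟨le_rfl, le_rfl⟩
  have hHa : ∀ p ∈ K, AnalyticAt ℂ H p := fun p hp => hH p hp p (hself p)
  have hGa : ∀ p ∈ K, AnalyticAt ℂ G p := fun p hp => hG p hp p (hself p)
  have hw2 : ∀ p ∈ K, p.2 ≠ 0 := fun p hp => left_ne_zero_of_mul (hw p hp)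
  have hd : ∀ p ∈ K, fderiv ℂ H p (0, 1) ≠ 0 := fun p hp => by
    rw [← partialW_eq (hHa p hp)]
    exact right_ne_zero_of_mul (hw p hp)
  have hslope : ∀ p ∈ K, ∀ r s : ℕ, InDir H p r s → (r : ℂ) = slopeFn H p * s :=
    fun p hp r s h => eq_slopeFn_mul_of_inDir (hHa p hp) (hw2 p hp) (hd p hp) h
  -- A direction with `s ≥ 1` forces a real slope. If the slope at `p₀` is not real, neither is it
  -- nearby, and the claim is vacuous.
  by_cases him : (slopeFn H p₀).im ≠ 0
  · refine ⟨0, ?_⟩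
    have hc : ContinuousAt (fun p => (slopeFn H p).im) p₀ :=
      Complex.continuous_im.continuousAt.comp
        (analyticAt_slopeFn (hHa p₀ hp₀) (hw2 p₀ hp₀) (hd p₀ hp₀)).continuousAt
    filter_upwards [hc.eventually_ne him] with p hp hpK r s hs hdir
    exact absurd (im_eq_zero_of_natCast_eq_mul (by omega) (hslope p hpK r s hdir)) hp
  push Not at him
  obtain ⟨g, hg⟩ : ∃ g, IsZeroParam H p₀ g := ⟨_, zeroParam_spec (hHa p₀ hp₀) (hmin p₀ hp₀).1.1
    (right_ne_zero_of_mul (hw p₀ hp₀))⟩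
  have hk1 : 1 ≤ k := one_le_of_analyticOrderAt
    (analyticAt_fTilde (hHa p₀ hp₀) hg (hw2 p₀ hp₀) (hd p₀ hp₀)) (hk p₀ hp₀)
  have hΦ : AnalyticAt ℂ (localPhase H g) (p₀, 0) :=
    analyticAt_localPhase (hHa p₀ hp₀) hg (hw2 p₀ hp₀) (hd p₀ hp₀)
  have hΨ : AnalyticAt ℂ (fun q : (ℂ × ℂ) × ℂ => poleWeight G H g (angleMap q.1 q.2)) (p₀, 0) :=
    AnalyticAt.fun_comp (f := fun q : (ℂ × ℂ) × ℂ => angleMap q.1 q.2)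
      (by
        simp only [angleMap_zero]
        exact analyticAt_poleWeight (hGa p₀ hp₀) (hHa p₀ hp₀) hg (hw2 p₀ hp₀) (hd p₀ hp₀))
      (analyticAt_angleMap _)
  obtain ⟨r₁, hr₁, M₁, hΦd, hΦc⟩ := exists_uniform_disk hΦ
  obtain ⟨r₂, hr₂, M₂, hΨd, -⟩ := exists_uniform_disk hΨ
  have hT : ∀ p ∈ K, IsZeroParam H p g →
      taylorCoeff (fTilde H p) k = taylorCoeff (fun x => localPhase H g (p, x)) k :=
    fun p hp hgp => taylorCoeff_congr (fTilde_eventuallyEq (hHa p hp) hgp (hd p hp)) k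
  -- Halving here, and in `m` below, leaves room for the strict inequalities at `p₀` to persist
  -- nearby by continuity.
  set c₀ := ‖taylorCoeff (fTilde H p₀) k‖ / 2 with hc₀
  have hc₀p : 0 < c₀ := half_pos (norm_pos_iff.2 (taylorCoeff_ne_zero
    (analyticAt_fTilde (hHa p₀ hp₀) hg (hw2 p₀ hp₀) (hd p₀ hp₀)) (hk p₀ hp₀)))
  obtain ⟨δ₀, hδ₀, hδ₀r, hlap⟩ := laplace_expansion_uniform hk1 (M := M₁) (lt_min hr₁ hr₂) hc₀p
  obtain ⟨δ₁, hδ₁, hpos⟩ := exists_re_localPhase_pos hg (hmin p₀ hp₀)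
    (fst_ne_zero_of_analyticOrderAt (hk p₀ hp₀)) (hw2 p₀ hp₀) him
  obtain ⟨δ₂, hδ₂, hcau⟩ := exists_coeff_sub_integral_le hF (hG p₀ hp₀) (hH p₀ hp₀) (hmin p₀ hp₀)
    hg (fst_ne_zero_of_analyticOrderAt (hk p₀ hp₀)) (hw2 p₀ hp₀) (hd p₀ hp₀)
  set δ := min δ₀ (min δ₁ δ₂) with hδdef
  have hδ : 0 < δ := lt_min hδ₀ (lt_min hδ₁ hδ₂)
  have hδle₀ : δ ≤ δ₀ := min_le_left _ _
  have hδle₁ : δ ≤ δ₁ := (min_le_right _ _).trans (min_le_left _ _)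
  have hδle₂ : δ ≤ δ₂ := (min_le_right _ _).trans (min_le_right _ _)
  have hpos₁ : 0 < (localPhase H g (p₀, (δ : ℂ))).re :=
    hpos δ hδ.ne' (by rwa [abs_of_pos hδ])
  have hpos₂ : 0 < (localPhase H g (p₀, -(δ : ℂ))).re := by
    have := hpos (-δ) (by simpa using hδ.ne') (by rwa [abs_neg, abs_of_pos hδ])
    rwa [Complex.ofReal_neg] at this
  set m := min (localPhase H g (p₀, (δ : ℂ))).re (localPhase H g (p₀, -(δ : ℂ))).re / 2 with hm
  have hmin0 := lt_min hpos₁ hpos₂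
  have hm0 : 0 < m := half_pos hmin0
  have hball : ∀ x : ℂ, ‖x‖ = δ → ContinuousAt (fun p => (localPhase H g (p, x)).re) p₀ := by
    intro x hx
    have h1 := hΦc x (by
      rw [mem_ball_zero_iff, hx]
      exact (hδle₀.trans_lt hδ₀r).trans_le (min_le_left _ _))
    exact Complex.continuous_re.continuousAt.comp
      (ContinuousAt.comp (f := fun p : ℂ × ℂ => (p, x)) h1 (by fun_prop))
  have hnδ : ‖(δ : ℂ)‖ = δ := by rw [Complex.norm_real, Real.norm_eq_abs, abs_of_pos hδ]
  obtain ⟨C₁, hC₁, hL⟩ := hlap δ hδ hδle₀ M₂ m hm0 n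
  obtain ⟨C₂, m', hC₂, hm', hcoeff⟩ := hcau δ hδ hδle₂
  obtain ⟨C₃, hC₃, hexp⟩ := exists_exp_neg_le_laplaceMoment hk1 n hm'
  refine ⟨C₂ * (C₃ * (1 / (k : ℝ) * Real.Gamma (((n : ℝ) + 1) / k))) + 1 / (2 * Real.pi) * C₁, ?_⟩
  filter_upwards [hΦd, hΨd, hg.eventually, hcoeff,
    (hball δ hnδ).eventually_const_lt
      (show m < (localPhase H g (p₀, (δ : ℂ))).re from
        (half_lt_self hmin0).trans_le (min_le_left _ _)),
    (hball (-δ) (by rwa [norm_neg])).eventually_const_lt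
      (show m < (localPhase H g (p₀, -(δ : ℂ))).re from
        (half_lt_self hmin0).trans_le (min_le_right _ _)),
    (continuousAt_taylorCoeff hΦ k).norm.eventually_const_lt
      (show c₀ < ‖taylorCoeff (fun x => localPhase H g (p₀, x)) k‖ by
        rw [← hT p₀ hp₀ hg]; linarith)]
    with p h1 h2 h3 h4 h5 h6 h7 hpK r s hs hdir
  have hgp := h3 (hmin p hpK).1.1
  have hrs := hslope p hpK r s hdir
  have hs1 : (1 : ℝ) ≤ s := by exact_mod_cast hs
  have hcast : ((s : ℝ) : ℂ) = (s : ℂ) := Complex.ofReal_natCast s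
  have hL' := hL (fun x => localPhase H g (p, x)) (fun x => poleWeight G H g (angleMap p x))
    (fTilde H p) (psiTilde G H p) (h1.1.mono (ball_subset_ball (min_le_left _ _)))
    (h2.1.mono (ball_subset_ball (min_le_right _ _)))
    (fun x hx => h1.2 x (ball_subset_ball (min_le_left _ _) hx))
    (fun x hx => h2.2 x (ball_subset_ball (min_le_right _ _) hx))
    (fTilde_eventuallyEq (hHa p hpK) hgp (hd p hpK))
    (psiTilde_eventuallyEq (hGa p hpK) (hHa p hpK) hgp (hw2 p hpK) (hd p hpK)) (hk p hpK)
    (by rw [hT p hpK hgp]; exact h7.le)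
    (eventually_re_localPhase_nonneg hgp (hmin p hpK).1 (hw2 p hpK)
      (im_eq_zero_of_natCast_eq_mul (by omega) hrs)) h5.le h6.le s hs1
  have h4' := h4 (hG p hpK) (hH p hpK) (hmin p hpK).1 r s hrs
  have he := hexp s hs1
  rw [hcast] at hL'
  have hπ : ‖(1 / (2 * Real.pi) : ℂ)‖ = 1 / (2 * Real.pi) := by
    rw [show (1 / (2 * Real.pi) : ℂ) = ((1 / (2 * Real.pi) : ℝ) : ℂ) by push_cast; rfl,
      Complex.norm_real, Real.norm_of_nonneg (by positivity)]
  have hsplit : ∀ A B D E : ℂ, A - B * E = A - B * D + B * (D - E) := by intros; ring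
  refine (le_of_eq (congrArg norm (hsplit _ _ (∫ θ in (-δ)..δ, poleWeight G H g (angleMap p θ) *
    Complex.exp (-(s : ℂ) * localPhase H g (p, θ))) _))).trans ((norm_add_le _ _).trans ?_)
  rw [norm_mul, hπ, add_mul]
  refine add_le_add (h4'.trans ?_) ?_
  · calc _ ≤ C₂ * (C₃ * laplaceMoment k n s) := by gcongr
      _ = _ := by rw [laplaceMoment]; ring
  · rw [mul_assoc]
    exact mul_le_mul_of_nonneg_left hL' (by positivity)

theorem expansionSum_eq_sum_range {G H : ℂ × ℂ → ℂ} {p : ℂ × ℂ} {k l₀ : ℕ}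
    (hb : ∀ l < l₀, bCoeff G H p k l = 0) (N s : ℕ) :
    expansionSum G H p k l₀ N s = ∑ l ∈ Finset.range (N + 1),
      constScriptA (taylorCoeff (fTilde H p) k) k l * bCoeff G H p k l *
        (((s : ℝ) ^ (-(((l : ℝ) + 1) / (k : ℝ))) : ℝ) : ℂ) := by
  rw [expansionSum]
  refine Finset.sum_subset (fun l hl => ?_) fun l hl hl' => ?_
  · rw [Finset.mem_Icc] at hl
    exact Finset.mem_range.2 (by omega)
  · rw [Finset.mem_range] at hl
    rw [Finset.mem_Icc] at hl'
    rw [hb l (by omega), mul_zero, zero_mul]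

theorem norm_sub_mul_le_of_norm_mul_sub_le {A B x z w : ℂ} {r s : ℕ} {E : ℝ} (hz : z ≠ 0)
    (hw : w ≠ 0) (h : ‖A * z ^ r * w ^ s - x * B‖ ≤ E) :
    ‖A - x * z ^ (-(r : ℤ)) * w ^ (-(s : ℤ)) * B‖
      ≤ E * ‖z ^ (-(r : ℤ)) * w ^ (-(s : ℤ))‖ := by
  have : A - x * z ^ (-(r : ℤ)) * w ^ (-(s : ℤ)) * B
      = (A * z ^ r * w ^ s - x * B) * (z ^ (-(r : ℤ)) * w ^ (-(s : ℤ))) := by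
    simp only [zpow_neg, zpow_natCast]
    field_simp
  rw [this, norm_mul]
  gcongr

end SmoothPole

end

/-! ### From local expansions to a compact set of poles -/

theorem theorem3p2
    (G H : ℂ × ℂ → ℂ) (a : ℕ → ℕ → ℂ)
    -- `F = G / H = ∑ a_{r,s} z^r w^s` near the origin
    (hF : ∀ᶠ q : ℂ × ℂ in 𝓝 0,
      HasSum (fun n : ℕ × ℕ => a n.1 n.2 * q.1 ^ n.1 * q.2 ^ n.2) (G q / H q))
    (K : Set (ℂ × ℂ)) (hK : IsCompact K)
    -- `G` and `H` are analytic in a neighborhood of `D(p)` for every `p ∈ K`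
    (hG : ∀ p ∈ K, AnalyticOnNhd ℂ G (SmoothPole.polydisk p))
    (hH : ∀ p ∈ K, AnalyticOnNhd ℂ H (SmoothPole.polydisk p))
    -- `K` consists of strictly minimal simple poles
    (hmin : ∀ p ∈ K, SmoothPole.IsStrictlyMinimal H p)
    (hpole : ∀ p ∈ K, SmoothPole.IsSimplePole H p)
    -- `w H_w ≠ 0`, so that `g`, `ψ` and `f̃` are defined
    (hw : ∀ p ∈ K, p.2 * SmoothPole.partialW H p ≠ 0)
    -- the two orders of vanishing are constant on `K`
    (k l₀ : ℕ)
    (hk : ∀ p ∈ K, analyticOrderAt (SmoothPole.fTilde H p) 0 = k)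
    (hl₀ : ∀ p ∈ K, SmoothPole.IsVanishingOrderOn G H p l₀) :
    ∀ N : ℕ, ∀ ε : ℝ, 0 < ε → ∃ S : ℕ, ∀ p ∈ K, ∀ r s : ℕ, S ≤ s → SmoothPole.InDir H p r s →
      ‖a r s - 1 / (2 * Real.pi) * p.1 ^ (-(r : ℤ)) * p.2 ^ (-(s : ℤ)) *
          SmoothPole.expansionSum G H p k l₀ N s‖
        ≤ ε * (‖p.1 ^ (-(r : ℤ)) * p.2 ^ (-(s : ℤ))‖ * (s : ℝ) ^ (-(((N : ℝ) + 1) / (k : ℝ)))) := by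
  intro N ε hε
  have hself : ∀ p : ℂ × ℂ, p ∈ SmoothPole.polydisk p := fun p => ⟨le_rfl, le_rfl⟩
  have hb : ∀ p ∈ K, 1 ≤ k → ∀ l < l₀, SmoothPole.bCoeff G H p k l = 0 := by
    intro p hp hk1 l hl
    have hHp := hH p hp p (hself p)
    exact SmoothPole.bCoeff_eq_zero hk1 (hG p hp p (hself p)) hHp
      (SmoothPole.zeroParam_spec hHp (hmin p hp).1.1 (right_ne_zero_of_mul (hw p hp)))
      (left_ne_zero_of_mul (hw p hp))
      (by rw [← SmoothPole.partialW_eq hHp]; exact right_ne_zero_of_mul (hw p hp))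
      (hk p hp) (hl₀ p hp).1 hl
  let bound (p : ℂ × ℂ) (r s : ℕ) : Prop :=
    ‖a r s - 1 / (2 * Real.pi) * p.1 ^ (-(r : ℤ)) * p.2 ^ (-(s : ℤ)) *
        SmoothPole.expansionSum G H p k l₀ N s‖
      ≤ ε * (‖p.1 ^ (-(r : ℤ)) * p.2 ^ (-(s : ℤ))‖ * (s : ℝ) ^ (-(((N : ℝ) + 1) / (k : ℝ))))
  -- The repeated membership lets the compactness induction run over sets that need not be contained
  -- in `K`.
  suffices h : ∃ S : ℕ, ∀ p ∈ K, p ∈ K → ∀ r s : ℕ, S ≤ s → SmoothPole.InDir H p r s →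
      bound p r s by
    obtain ⟨S, hS⟩ := h
    exact ⟨S, fun p hp => hS p hp hp⟩
  refine hK.induction_on (p := fun t => ∃ S : ℕ, ∀ p ∈ t, p ∈ K → ∀ r s : ℕ, S ≤ s →
    SmoothPole.InDir H p r s → bound p r s) ⟨0, by simp⟩ ?_ ?_ ?_
  · rintro t u htu ⟨S, hS⟩
    exact ⟨S, fun p hp => hS p (htu hp)⟩
  · rintro t u ⟨S₁, h₁⟩ ⟨S₂, h₂⟩
    refine ⟨max S₁ S₂, fun p hp hpK r s hs hdir => ?_⟩
    rcases hp with hp | hp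
    · exact h₁ p hp hpK r s ((le_max_left _ _).trans hs) hdir
    · exact h₂ p hp hpK r s ((le_max_right _ _).trans hs) hdir
  · intro p₀ hp₀
    have hH₀ := hH p₀ hp₀ p₀ (hself p₀)
    have hk1 : 1 ≤ k := SmoothPole.one_le_of_analyticOrderAt (SmoothPole.analyticAt_fTilde hH₀
      (SmoothPole.zeroParam_spec hH₀ (hmin p₀ hp₀).1.1 (right_ne_zero_of_mul (hw p₀ hp₀)))
      (left_ne_zero_of_mul (hw p₀ hp₀))
      (by rw [← SmoothPole.partialW_eq hH₀]; exact right_ne_zero_of_mul (hw p₀ hp₀))) (hk p₀ hp₀)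
    have hk0 : (0 : ℝ) < k := by exact_mod_cast hk1
    -- With `n = N + 1` the sum runs over `l ≤ N` and the error is `O(s^{-(N+2)/k})`; the spare
    -- factor `s^{-1/k}` absorbs `C` into `ε`.
    obtain ⟨C, hC⟩ := SmoothPole.exists_local_expansion hF hG hH hmin hw hk (N + 1) hp₀
    have hlim : Tendsto (fun s : ℕ => C * (s : ℝ) ^ (-(1 / (k : ℝ)))) atTop (𝓝 0) := by
      have h1 := (tendsto_rpow_neg_atTop (show 0 < 1 / (k : ℝ) by positivity)).comp
        tendsto_natCast_atTop_atTop
      simpa using h1.const_mul C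
    obtain ⟨S, hS⟩ := eventually_atTop.1 (hlim.eventually_le_const hε)
    refine ⟨{p | p ∈ K → _}, mem_nhdsWithin_of_mem_nhds hC, max S 1, ?_⟩
    intro p hp hpK r s hs hdir
    have hs1 : 1 ≤ s := (le_max_right _ _).trans hs
    have hs0 : (0 : ℝ) < s := by exact_mod_cast hs1
    have h1 := hp hpK r s hs1 hdir
    rw [← SmoothPole.expansionSum_eq_sum_range (hb p hpK hk1)] at h1
    refine (SmoothPole.norm_sub_mul_le_of_norm_mul_sub_le
      (SmoothPole.fst_ne_zero_of_analyticOrderAt (hk p hpK)) (left_ne_zero_of_mul (hw p hpK))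
      (h1.trans ?_)).trans_eq
        (show ε * (s : ℝ) ^ (-(((N : ℝ) + 1) / (k : ℝ))) * _ = _ by rw [mul_assoc, mul_comm (_ ^ _)])
    have he : -((((N + 1 : ℕ) : ℝ) + 1) / (k : ℝ)) = -(1 / (k : ℝ)) + -(((N : ℝ) + 1) / k) := by
      push_cast
      ring
    rw [he, Real.rpow_add hs0, ← mul_assoc]
    gcongr
    exact hS s ((le_max_left _ _).trans hs)
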